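/- Let $0<U<a$, $M=U/a\in(0,1)$, $c=\frac{M}{a(1-M^2)}$, and for $s\in\mathbb C$ let $\lambda=\lambda(s)=-\frac{s(1+cU)}{U}$. Let $H_0^{(1)}=J_0+iY_0$ be the Hankel function of the first kind of order $0$ (principal branch) and put $$z=z(x,\xi,y)=\frac{is}{a\sqrt{1-M^2}}\sqrt{\frac{(x-\xi)^2}{1-M^2}+y^2},\qquad \zeta=z(u,\xi,y).$$ For $\operatorname{Re}s>0$ and $x\ne\xi$ define $$K(x,\xi,s)=\lim_{y\to0^+}\Big[\frac{1-M^2}{U}\frac{\partial H_0^{(1)}(z)}{\partial x}+\frac{\lambda(1-M^2)}{U}H_0^{(1)}(z)+\frac{e^{\lambda x}}{U}\Big(\lambda^2(1-M^2)-\frac{s^2}{a^2(1-M^2)}\Big)\int_{-\infty}^x e^{-\lambda u}H_0^{(1)}(\zeta)\,du\Big]-\frac{2i(1-M^2)}{\pi U}\,\frac1{x-\xi},$$ and let $\mathcal K_s[f](x)=\int_{-1}^1K(x,\xi,s)f(\xi)\,d\xi$ and $$\mathcal T^{-1}[g](x)=-\frac1\pi\,\mathrm{p.v.}\!\int_{-1}^1\sqrt{\frac{1-y^2}{1-x^2}}\,\frac{g(y)}{y-x}\,dy,\qquad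 \mathcal N_s=\frac{iU}{2(1-M^2)}\,\mathcal K_s\circ\mathcal T^{-1},\qquad \mathcal G_s=\mathcal I+\mathcal N_s .$$ **Proposition 5.2.** Let $\operatorname{Re}s>0$. The limit and the integrals defining $K(x,\xi,s)$ exist for $x\neq\xi$. For $f\in L^2[-1,1]$ the principal value $\mathcal T^{-1}[f](x)$ exists for a.e. $x\in[-1,1]$, and the integral defining $\mathcal K_s[\mathcal T^{-1}f](x)$ converges absolutely for a.e. $x\in[-1,1]$. The operator $\mathcal N_s$ is a bounded integral operator on $L^2[-1,1]$, $$\mathcal N_s[f](x)=\int_{-1}^1N(x,y,s)f(y)\,dy\quad\text{for a.e. }x,\qquad N(\cdot,\cdot,s)\in L^2([-1,1]^2),$$ that is, it is Hilbert–Schmidt. Hence $\mathcal N_s$ is compact, and $\mathcal G_s$ is a Fredholm operator on $L^2[-1,1]$. Moreover, for every $\sigma_1>0$ there is a constant $C>0$ (depending only on $a$, $U$, $\sigma_1$, and not on $s$) such that $$\int_{-1}^1\!\int_{-1}^1|N(x,y,s)|^2\,dx\,dy<C|s|^4\qquad\text{for all } s \text{ with }\operatorname{Re}s\ge\sigma_1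 .$$ -/

import Mathlib

open MeasureTheory Filter Topology Set

namespace Possio

noncomputable section

/-- The Bessel function of the first kind of order `0`. -/
def besselJ0 (z : ℂ) : ℂ :=
  ∑' k : ℕ, (-1 : ℂ) ^ k / ((k.factorial : ℂ) ^ 2) * (z / 2) ^ (2 * k)

/-- The Bessel function of the second kind of order `0` (principal branch of the logarithm):
`(2/π) (log (z/2) + γ) J₀(z) - (2/π) ∑ (-1)ᵏ hₖ (z/2)²ᵏ / (k!)²`, where `hₖ = 1 + 1/2 + ⋯ + 1/k`. -/
def besselY0 (z : ℂ) : ℂ :=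
  2 / (Real.pi : ℂ) * (Complex.log (z / 2) + (Real.eulerMascheroniConstant : ℂ)) * besselJ0 z
    - 2 / (Real.pi : ℂ) *
      ∑' k : ℕ, (-1 : ℂ) ^ k * ((harmonic k : ℚ) : ℂ) / ((k.factorial : ℂ) ^ 2) * (z / 2) ^ (2 * k)

/-- The Hankel function of the first kind of order `0`. -/
def hankel0 (z : ℂ) : ℂ := besselJ0 z + Complex.I * besselY0 z

/-- The Mach number `M = U / a`; `a` is the speed of sound and `U` the free stream velocity. -/
def mach (a U : ℝ) : ℝ := U / a

/-- `1 - M²`. -/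
def beta2 (a U : ℝ) : ℝ := 1 - mach a U ^ 2

/-- `c = M / (a (1 - M²))`. -/
def cConst (a U : ℝ) : ℝ := mach a U / (a * beta2 a U)

/-- `λ(s) = - s (1 + c U) / U`. -/
def lam (a U : ℝ) (s : ℂ) : ℂ := -(s * ((1 + cConst a U * U : ℝ) : ℂ)) / (U : ℂ)

/-- The argument `z = (i s / (a √(1 - M²))) √((x - ξ)² / (1 - M²) + (y - η)²)` of the Hankel
function, taken at `η = 0`. -/
def waveArg (a U : ℝ) (s : ℂ) (ξ y x : ℝ) : ℂ :=
  Complex.I * s / ((a * Real.sqrt (beta2 a U) : ℝ) : ℂ) *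
    ((Real.sqrt ((x - ξ) ^ 2 / beta2 a U + y ^ 2) : ℝ) : ℂ)

/-- The expression whose limit as `y → 0⁺` is the kernel of the generalized Possio equation:
`((1 - M²)/U) ∂ₓ H₀(z) + (λ (1 - M²)/U) H₀(z)
  + (e^{λ x}/U) (λ² (1 - M²) - s²/(a² (1 - M²))) ∫_{-∞}^x e^{-λ u} H₀(ζ(u)) du`. -/
def prePossio (a U : ℝ) (s : ℂ) (x ξ y : ℝ) : ℂ :=
  ((beta2 a U / U : ℝ) : ℂ) * deriv (fun x' : ℝ => hankel0 (waveArg a U s ξ y x')) x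
    + lam a U s * ((beta2 a U / U : ℝ) : ℂ) * hankel0 (waveArg a U s ξ y x)
    + Complex.exp (lam a U s * (x : ℂ)) / (U : ℂ)
      * (lam a U s ^ 2 * ((beta2 a U : ℝ) : ℂ) - s ^ 2 / ((a ^ 2 * beta2 a U : ℝ) : ℂ))
      * ∫ u in Iic x, Complex.exp (-(lam a U s * (u : ℂ))) * hankel0 (waveArg a U s ξ y u)

/-- The kernel of the generalized Possio equation. -/
def possioKernel (a U : ℝ) (s : ℂ) (x ξ : ℝ) : ℂ :=
  limUnder (𝓝[>] (0 : ℝ)) (fun y : ℝ => prePossio a U s x ξ y)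

/-- `K(x, ξ, s)`: the kernel of the generalized Possio equation minus its Cauchy part
`(2 i (1 - M²) / (π U)) / (x - ξ)`. -/
def kernelK (a U : ℝ) (s : ℂ) (x ξ : ℝ) : ℂ :=
  possioKernel a U s x ξ
    - 2 * Complex.I * ((beta2 a U : ℝ) : ℂ) / ((Real.pi * U : ℝ) : ℂ) / ((x - ξ : ℝ) : ℂ)

/-- Lebesgue measure on `[-1, 1]`. -/
abbrev μI : Measure ℝ := volume.restrict (Icc (-1 : ℝ) 1)

/-- `L²[-1, 1]`. -/
abbrev L2I : Type := Lp ℂ 2 μI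

/-- The integral for `𝒯⁻¹[g](x)` with the interval `|y - x| ≤ ε` cut out. -/
def truncTinv (g : ℝ → ℂ) (x ε : ℝ) : ℂ :=
  -(1 / (Real.pi : ℂ)) *
    ∫ y in {y : ℝ | y ∈ Icc (-1 : ℝ) 1 ∧ ε < |y - x|},
      ((Real.sqrt ((1 - y ^ 2) / (1 - x ^ 2)) : ℝ) : ℂ) * g y / ((y - x : ℝ) : ℂ)

/-- `𝒯⁻¹[g](x) = -(1/π) p.v. ∫_{-1}^{1} √((1 - y²)/(1 - x²)) g(y) / (y - x) dy`. -/
def Tinv (g : ℝ → ℂ) (x : ℝ) : ℂ := limUnder (𝓝[>] (0 : ℝ)) (truncTinv g x)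

/-- `𝒦_s[f](x) = ∫_{-1}^{1} K(x, ξ, s) f(ξ) dξ`. -/
def opK (a U : ℝ) (s : ℂ) (f : ℝ → ℂ) (x : ℝ) : ℂ :=
  ∫ ξ, kernelK a U s x ξ * f ξ ∂μI

/-- `(i U / (2 (1 - M²))) 𝒦_s[𝒯⁻¹[f]](x)`. -/
def opN (a U : ℝ) (s : ℂ) (f : ℝ → ℂ) (x : ℝ) : ℂ :=
  Complex.I * (U : ℂ) / ((2 * beta2 a U : ℝ) : ℂ) * opK a U s (Tinv f) x

end

end Possio

/-!
Write `w(y) = √(1 - y²)`. The two facts behind the result are that the singularity of the Possio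
kernel beyond its Cauchy part is mild, and that the inverse finite Hilbert transform is, after
conjugation with powers of `w`, a bounded operator given by orthonormal systems.

*The kernel.* On the upper half plane the Hankel function is a Macdonald function:
`H₀(i w) = -(2 i / π) K₀(w)` for `Re w > 0` (`hankel0_I_mul`), where
`K₀(w) = ∫₀^∞ e^{-w cosh t} dt`. Both sides satisfy the same first order system, and they have the
same logarithmic behaviour at `0`, which a Wronskian argument turns into equality. The integral
representation gives exponential decay together with explicit bounds near `0`, so the limit
`y → 0⁺` may be taken by dominated convergence (`tendsto_prePossio`). The outcome is
`K(x, ξ, s) = κ(x - ξ)` with `κ = reducedKernel a U s`, in which the singularity `1 / (x - ξ)` has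
been cancelled, and `|κ(X)| ≤ C |s|² (1 + |X|^{-1/4})`, uniformly for `Re s ≥ σ₁`
(`exists_norm_reducedKernel_le`).

*The inverse Hilbert transform.* The functions `eₙ = √(2/π) w^{1/2} Uₙ` and
`cₙ = √(2/π) w^{-1/2} Tₙ₊₁` are orthonormal in `L²[-1, 1]`, so `V = ∑ ⟨eₙ, ·⟩ cₙ` (`transfer`) is
bounded. The generating functions of the Chebyshev polynomials say that, off the real axis, the
Cauchy integral of `w^{1/2} F` is `√(z² - 1)` times the Cauchy integral of `w^{-1/2} V F`
(`integral_cauchy_eq_mul_integral_cauchy`). Letting `z → x` from both sides, at a common Lebesgue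
point `x` of the two densities, yields the principal value and the formula
`𝒯⁻¹ f = w^{-1/2} V (w^{1/2} f)` almost everywhere (`ae_tendsto_truncTinv`).

*Hilbert–Schmidt property.* Hence `𝒩_s f` is a constant times `T_k V (w^{1/2} f)`, where `T_k` has
the kernel `k(x, ξ) = κ(x - ξ) w(ξ)^{-1/2}`. Since `|k|²` is bounded by `C² |s|⁴` times an
integrable function, `T_k` is Hilbert–Schmidt. By Bessel's inequality so is `T_k V`, with kernel
`∑ (T_k cₙ)(x) eₙ(y)` of norm at most `‖k‖` (`exists_hasSum_tensor`); this gives the kernel of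
`𝒩_s` and the bound by `|s|⁴`. Truncating the series approximates `𝒩_s` by operators of finite
rank, so `𝒩_s` is compact and `1 + 𝒩_s` is Fredholm.
-/


namespace Possio

noncomputable section

/-! ### The Macdonald functions -/

/-- The moments `∫₀^∞ coshⁿ t · e^{-w cosh t} dt` of the Macdonald integral. For `n = 0` and `n = 1`
these are the Macdonald functions `K₀(w)` and `K₁(w)` on the half plane `Re w > 0`. -/
def macdonald (n : ℕ) (w : ℂ) : ℂ :=
  ∫ t in Ioi (0 : ℝ), ((Real.cosh t ^ n : ℝ) : ℂ) * Complex.exp (-(w * (Real.cosh t : ℝ)))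

lemma exp_half_le_cosh (t : ℝ) : Real.exp t / 2 ≤ Real.cosh t := by
  rw [Real.cosh_eq]; have := Real.exp_pos (-t); linarith

lemma integrableOn_cosh_pow_mul_exp (n : ℕ) {q : ℝ} (hq : 0 < q) :
    IntegrableOn (fun t : ℝ => Real.cosh t ^ n * Real.exp (-(q * Real.cosh t))) (Ioi 0) := by
  have hexp : IntegrableOn (fun t : ℝ => ((n + 1).factorial / q ^ (n + 1) * 2) * Real.exp (-t))
      (Ioi 0) := (integrableOn_exp_neg_Ioi 0).const_mul _
  refine hexp.mono' (by fun_prop) (Eventually.of_forall fun t => ?_)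
  have hc : 0 < Real.cosh t := Real.cosh_pos t
  rw [Real.norm_of_nonneg (by positivity)]
  have h1 := Real.pow_div_factorial_le_exp (q * Real.cosh t) (by positivity) (n + 1)
  have h2 : Real.exp (-t) * Real.cosh t ≥ 1 / 2 := by
    have := exp_half_le_cosh t
    have h3 : Real.exp (-t) * Real.exp t = 1 := by rw [← Real.exp_add]; simp
    nlinarith [Real.exp_pos (-t)]
  rw [Real.exp_neg (q * _), ← div_eq_mul_inv, div_le_iff₀ (Real.exp_pos _)]
  have hf : (0 : ℝ) < (n + 1).factorial := by positivity
  rw [div_le_iff₀ hf, mul_pow] at h1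
  have hA : Real.cosh t ^ (n + 1) * q ^ (n + 1) ≤
      Real.exp (q * Real.cosh t) * (n + 1).factorial := by linarith
  have hB : Real.cosh t ^ n ≤ Real.cosh t ^ n * (2 * (Real.exp (-t) * Real.cosh t)) :=
    le_mul_of_one_le_right (by positivity) (by linarith)
  calc Real.cosh t ^ n ≤ Real.cosh t ^ n * (2 * (Real.exp (-t) * Real.cosh t)) := hB
    _ = 2 * Real.exp (-t) * (Real.cosh t ^ (n + 1) * q ^ (n + 1)) / q ^ (n + 1) := by
        rw [pow_succ (Real.cosh t)]
        field_simp
    _ ≤ 2 * Real.exp (-t) * (Real.exp (q * Real.cosh t) * (n + 1).factorial) / q ^ (n + 1) := by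
        gcongr
    _ = _ := by ring

lemma norm_macdonald_integrand (n : ℕ) (w : ℂ) (t : ℝ) :
    ‖((Real.cosh t ^ n : ℝ) : ℂ) * Complex.exp (-(w * (Real.cosh t : ℝ)))‖ =
      Real.cosh t ^ n * Real.exp (-(w.re * Real.cosh t)) := by
  rw [norm_mul, Complex.norm_exp, Complex.norm_real, Real.norm_of_nonneg]
  · simp only [Complex.neg_re, Complex.re_mul_ofReal]
  · have := Real.cosh_pos t; positivity

lemma continuous_macdonald_integrand (n : ℕ) (w : ℂ) :
    Continuous fun t : ℝ =>
      ((Real.cosh t ^ n : ℝ) : ℂ) * Complex.exp (-(w * (Real.cosh t : ℝ))) := by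
  have := Real.continuous_cosh
  fun_prop

lemma integrableOn_macdonald (n : ℕ) {w : ℂ} (hw : 0 < w.re) :
    IntegrableOn (fun t : ℝ =>
      ((Real.cosh t ^ n : ℝ) : ℂ) * Complex.exp (-(w * (Real.cosh t : ℝ)))) (Ioi 0) := by
  refine (integrableOn_cosh_pow_mul_exp n hw).mono'
    (continuous_macdonald_integrand n w).aestronglyMeasurable (Eventually.of_forall fun t => ?_)
  exact (norm_macdonald_integrand n w t).le

lemma hasDerivAt_macdonald (n : ℕ) {w : ℂ} (hw : 0 < w.re) :
    HasDerivAt (macdonald n) (-macdonald (n + 1) w) w := by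
  have hball : ∀ v ∈ Metric.ball w (w.re / 2), w.re / 2 < v.re := by
    intro v hv
    have h1 := (Complex.abs_re_le_norm (v - w)).trans_lt (mem_ball_iff_norm.1 hv)
    rw [Complex.sub_re, abs_lt] at h1
    linarith [h1.1]
  have key := hasDerivAt_integral_of_dominated_loc_of_deriv_le
    (μ := volume.restrict (Ioi (0 : ℝ))) (x₀ := w)
    (F := fun w t => ((Real.cosh t ^ n : ℝ) : ℂ) * Complex.exp (-(w * (Real.cosh t : ℝ))))
    (F' := fun w t =>
      -(((Real.cosh t ^ (n + 1) : ℝ) : ℂ) * Complex.exp (-(w * (Real.cosh t : ℝ)))))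
    (bound := fun t => Real.cosh t ^ (n + 1) * Real.exp (-(w.re / 2 * Real.cosh t)))
    (Metric.ball_mem_nhds w (half_pos hw))
    (Eventually.of_forall fun v => (continuous_macdonald_integrand n v).aestronglyMeasurable)
    (integrableOn_macdonald n hw)
    (continuous_macdonald_integrand (n + 1) w).neg.aestronglyMeasurable
    (Eventually.of_forall fun t v hv => ?_)
    (integrableOn_cosh_pow_mul_exp (n + 1) (half_pos hw))
    (Eventually.of_forall fun t v hv => ?_)
  · have h := key.2
    rw [integral_neg] at h
    exact h
  · rw [norm_neg, norm_macdonald_integrand]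
    have := hball v hv
    have hc := Real.cosh_pos t
    gcongr
  · have h1 : HasDerivAt (fun v : ℂ => -(v * (Real.cosh t : ℝ))) (-((Real.cosh t : ℝ) : ℂ)) v := by
      simpa using! ((hasDerivAt_id v).mul_const ((Real.cosh t : ℝ) : ℂ)).neg
    convert! h1.cexp.const_mul ((Real.cosh t ^ n : ℝ) : ℂ) using 1
    push_cast
    ring

/-- Bessel's equation, integrated once by parts under the Macdonald integral. -/
lemma macdonald_two {w : ℂ} (hw : 0 < w.re) :
    w * macdonald 2 w = macdonald 1 w + w * macdonald 0 w := by
  have hd : ∀ t ∈ Ioi (0 : ℝ), HasDerivAt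
      (fun t : ℝ => -((Real.sinh t : ℝ) : ℂ) * Complex.exp (-(w * (Real.cosh t : ℝ))))
      (w * (((Real.cosh t ^ 2 : ℝ) : ℂ) * Complex.exp (-(w * (Real.cosh t : ℝ))))
        - ((Real.cosh t ^ 1 : ℝ) : ℂ) * Complex.exp (-(w * (Real.cosh t : ℝ)))
        - w * (((Real.cosh t ^ 0 : ℝ) : ℂ) * Complex.exp (-(w * (Real.cosh t : ℝ))))) t := by
    intro t _
    have h1 : HasDerivAt (fun t : ℝ => -((Real.sinh t : ℝ) : ℂ)) (-((Real.cosh t : ℝ) : ℂ)) t :=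
      (Real.hasDerivAt_sinh t).ofReal_comp.neg
    have h2 : HasDerivAt (fun t : ℝ => -(w * ((Real.cosh t : ℝ) : ℂ)))
        (-(w * ((Real.sinh t : ℝ) : ℂ))) t :=
      ((Real.hasDerivAt_cosh t).ofReal_comp.const_mul w).neg
    convert! h1.mul h2.cexp using 1
    have h3 : ((Real.cosh t ^ 2 : ℝ) : ℂ) = ((Real.sinh t : ℝ) : ℂ) ^ 2 + 1 := by
      rw [Real.cosh_sq]; push_cast; ring
    rw [h3]
    push_cast
    ring
  have hint := (((integrableOn_macdonald 2 hw).const_mul w).sub (integrableOn_macdonald 1 hw)).sub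
    ((integrableOn_macdonald 0 hw).const_mul w)
  have hlim : Tendsto
      (fun t : ℝ => -((Real.sinh t : ℝ) : ℂ) * Complex.exp (-(w * (Real.cosh t : ℝ)))) atTop
      (𝓝 0) := by
    have hb : Tendsto (fun t : ℝ => (Real.cosh t) * Real.exp (-(w.re * Real.cosh t))) atTop
        (𝓝 0) := by
      have hcosh : Tendsto Real.cosh atTop atTop :=
        tendsto_atTop_mono exp_half_le_cosh
          (Real.tendsto_exp_atTop.atTop_div_const (by norm_num))
      have h := (Real.tendsto_pow_mul_exp_neg_atTop_nhds_zero 1).comp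
        (hcosh.const_mul_atTop hw)
      have h' := h.const_mul (w.re⁻¹)
      rw [mul_zero] at h'
      refine h'.congr fun t => ?_
      simp only [Function.comp, pow_one]
      field_simp
    refine squeeze_zero_norm (fun t => ?_) hb
    rw [norm_mul, norm_neg, Complex.norm_real, Complex.norm_exp]
    simp only [Complex.neg_re, Complex.re_mul_ofReal]
    gcongr
    refine abs_le_of_sq_le_sq ?_ (Real.cosh_pos t).le
    rw [Real.cosh_sq]
    linarith
  have h0 := integral_Ioi_of_hasDerivAt_of_tendsto (a := (0 : ℝ))
    (f := fun t : ℝ => -((Real.sinh t : ℝ) : ℂ) * Complex.exp (-(w * (Real.cosh t : ℝ))))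
    (by
      have h1 := Real.continuous_sinh
      have h2 := Real.continuous_cosh
      exact Continuous.continuousWithinAt (by fun_prop)) hd hint hlim
  rw [integral_sub, integral_sub, integral_const_mul, integral_const_mul] at h0
  · simp only [Real.sinh_zero, Complex.ofReal_zero, neg_zero, zero_mul, sub_zero] at h0
    unfold macdonald
    linear_combination h0
  · exact (integrableOn_macdonald 2 hw).const_mul w
  · exact integrableOn_macdonald 1 hw
  · exact ((integrableOn_macdonald 2 hw).const_mul w).sub (integrableOn_macdonald 1 hw)
  · exact (integrableOn_macdonald 0 hw).const_mul w

lemma hasDerivAt_mul_macdonald_one {w : ℂ} (hw : 0 < w.re) :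
    HasDerivAt (fun w => w * macdonald 1 w) (-(w * macdonald 0 w)) w := by
  convert! (hasDerivAt_id w).mul (hasDerivAt_macdonald 1 hw) using 1
  have := macdonald_two hw
  simp only [id]
  linear_combination this

/-- The bound comes from `cosh t ≥ 1/2 + eᵗ/4` and `e^{-u} ≤ u^{-1/4}`. The exponent `1/4` leaves
the square of the bound integrable at `0`. -/
lemma norm_macdonald_zero_le {w : ℂ} (hw : 0 < w.re) :
    ‖macdonald 0 w‖ ≤
      8 * (w.re ^ (-(1 / 4) : ℝ) * Real.exp (-(w.re / 2))) := by
  set q := w.re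
  have hI : IntegrableOn (fun t : ℝ => Real.exp (-(q / 2)) * (q / 4) ^ (-(1 / 4) : ℝ) *
      Real.exp (-(1 / 4) * t)) (Ioi 0) := (integrableOn_exp_mul_Ioi (by norm_num) 0).const_mul _
  have hle : ‖macdonald 0 w‖ ≤ ∫ t in Ioi (0 : ℝ), Real.exp (-(q / 2)) * (q / 4) ^ (-(1 / 4) : ℝ) *
      Real.exp (-(1 / 4) * t) := by
    refine norm_integral_le_of_norm_le hI (Eventually.of_forall fun t => ?_)
    rw [norm_macdonald_integrand, pow_zero, one_mul]
    have hc := Real.one_le_cosh t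
    have hc' := exp_half_le_cosh t
    have hu : 0 < q / 4 * Real.exp t := by positivity
    have h1 : Real.exp (-(q / 4 * Real.exp t)) ≤ (q / 4 * Real.exp t) ^ (-(1 / 4) : ℝ) := by
      rw [Real.rpow_def_of_pos hu]
      apply Real.exp_le_exp.2
      have := Real.log_le_sub_one_of_pos hu
      linarith
    rw [Real.mul_rpow (by positivity) (Real.exp_pos _).le, ← Real.exp_mul, mul_comm t] at h1
    calc Real.exp (-(q * Real.cosh t))
        ≤ Real.exp (-(q / 2)) * Real.exp (-(q / 4 * Real.exp t)) := by
          rw [← Real.exp_add]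
          apply Real.exp_le_exp.2
          nlinarith
      _ ≤ _ := by
          rw [mul_assoc]
          gcongr
  refine hle.trans ?_
  rw [integral_const_mul, integral_exp_mul_Ioi (by norm_num)]
  rw [Real.div_rpow hw.le (by norm_num), mul_zero, Real.exp_zero]
  have h4 : (1 : ℝ) / 2 ≤ (4 : ℝ) ^ (-(1 / 4) : ℝ) := by
    have : (4 : ℝ) ^ (-(1 / 2) : ℝ) ≤ (4 : ℝ) ^ (-(1 / 4) : ℝ) :=
      Real.rpow_le_rpow_of_exponent_le (by norm_num) (by norm_num)
    refine le_trans ?_ this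
    rw [Real.rpow_neg (by norm_num), ← Real.sqrt_eq_rpow,
      show (4 : ℝ) = 2 ^ 2 by norm_num, Real.sqrt_sq (by norm_num)]
    norm_num
  have hX : 0 ≤ q ^ (-(1 / 4) : ℝ) * Real.exp (-(q / 2)) := by positivity
  have h5 : ((4 : ℝ) ^ (-(1 / 4) : ℝ))⁻¹ ≤ 2 := by
    rw [inv_le_comm₀ (by positivity) (by norm_num)]; linarith
  calc _ = 4 * (((4 : ℝ) ^ (-(1 / 4) : ℝ))⁻¹ * (q ^ (-(1 / 4) : ℝ) * Real.exp (-(q / 2)))) := by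
        rw [div_eq_mul_inv]; ring
    _ ≤ 4 * (2 * (q ^ (-(1 / 4) : ℝ) * Real.exp (-(q / 2)))) := by gcongr
    _ = _ := by ring

lemma integral_cosh_mul_exp_neg_sinh {w : ℂ} (hw : 0 < w.re) :
    IntegrableOn (fun t : ℝ =>
      (Real.cosh t : ℂ) * Complex.exp (-(w * (Real.sinh t : ℝ)))) (Ioi 0) ∧
    w * ∫ t in Ioi (0 : ℝ), (Real.cosh t : ℂ) * Complex.exp (-(w * (Real.sinh t : ℝ))) = 1 := by
  have hsinh : Tendsto Real.sinh atTop atTop := by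
    refine tendsto_atTop_mono' _ ?_ tendsto_id
    filter_upwards [eventually_ge_atTop 0] with t ht
    exact Real.self_le_sinh_iff.2 ht
  have hderR : ∀ t ∈ Ioi (0 : ℝ), HasDerivAt (fun t => -(w.re⁻¹) * Real.exp (-(w.re * Real.sinh t)))
      (Real.cosh t * Real.exp (-(w.re * Real.sinh t))) t := by
    intro t _
    have h2 : HasDerivAt (fun t => -(w.re * Real.sinh t)) (-(w.re * Real.cosh t)) t :=
      ((Real.hasDerivAt_sinh t).const_mul w.re).neg
    convert! h2.exp.const_mul (-(w.re⁻¹)) using 1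
    field_simp
  have hlimR : Tendsto (fun t => Real.exp (-(w.re * Real.sinh t))) atTop (𝓝 0) :=
    Real.tendsto_exp_neg_atTop_nhds_zero.comp (hsinh.const_mul_atTop hw)
  have hIR : IntegrableOn (fun t => Real.cosh t * Real.exp (-(w.re * Real.sinh t))) (Ioi 0) := by
    refine integrableOn_Ioi_deriv_of_nonneg (a := 0) ?_ hderR ?_
      (hlimR.const_mul (-(w.re⁻¹)))
    · have := Real.continuous_sinh
      exact Continuous.continuousWithinAt (by fun_prop)
    · intro t _
      have := Real.cosh_pos t
      positivity
  have hnorm : ∀ t : ℝ, ‖(Real.cosh t : ℂ) * Complex.exp (-(w * (Real.sinh t : ℝ)))‖ =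
      Real.cosh t * Real.exp (-(w.re * Real.sinh t)) := by
    intro t
    rw [norm_mul, Complex.norm_exp, Complex.norm_real, Real.norm_of_nonneg (Real.cosh_pos t).le]
    simp only [Complex.neg_re, Complex.re_mul_ofReal]
  have hcont : Continuous fun t : ℝ =>
      (Real.cosh t : ℂ) * Complex.exp (-(w * (Real.sinh t : ℝ))) := by
    have h1 := Real.continuous_sinh
    have h2 := Real.continuous_cosh
    fun_prop
  have hI : IntegrableOn (fun t : ℝ =>
      (Real.cosh t : ℂ) * Complex.exp (-(w * (Real.sinh t : ℝ)))) (Ioi 0) :=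
    hIR.mono' hcont.aestronglyMeasurable (Eventually.of_forall fun t => (hnorm t).le)
  refine ⟨hI, ?_⟩
  have hder : ∀ t ∈ Ioi (0 : ℝ), HasDerivAt
      (fun t : ℝ => -Complex.exp (-(w * (Real.sinh t : ℝ))))
      (w * ((Real.cosh t : ℂ) * Complex.exp (-(w * (Real.sinh t : ℝ))))) t := by
    intro t _
    have h2 : HasDerivAt (fun t : ℝ => -(w * ((Real.sinh t : ℝ) : ℂ)))
        (-(w * ((Real.cosh t : ℝ) : ℂ))) t :=
      ((Real.hasDerivAt_sinh t).ofReal_comp.const_mul w).neg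
    convert! h2.cexp.neg using 1
    ring
  have hlim : Tendsto (fun t : ℝ => -Complex.exp (-(w * (Real.sinh t : ℝ)))) atTop (𝓝 0) := by
    refine squeeze_zero_norm (fun t => ?_) hlimR
    rw [norm_neg, Complex.norm_exp]
    simp only [Complex.neg_re, Complex.re_mul_ofReal, le_refl]
  have h0 := integral_Ioi_of_hasDerivAt_of_tendsto (a := (0 : ℝ))
    (f := fun t : ℝ => -Complex.exp (-(w * (Real.sinh t : ℝ))))
    (by
      have h1 := Real.continuous_sinh
      exact Continuous.continuousWithinAt (by fun_prop)) hder (hI.const_mul w) hlim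
  rw [integral_const_mul] at h0
  simpa using h0

lemma norm_exp_sub_exp_le {a b : ℂ} {m : ℝ} (ha : a.re ≤ m) (hb : b.re ≤ m) :
    ‖Complex.exp a - Complex.exp b‖ ≤ Real.exp m * ‖a - b‖ := by
  refine (convex_halfSpace_re_le m).norm_image_sub_le_of_norm_hasDerivWithin_le
    (f := Complex.exp) (f' := Complex.exp) (fun x _ => (Complex.hasDerivAt_exp x).hasDerivWithinAt)
    (fun x hx => ?_) hb ha
  rw [Complex.norm_exp]
  exact Real.exp_le_exp.2 hx

/-- `w K₁(w)` is compared with `w ∫₀^∞ cosh t · e^{-w sinh t} dt = 1`. -/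
lemma norm_mul_macdonald_one_sub_one_le {w : ℂ} (hw : 0 < w.re) :
    ‖w * macdonald 1 w - 1‖ ≤ ‖w‖ ^ 2 / w.re := by
  obtain ⟨hI, h1⟩ := integral_cosh_mul_exp_neg_sinh hw
  have hwre : 0 < ((w.re : ℝ) : ℂ).re := by simpa using hw
  obtain ⟨hIR, h1R⟩ := integral_cosh_mul_exp_neg_sinh hwre
  have hRe : ∀ t : ℝ, (Real.cosh t : ℂ) * Complex.exp (-(((w.re : ℝ) : ℂ) * (Real.sinh t : ℝ))) =
      ((Real.cosh t * Real.exp (-(w.re * Real.sinh t)) : ℝ) : ℂ) := by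
    intro t; push_cast; rfl
  simp only [hRe] at hIR h1R
  have hIR' : IntegrableOn (fun t => Real.cosh t * Real.exp (-(w.re * Real.sinh t))) (Ioi 0) := by
    exact hIR.re
  rw [integral_complex_ofReal, ← Complex.ofReal_mul, Complex.ofReal_eq_one] at h1R
  rw [← h1, ← mul_sub, macdonald, ← integral_sub (integrableOn_macdonald 1 hw) hI, norm_mul]
  have hle : ‖∫ t in Ioi (0 : ℝ),
      (((Real.cosh t ^ 1 : ℝ) : ℂ) * Complex.exp (-(w * (Real.cosh t : ℝ))) -
        (Real.cosh t : ℂ) * Complex.exp (-(w * (Real.sinh t : ℝ))))‖ ≤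
      ∫ t in Ioi (0 : ℝ), ‖w‖ * (Real.cosh t * Real.exp (-(w.re * Real.sinh t))) := by
    refine norm_integral_le_of_norm_le (hIR'.const_mul _) ?_
    filter_upwards [self_mem_ae_restrict measurableSet_Ioi] with t ht
    rw [pow_one, ← mul_sub, norm_mul, Complex.norm_real, Real.norm_of_nonneg (Real.cosh_pos t).le]
    have h2 := norm_exp_sub_exp_le (a := -(w * (Real.cosh t : ℝ))) (b := -(w * (Real.sinh t : ℝ)))
      (m := -(w.re * Real.sinh t))
      (by
        simp only [Complex.neg_re, Complex.re_mul_ofReal]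
        have := Real.sinh_lt_cosh t
        nlinarith)
      (by simp only [Complex.neg_re, Complex.re_mul_ofReal, le_refl])
    have h3 : ‖-(w * (Real.cosh t : ℝ)) - -(w * (Real.sinh t : ℝ))‖ ≤ ‖w‖ := by
      have : -(w * (Real.cosh t : ℝ)) - -(w * (Real.sinh t : ℝ)) =
          -(w * ((Real.exp (-t) : ℝ) : ℂ)) := by
        rw [← Real.cosh_sub_sinh]; push_cast; ring
      rw [this, norm_neg, norm_mul, Complex.norm_real, Real.norm_of_nonneg (Real.exp_pos _).le]
      have h4 : Real.exp (-t) ≤ 1 := Real.exp_le_one_iff.2 (by linarith [mem_Ioi.1 ht])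
      nlinarith [norm_nonneg w]
    calc _ ≤ Real.cosh t * (Real.exp (-(w.re * Real.sinh t)) * ‖w‖) := by
          have := Real.cosh_pos t
          gcongr
          exact h2.trans (by gcongr)
      _ = _ := by ring
  rw [integral_const_mul, eq_inv_of_mul_eq_one_right h1R] at hle
  calc _ ≤ ‖w‖ * (‖w‖ * (w.re)⁻¹) := by gcongr
    _ = _ := by ring

/-! ### Power series with factorially decaying coefficients -/

/-- The sum of the power series with coefficients `c`. -/
def powerSum (c : ℕ → ℂ) (q : ℂ) : ℂ := ∑' k, c k * q ^ k

/-- Coefficients that decay at least like `C / k!`, so that their power series is entire. -/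
def FactorialDecay (c : ℕ → ℂ) : Prop := ∃ C : ℝ, ∀ k, ‖c k‖ ≤ C / (k.factorial : ℝ)

lemma FactorialDecay.summable {c : ℕ → ℂ} (hc : FactorialDecay c) (q : ℂ) :
    Summable fun k => c k * q ^ k := by
  obtain ⟨C, hC⟩ := hc
  refine Summable.of_norm_bounded ((Real.summable_pow_div_factorial ‖q‖).mul_left C) fun k => ?_
  rw [norm_mul, norm_pow]
  calc _ ≤ C / (k.factorial : ℝ) * ‖q‖ ^ k := by gcongr; exact hC k
    _ = _ := by ring

lemma hasDerivAt_powerSum {c d : ℕ → ℂ} (hc : FactorialDecay c) (hd : FactorialDecay d)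
    (hcd : ∀ k, d k = (k + 1) * c (k + 1)) (q : ℂ) :
    HasDerivAt (powerSum c) (powerSum d q) q := by
  set R := ‖q‖ + 1 with hR
  have hRpos : 0 < R := by positivity
  obtain ⟨C, hC⟩ := hd
  have hu : Summable fun k : ℕ => ‖c k‖ * k * R ^ (k - 1) := by
    rw [← summable_nat_add_iff 1]
    refine Summable.of_nonneg_of_le (fun k => by positivity) (fun k => ?_)
      ((Real.summable_pow_div_factorial R).mul_left C)
    have h1 : ‖c (k + 1)‖ * ((k + 1 : ℕ) : ℝ) = ‖d k‖ := by
      rw [hcd, norm_mul, mul_comm]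
      congr 1
      have : ((k : ℂ) + 1) = ((k + 1 : ℕ) : ℂ) := by push_cast; ring
      rw [this, Complex.norm_natCast]
    rw [h1, Nat.add_sub_cancel]
    calc _ ≤ C / (k.factorial : ℝ) * R ^ k := by gcongr; exact hC k
      _ = _ := by ring
  have key := hasDerivAt_tsum_of_isPreconnected (𝕜 := ℂ) (t := Metric.ball (0 : ℂ) R) (y₀ := 0)
    (y := q) (g := fun k q => c k * q ^ k) (g' := fun k q => c k * (k * q ^ (k - 1))) hu
    Metric.isOpen_ball (convex_ball (0 : ℂ) R).isPreconnected
    (fun k y _ => (hasDerivAt_pow k y).const_mul _)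
    (fun k y hy => by
      rw [norm_mul, norm_mul, norm_pow, Complex.norm_natCast, mul_assoc]
      have : ‖y‖ ≤ R := (mem_ball_zero_iff.1 hy).le
      gcongr)
    (by simpa using hRpos) (hc.summable 0) (by simp [hR])
  convert! key using 1
  have hs : Summable fun k : ℕ => c k * (k * q ^ (k - 1)) := by
    refine Summable.of_norm_bounded hu fun k => ?_
    rw [norm_mul, norm_mul, norm_pow, Complex.norm_natCast, mul_assoc]
    have : ‖q‖ ≤ R := by linarith
    gcongr
  rw [hs.tsum_eq_zero_add]
  simp only [powerSum, Nat.cast_zero, zero_mul, mul_zero, zero_add, Nat.add_sub_cancel, hcd]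
  congr 1
  ext k
  push_cast
  ring

lemma mul_powerSum {d e : ℕ → ℂ} (he : FactorialDecay e)
    (hed : ∀ k, e (k + 1) = d k) (he0 : e 0 = 0) (q : ℂ) :
    q * powerSum d q = powerSum e q := by
  unfold powerSum
  rw [(he.summable q).tsum_eq_zero_add, he0, zero_mul, zero_add, ← tsum_mul_left]
  congr 1
  ext k
  rw [hed]
  ring

lemma powerSum_zero (c : ℕ → ℂ) : powerSum c 0 = c 0 := by
  unfold powerSum
  rw [tsum_eq_single 0 (fun k hk => by simp [hk])]
  simp

lemma powerSum_add {c d : ℕ → ℂ} (hc : FactorialDecay c) (hd : FactorialDecay d) (q : ℂ) :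
    powerSum (fun k => c k + d k) q = powerSum c q + powerSum d q := by
  unfold powerSum
  rw [← (hc.summable q).tsum_add (hd.summable q)]
  congr 1
  ext k
  ring

lemma harmonic_le_self (k : ℕ) : harmonic k ≤ k := by
  unfold harmonic
  calc ∑ i ∈ Finset.range k, ((i + 1 : ℕ) : ℚ)⁻¹ ≤ ∑ i ∈ Finset.range k, (1 : ℚ) := by
        refine Finset.sum_le_sum fun i _ => inv_le_one_of_one_le₀ ?_
        exact_mod_cast Nat.succ_le_succ (Nat.zero_le i)
    _ = k := by simp

lemma norm_harmonic_le (k : ℕ) : ‖((harmonic k : ℚ) : ℂ)‖ ≤ k := by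
  have h : ((harmonic k : ℚ) : ℂ) = (((harmonic k : ℚ) : ℝ) : ℂ) := by push_cast; rfl
  have h0 : 0 ≤ harmonic k := by
    unfold harmonic; positivity
  rw [h, Complex.norm_real, Real.norm_of_nonneg (by exact_mod_cast h0)]
  exact_mod_cast harmonic_le_self k

/-- Coefficients of `I₀` in the variable `(w/2)²`. -/
def coeffI (k : ℕ) : ℂ := 1 / (k.factorial : ℂ) ^ 2

/-- Coefficients of the non-logarithmic part of `K₀` in the variable `(w/2)²`. -/
def coeffH (k : ℕ) : ℂ := ((harmonic k : ℚ) : ℂ) / (k.factorial : ℂ) ^ 2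

lemma coeffI_succ (k : ℕ) : (k + 1) ^ 2 * coeffI (k + 1) = coeffI k := by
  unfold coeffI
  have h1 : (k.factorial : ℂ) ≠ 0 := by exact_mod_cast k.factorial_ne_zero
  have h2 : (k + 1 : ℂ) ≠ 0 := by exact_mod_cast k.succ_ne_zero
  rw [Nat.factorial_succ]
  push_cast
  field_simp

lemma coeffH_succ (k : ℕ) :
    (k + 1) ^ 2 * coeffH (k + 1) = coeffH k + (k + 1) * coeffI (k + 1) := by
  unfold coeffH coeffI
  have h1 : (k.factorial : ℂ) ≠ 0 := by exact_mod_cast k.factorial_ne_zero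
  have h2 : (k + 1 : ℂ) ≠ 0 := by exact_mod_cast k.succ_ne_zero
  rw [Nat.factorial_succ, harmonic_succ]
  push_cast
  field_simp

/-- All the coefficient sequences in use are of this size. -/
lemma factorialDecay_of_le {c : ℕ → ℂ} (h : ∀ k, ‖c k‖ ≤ (k : ℝ) ^ 2 / (k.factorial : ℝ) ^ 2) :
    FactorialDecay fun k => c k := by
  refine ⟨2, fun k => (h k).trans ?_⟩
  have hk : (0 : ℝ) < k.factorial := by exact_mod_cast k.factorial_pos
  rw [div_le_div_iff₀ (by positivity) hk, sq (k.factorial : ℝ), ← mul_assoc]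
  gcongr
  have h2 : k ^ 2 ≤ 2 * k.factorial := by
    rcases k with _ | _ | _ | _ | k
    · simp
    · simp
    · simp [Nat.factorial]
    · simp [Nat.factorial]
    · rw [Nat.factorial_succ, Nat.factorial_succ, Nat.factorial_succ]
      have := Nat.factorial_pos (k + 1)
      nlinarith [Nat.mul_le_mul_left ((k + 4) * (k + 3) * (k + 2)) this]
  exact_mod_cast h2

lemma norm_coeffI (k : ℕ) : ‖coeffI k‖ = 1 / (k.factorial : ℝ) ^ 2 := by
  simp [coeffI]

lemma factorialDecay_coeffI : FactorialDecay coeffI := by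
  refine ⟨1, fun k => ?_⟩
  rw [norm_coeffI]
  have hk : (1 : ℝ) ≤ k.factorial := by exact_mod_cast k.factorial_pos
  gcongr
  nlinarith

lemma norm_coeffH_le (k : ℕ) : ‖coeffH k‖ ≤ (k : ℝ) / (k.factorial : ℝ) ^ 2 := by
  rw [coeffH, norm_div, norm_pow, Complex.norm_natCast]
  gcongr
  exact norm_harmonic_le k

lemma factorialDecay_coeffH : FactorialDecay coeffH := by
  refine factorialDecay_of_le fun k => (norm_coeffH_le k).trans ?_
  gcongr
  exact_mod_cast Nat.le_self_pow two_ne_zero k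

lemma factorialDecay_mul_coeffI : FactorialDecay fun k => k * coeffI k := by
  refine factorialDecay_of_le fun k => ?_
  rw [norm_mul, norm_coeffI, Complex.norm_natCast, mul_one_div]
  gcongr
  exact_mod_cast Nat.le_self_pow two_ne_zero k

lemma factorialDecay_mul_coeffH : FactorialDecay fun k => k * coeffH k := by
  refine factorialDecay_of_le fun k => ?_
  rw [norm_mul, Complex.norm_natCast, sq, mul_div_assoc]
  gcongr
  exact norm_coeffH_le k

lemma FactorialDecay.of_shift {c d : ℕ → ℂ} (hd : FactorialDecay d)
    (h : ∀ k, ‖c k‖ ≤ ‖d k‖) : FactorialDecay c := by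
  obtain ⟨C, hC⟩ := hd
  exact ⟨C, fun k => (h k).trans (hC k)⟩

lemma factorialDecay_shift_coeffI : FactorialDecay fun k => (k + 1) * coeffI (k + 1) := by
  refine factorialDecay_coeffI.of_shift fun k => ?_
  rw [← coeffI_succ k, sq, mul_assoc]
  rw [norm_mul ((k : ℂ) + 1) (((k : ℂ) + 1) * coeffI (k + 1))]
  refine le_mul_of_one_le_left (norm_nonneg _) ?_
  have : ((k : ℂ) + 1) = ((k + 1 : ℕ) : ℂ) := by push_cast; ring
  rw [this, Complex.norm_natCast]
  exact_mod_cast Nat.succ_le_succ (Nat.zero_le k)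

lemma factorialDecay_shift_coeffH : FactorialDecay fun k => (k + 1) * coeffH (k + 1) := by
  have h : FactorialDecay fun k => coeffH k + (k + 1) * coeffI (k + 1) := by
    obtain ⟨C, hC⟩ := factorialDecay_coeffH
    obtain ⟨C', hC'⟩ := factorialDecay_shift_coeffI
    refine ⟨C + C', fun k => (norm_add_le _ _).trans ?_⟩
    rw [add_div]
    exact add_le_add (hC k) (hC' k)
  refine h.of_shift fun k => ?_
  rw [← coeffH_succ k, sq, mul_assoc]
  rw [norm_mul ((k : ℂ) + 1) (((k : ℂ) + 1) * coeffH (k + 1))]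
  refine le_mul_of_one_le_left (norm_nonneg _) ?_
  have : ((k : ℂ) + 1) = ((k + 1 : ℕ) : ℂ) := by push_cast; ring
  rw [this, Complex.norm_natCast]
  exact_mod_cast Nat.succ_le_succ (Nat.zero_le k)

lemma hasDerivAt_powerSum_coeffI (q : ℂ) : HasDerivAt (powerSum coeffI)
    (powerSum (fun k => (k + 1) * coeffI (k + 1)) q) q :=
  hasDerivAt_powerSum factorialDecay_coeffI factorialDecay_shift_coeffI (fun _ => rfl) q

lemma hasDerivAt_powerSum_coeffH (q : ℂ) : HasDerivAt (powerSum coeffH)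
    (powerSum (fun k => (k + 1) * coeffH (k + 1)) q) q :=
  hasDerivAt_powerSum factorialDecay_coeffH factorialDecay_shift_coeffH (fun _ => rfl) q

lemma hasDerivAt_powerSum_mul_coeffI (q : ℂ) : HasDerivAt (powerSum fun k => k * coeffI k)
    (powerSum coeffI q) q :=
  hasDerivAt_powerSum factorialDecay_mul_coeffI factorialDecay_coeffI
    (fun k => by rw [← coeffI_succ]; push_cast; ring) q

lemma hasDerivAt_powerSum_mul_coeffH (q : ℂ) : HasDerivAt (powerSum fun k => k * coeffH k)
    (powerSum coeffH q + powerSum (fun k => (k + 1) * coeffI (k + 1)) q) q := by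
  rw [← powerSum_add factorialDecay_coeffH factorialDecay_shift_coeffI]
  refine hasDerivAt_powerSum factorialDecay_mul_coeffH ?_
    (fun k => by rw [← coeffH_succ]; push_cast; ring) q
  obtain ⟨C, hC⟩ := factorialDecay_coeffH
  obtain ⟨C', hC'⟩ := factorialDecay_shift_coeffI
  refine ⟨C + C', fun k => (norm_add_le _ _).trans ?_⟩
  rw [add_div]
  exact add_le_add (hC k) (hC' k)

lemma mul_powerSum_shift_coeffI (q : ℂ) :
    q * powerSum (fun k => (k + 1) * coeffI (k + 1)) q = powerSum (fun k => k * coeffI k) q :=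
  mul_powerSum factorialDecay_mul_coeffI (fun k => by push_cast; ring) (by simp) q

lemma mul_powerSum_shift_coeffH (q : ℂ) :
    q * powerSum (fun k => (k + 1) * coeffH (k + 1)) q = powerSum (fun k => k * coeffH k) q :=
  mul_powerSum factorialDecay_mul_coeffH (fun k => by push_cast; ring) (by simp) q

lemma powerSum_coeffI_ne_zero (x : ℝ) (hx : 0 ≤ x) : powerSum coeffI x ≠ 0 := by
  have h : powerSum coeffI x = ((∑' k : ℕ, 1 / (k.factorial : ℝ) ^ 2 * x ^ k : ℝ) : ℂ) := by
    rw [Complex.ofReal_tsum]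
    unfold powerSum coeffI
    congr 1
    ext k
    push_cast
    rfl
  have hs : Summable fun k : ℕ => 1 / (k.factorial : ℝ) ^ 2 * x ^ k := by
    have h1 := (factorialDecay_coeffI.summable x).norm
    refine h1.congr fun k => ?_
    rw [norm_mul, norm_coeffI, norm_pow, Complex.norm_real, Real.norm_of_nonneg hx]
  rw [h, Complex.ofReal_ne_zero]
  exact (hs.tsum_pos (fun k => by positivity) 0 (by simp)).ne'

/-! ### The logarithmic singularity of the Macdonald function -/

/-- This is `Γ'(1) = -γ`. Integrability follows from the value: the integral of a function that is
not integrable would be `0`. -/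
lemma integral_log_mul_exp_neg :
    IntegrableOn (fun t : ℝ => Real.log t * Real.exp (-t)) (Ioi 0) ∧
    ∫ t in Ioi (0 : ℝ), Real.log t * Real.exp (-t) = -Real.eulerMascheroniConstant := by
  have h1 := Complex.hasDerivAt_GammaIntegral (s := 1) (by simp)
  have h2 : HasDerivAt Complex.Gamma
      (∫ t : ℝ in Ioi 0, (t : ℂ) ^ ((1 : ℂ) - 1) * (Real.log t * Real.exp (-t))) 1 := by
    refine h1.congr_of_eventuallyEq ?_
    have : ∀ᶠ s : ℂ in 𝓝 1, 0 < s.re :=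
      (isOpen_lt continuous_const Complex.continuous_re).mem_nhds (by simp)
    filter_upwards [this] with s hs
    exact Complex.Gamma_eq_integral hs
  have h3 := h2.unique Complex.hasDerivAt_Gamma_one
  have h4 : ∫ t : ℝ in Ioi 0, (t : ℂ) ^ ((1 : ℂ) - 1) * (Real.log t * Real.exp (-t)) =
      ((∫ t in Ioi (0 : ℝ), Real.log t * Real.exp (-t) : ℝ) : ℂ) := by
    rw [← integral_complex_ofReal]
    refine setIntegral_congr_fun measurableSet_Ioi fun t _ => ?_
    simp
  rw [h4] at h3
  have h5 : ∫ t in Ioi (0 : ℝ), Real.log t * Real.exp (-t) = -Real.eulerMascheroniConstant := by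
    exact_mod_cast h3
  refine ⟨?_, h5⟩
  by_contra hni
  have := Real.one_half_lt_eulerMascheroniConstant
  rw [integral_undef hni] at h5
  linarith

lemma tendsto_log_mul_of_hasDerivAt {G : ℝ → ℂ} {g : ℂ} (hG : HasDerivAt G g 0) (h0 : G 0 = 0)
    (c : ℝ) :
    Tendsto (fun x : ℝ => ((Real.log x + c : ℝ) : ℂ) * G x) (𝓝[>] 0) (𝓝 0) := by
  have h1 := hG.tendsto_slope_zero_right
  have h2 : Tendsto (fun x : ℝ => (((Real.log x + c) * x : ℝ) : ℂ)) (𝓝[>] 0) (𝓝 0) := by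
    have ha := tendsto_log_mul_rpow_nhdsGT_zero (r := 1) one_pos
    have hb : Tendsto (fun x : ℝ => c * x) (𝓝[>] 0) (𝓝 0) := by
      have : Tendsto (fun x : ℝ => c * x) (𝓝 0) (𝓝 (c * 0)) :=
        tendsto_id.const_mul c
      rw [mul_zero] at this
      exact this.mono_left nhdsWithin_le_nhds
    have hc := ha.add hb
    rw [add_zero] at hc
    have hd : Tendsto (fun x : ℝ => (Real.log x + c) * x) (𝓝[>] 0) (𝓝 0) := by
      refine hc.congr fun x => ?_
      rw [Real.rpow_one]; ring
    exact_mod_cast (Complex.continuous_ofReal.tendsto 0).comp hd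
  have h3 := h2.mul h1
  rw [zero_mul] at h3
  refine h3.congr' ?_
  filter_upwards [self_mem_nhdsWithin] with x hx
  have hx' : (x : ℂ) ≠ 0 := by exact_mod_cast (mem_Ioi.1 hx).ne'
  rw [zero_add, h0, sub_zero, Complex.real_smul]
  push_cast
  field_simp

lemma image_mul_exp_Ioi {δ : ℝ} (hδ : 0 < δ) :
    (fun t : ℝ => δ * Real.exp t) '' Ioi 0 = Ioi δ := by
  ext u
  simp only [mem_image, mem_Ioi]
  constructor
  · rintro ⟨t, ht, rfl⟩
    have := Real.one_lt_exp_iff.2 ht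
    nlinarith
  · intro hu
    refine ⟨Real.log (u / δ), Real.log_pos ((one_lt_div hδ).2 hu), ?_⟩
    rw [Real.exp_log (by have := hδ.trans hu; positivity)]
    field_simp

/-- `∫₀^∞ e^{-δ eᵗ} dt` is the exponential integral of `δ`. -/
lemma integral_exp_neg_mul_exp {δ : ℝ} (hδ : 0 < δ) :
    IntegrableOn (fun t : ℝ => Real.exp (-(δ * Real.exp t))) (Ioi 0) ∧
    ∫ t in Ioi (0 : ℝ), Real.exp (-(δ * Real.exp t)) =
      (∫ t in Ioi δ, Real.log t * Real.exp (-t)) - Real.log δ * Real.exp (-δ) := by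
  have hd : ∀ t ∈ Ioi (0 : ℝ), HasDerivWithinAt (fun t : ℝ => δ * Real.exp t) (δ * Real.exp t)
      (Ioi 0) t := fun t _ => ((Real.hasDerivAt_exp t).const_mul δ).hasDerivWithinAt
  have hinj : InjOn (fun t : ℝ => δ * Real.exp t) (Ioi 0) := fun a _ b _ hab =>
    Real.exp_injective (mul_left_cancel₀ hδ.ne' hab)
  have hEi : IntegrableOn (fun u : ℝ => Real.exp (-u) / u) (Ioi δ) := by
    have h1 : IntegrableOn (fun u : ℝ => δ⁻¹ * Real.exp (-u)) (Ioi δ) :=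
      (integrableOn_exp_neg_Ioi δ).const_mul _
    refine h1.mono' ?_ ?_
    · exact (by fun_prop : Measurable fun u : ℝ => Real.exp (-u) / u).aestronglyMeasurable
    · filter_upwards [self_mem_ae_restrict measurableSet_Ioi] with u hu
      have hu' : 0 < u := hδ.trans hu
      rw [Real.norm_of_nonneg (by positivity), div_eq_inv_mul]
      gcongr
      exact (mem_Ioi.1 hu).le
  have hsimp : ∀ t ∈ Ioi (0 : ℝ), |δ * Real.exp t| • (Real.exp (-(δ * Real.exp t)) /
      (δ * Real.exp t)) = Real.exp (-(δ * Real.exp t)) := by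
    intro t _
    rw [abs_of_pos (by positivity), smul_eq_mul]
    field_simp
  have hint : IntegrableOn (fun t : ℝ => Real.exp (-(δ * Real.exp t))) (Ioi 0) := by
    have h2 := (integrableOn_image_iff_integrableOn_abs_deriv_smul measurableSet_Ioi hd hinj
      (fun u => Real.exp (-u) / u)).1 (by rwa [image_mul_exp_Ioi hδ])
    exact h2.congr_fun hsimp measurableSet_Ioi
  refine ⟨hint, ?_⟩
  have h3 := integral_image_eq_integral_abs_deriv_smul measurableSet_Ioi hd hinj
    (fun u => Real.exp (-u) / u)
  rw [image_mul_exp_Ioi hδ, setIntegral_congr_fun measurableSet_Ioi hsimp] at h3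
  rw [← h3]
  have hlogI : IntegrableOn (fun t : ℝ => Real.log t * Real.exp (-t)) (Ioi δ) :=
    integral_log_mul_exp_neg.1.mono_set (Ioi_subset_Ioi hδ.le)
  have hder : ∀ u ∈ Ioi δ, HasDerivAt (fun u => -(Real.log u * Real.exp (-u)))
      (Real.log u * Real.exp (-u) - Real.exp (-u) / u) u := by
    intro u hu
    have hu' : u ≠ 0 := (hδ.trans hu).ne'
    convert! ((Real.hasDerivAt_log hu').mul (hasDerivAt_neg u).exp).neg using 1
    field_simp
    ring
  have hlim : Tendsto (fun u => -(Real.log u * Real.exp (-u))) atTop (𝓝 0) := by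
    have h := Real.tendsto_pow_mul_exp_neg_atTop_nhds_zero 1
    refine squeeze_zero_norm' ?_ h
    filter_upwards [eventually_ge_atTop 1] with u hu
    rw [norm_neg, Real.norm_of_nonneg (mul_nonneg (Real.log_nonneg hu) (Real.exp_pos _).le),
      pow_one]
    gcongr
    exact (Real.log_le_sub_one_of_pos (by linarith)).trans (by linarith)
  have h4 := integral_Ioi_of_hasDerivAt_of_tendsto (a := δ)
    (f := fun u => -(Real.log u * Real.exp (-u)))
    (by
      have : ContinuousAt Real.log δ := Real.continuousAt_log hδ.ne'
      exact (this.mul (by fun_prop)).neg.continuousWithinAt)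
    hder (hlogI.sub hEi) hlim
  rw [integral_sub hlogI hEi] at h4
  linarith

/-- The behaviour `K₀(2x) = -log x - γ + o(1)` at `0+`, by comparison with an exponential
integral. -/
lemma tendsto_macdonald_zero_add_log :
    Tendsto (fun x : ℝ => macdonald 0 (2 * x : ℝ) +
      ((Real.log x + Real.eulerMascheroniConstant : ℝ) : ℂ)) (𝓝[>] 0) (𝓝 0) := by
  have hA : Tendsto (fun δ : ℝ => (∫ t in Ioi δ, Real.log t * Real.exp (-t)) +
      Real.eulerMascheroniConstant) (𝓝[>] 0) (𝓝 0) := by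
    have hcov := aecover_Ioi_of_Ioi (μ := volume) (l := 𝓝[>] (0 : ℝ)) (a := fun δ : ℝ => δ)
      (A := (0 : ℝ)) (tendsto_id.mono_left nhdsWithin_le_nhds)
    have h1 := hcov.integral_tendsto_of_countably_generated integral_log_mul_exp_neg.1
    rw [integral_log_mul_exp_neg.2] at h1
    have h2 := h1.add_const Real.eulerMascheroniConstant
    rw [neg_add_cancel] at h2
    refine h2.congr' ?_
    filter_upwards [self_mem_nhdsWithin] with δ hδ
    rw [Measure.restrict_restrict measurableSet_Ioi,
      inter_eq_self_of_subset_left (Ioi_subset_Ioi (mem_Ioi.1 hδ).le)]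
  have hB : Tendsto (fun δ : ℝ => ((Real.log δ + 0 : ℝ) : ℂ) *
      ((1 - Real.exp (-δ) : ℝ) : ℂ)) (𝓝[>] 0) (𝓝 0) := by
    refine tendsto_log_mul_of_hasDerivAt
      (G := fun δ => ((1 - Real.exp (-δ) : ℝ) : ℂ)) (g := ((0 - Real.exp (-0) * -1 : ℝ) : ℂ)) ?_
      (by simp) 0
    exact (((hasDerivAt_const (0 : ℝ) (1 : ℝ)).sub (hasDerivAt_neg (0 : ℝ)).exp)).ofReal_comp
  have hC : Tendsto (fun δ : ℝ => macdonald 0 (2 * δ : ℝ) -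
      ((∫ t in Ioi (0 : ℝ), Real.exp (-(δ * Real.exp t)) : ℝ) : ℂ)) (𝓝[>] 0) (𝓝 0) := by
    have hid : Tendsto (fun δ : ℝ => δ) (𝓝[>] 0) (𝓝 0) :=
      tendsto_id.mono_left nhdsWithin_le_nhds
    refine squeeze_zero_norm' ?_ hid
    filter_upwards [self_mem_nhdsWithin] with δ hδ
    have hδ' : 0 < δ := hδ
    obtain ⟨hI, -⟩ := integral_exp_neg_mul_exp hδ'
    have hre : 0 < ((2 * δ : ℝ) : ℂ).re := by simpa using hδ'
    have hI' : IntegrableOn (fun t : ℝ => ((Real.exp (-(δ * Real.exp t)) : ℝ) : ℂ)) (Ioi 0) :=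
      hI.ofReal
    rw [← integral_complex_ofReal, macdonald, ← integral_sub (integrableOn_macdonald 0 hre) hI']
    have hbd : IntegrableOn (fun t : ℝ => δ * Real.exp (-t)) (Ioi 0) :=
      (integrableOn_exp_neg_Ioi 0).const_mul _
    refine (norm_integral_le_of_norm_le hbd (Eventually.of_forall fun t => ?_)).trans ?_
    · have hcosh : 2 * δ * Real.cosh t = δ * Real.exp t + δ * Real.exp (-t) := by
        rw [Real.cosh_eq]; ring
      have h1 : ((Real.cosh t ^ 0 : ℝ) : ℂ) * Complex.exp (-(((2 * δ : ℝ) : ℂ) * (Real.cosh t : ℝ)))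
          - ((Real.exp (-(δ * Real.exp t)) : ℝ) : ℂ) =
          ((Real.exp (-(δ * Real.exp t)) * (Real.exp (-(δ * Real.exp (-t))) - 1) : ℝ) : ℂ) := by
        rw [mul_sub, ← Real.exp_add, ← neg_add, ← hcosh]
        push_cast
        simp
      rw [h1, Complex.norm_real, norm_mul, Real.norm_of_nonneg (Real.exp_pos _).le]
      have h2 : Real.exp (-(δ * Real.exp t)) ≤ 1 := Real.exp_le_one_iff.2 (by
        have := Real.exp_pos t; nlinarith)
      have hy : 0 ≤ δ * Real.exp (-t) := by positivity
      have h3 : ‖Real.exp (-(δ * Real.exp (-t))) - 1‖ ≤ δ * Real.exp (-t) := by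
        rw [Real.norm_eq_abs, abs_le]
        have ha := Real.add_one_le_exp (-(δ * Real.exp (-t)))
        have hb : Real.exp (-(δ * Real.exp (-t))) ≤ 1 := Real.exp_le_one_iff.2 (by linarith)
        constructor <;> linarith
      calc _ ≤ 1 * (δ * Real.exp (-t)) := by gcongr
        _ = _ := one_mul _
    · rw [integral_const_mul, integral_exp_neg_Ioi_zero, mul_one]
  have hA' : Tendsto (fun δ : ℝ => (((∫ t in Ioi δ, Real.log t * Real.exp (-t)) +
      Real.eulerMascheroniConstant : ℝ) : ℂ)) (𝓝[>] 0) (𝓝 0) := by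
    exact_mod_cast (Complex.continuous_ofReal.tendsto 0).comp hA
  have hsum := (hC.add hA').add hB
  simp only [add_zero] at hsum
  refine hsum.congr' ?_
  filter_upwards [self_mem_nhdsWithin] with δ hδ
  rw [(integral_exp_neg_mul_exp hδ).2]
  push_cast
  ring

/-! ### The Hankel function on the upper half plane -/

/-- The series expansion of the Macdonald function `K₀`. -/
def macdonaldSeries (w : ℂ) : ℂ :=
  -(Complex.log (w / 2) + (Real.eulerMascheroniConstant : ℂ)) * powerSum coeffI ((w / 2) ^ 2) +
    powerSum coeffH ((w / 2) ^ 2)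

lemma hankel0_I_mul_eq_series {w : ℂ} (hw : 0 < w.re) :
    hankel0 (Complex.I * w) = -(2 * Complex.I / (Real.pi : ℂ)) * macdonaldSeries w := by
  have hw0 : w ≠ 0 := by rintro rfl; simp at hw
  have hpow : ∀ k : ℕ, (-1 : ℂ) ^ k * (Complex.I * w / 2) ^ (2 * k) = ((w / 2) ^ 2) ^ k := by
    intro k
    rw [pow_mul, ← mul_pow, mul_div_assoc, mul_pow Complex.I, Complex.I_sq]
    congr 1
    ring
  have hJ : besselJ0 (Complex.I * w) = powerSum coeffI ((w / 2) ^ 2) := by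
    unfold besselJ0 powerSum coeffI
    congr 1
    ext k
    rw [← hpow]
    ring
  have hS : ∑' k : ℕ, (-1 : ℂ) ^ k * ((harmonic k : ℚ) : ℂ) / ((k.factorial : ℂ) ^ 2) *
      (Complex.I * w / 2) ^ (2 * k) = powerSum coeffH ((w / 2) ^ 2) := by
    unfold powerSum coeffH
    congr 1
    ext k
    rw [← hpow]
    ring
  have hlog : Complex.log (Complex.I * w / 2) =
      Complex.log (w / 2) + Real.pi / 2 * Complex.I := by
    have hre : 0 < (w / 2).re := by
      have : (w / 2).re = w.re / 2 := by
        rw [show (2 : ℂ) = ((2 : ℝ) : ℂ) by norm_num, Complex.div_ofReal_re]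
      rw [this]; positivity
    have harg := abs_lt.1 (Complex.abs_arg_lt_pi_div_two_iff.2 (Or.inl hre))
    have hw2 : w / 2 ≠ 0 := div_ne_zero hw0 two_ne_zero
    rw [mul_div_assoc, (Complex.log_mul_eq_add_log_iff Complex.I_ne_zero hw2).2, Complex.log_I,
      add_comm]
    rw [Complex.arg_I]
    constructor <;> linarith [harg.1, harg.2, Real.pi_pos]
  have hpi : (Real.pi : ℂ) ≠ 0 := by exact_mod_cast Real.pi_ne_zero
  unfold hankel0 besselY0 macdonaldSeries
  rw [hS, hlog, hJ]
  field_simp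
  ring_nf
  rw [Complex.I_sq]
  ring

/-- A system equivalent to Bessel's modified equation on the right half plane:
`w f' = g`, `g' = w f`. -/
def SolvesBessel (f g : ℂ → ℂ) : Prop :=
  ∀ w : ℂ, 0 < w.re → HasDerivAt f (g w / w) w ∧ HasDerivAt g (w * f w) w

lemma SolvesBessel.sub {f g f' g' : ℂ → ℂ} (h : SolvesBessel f g) (h' : SolvesBessel f' g') :
    SolvesBessel (fun w => f w - f' w) (fun w => g w - g' w) := by
  intro w hw
  refine ⟨?_, ?_⟩
  · rw [sub_div]; exact (h w hw).1.sub (h' w hw).1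
  · rw [mul_sub]; exact (h w hw).2.sub (h' w hw).2

lemma solvesBessel_macdonald :
    SolvesBessel (macdonald 0) (fun w => -(w * macdonald 1 w)) := by
  intro w hw
  have hw0 : w ≠ 0 := by rintro rfl; simp at hw
  refine ⟨?_, ?_⟩
  · convert! hasDerivAt_macdonald 0 hw using 1
    field_simp
  · convert! (hasDerivAt_mul_macdonald_one hw).neg using 1
    ring

lemma hasDerivAt_half_sq (w : ℂ) : HasDerivAt (fun w : ℂ => (w / 2) ^ 2) (w / 2) w := by
  convert! ((hasDerivAt_id w).div_const 2).pow 2 using 1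
  simp
  ring

lemma solvesBessel_powerSum :
    SolvesBessel (fun w => powerSum coeffI ((w / 2) ^ 2))
      (fun w => 2 * powerSum (fun k => k * coeffI k) ((w / 2) ^ 2)) := by
  intro w hw
  have hw0 : w ≠ 0 := by rintro rfl; simp at hw
  refine ⟨?_, ?_⟩
  · have h := (hasDerivAt_powerSum_coeffI ((w / 2) ^ 2)).comp w (hasDerivAt_half_sq w)
    convert! h using 1
    beta_reduce
    rw [← mul_powerSum_shift_coeffI]
    field_simp
  · have h := ((hasDerivAt_powerSum_mul_coeffI ((w / 2) ^ 2)).comp w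
      (hasDerivAt_half_sq w)).const_mul 2
    convert! h using 1
    ring

lemma solvesBessel_macdonaldSeries :
    SolvesBessel macdonaldSeries
      (fun w => -powerSum coeffI ((w / 2) ^ 2)
        - 2 * (Complex.log (w / 2) + (Real.eulerMascheroniConstant : ℂ)) *
          powerSum (fun k => k * coeffI k) ((w / 2) ^ 2)
        + 2 * powerSum (fun k => k * coeffH k) ((w / 2) ^ 2)) := by
  intro w hw
  have hw0 : w ≠ 0 := by rintro rfl; simp at hw
  have hre : 0 < (w / 2).re := by
    have : (w / 2).re = w.re / 2 := by
      rw [show (2 : ℂ) = ((2 : ℝ) : ℂ) by norm_num, Complex.div_ofReal_re]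
    rw [this]; positivity
  have hlog : HasDerivAt (fun w : ℂ => Complex.log (w / 2) + (Real.eulerMascheroniConstant : ℂ))
      w⁻¹ w := by
    have h := (((hasDerivAt_id w).div_const 2).clog (Or.inl hre)).add_const
      (Real.eulerMascheroniConstant : ℂ)
    convert! h using 1
    simp only [id]
    field_simp
  have hI := (hasDerivAt_powerSum_coeffI ((w / 2) ^ 2)).comp w (hasDerivAt_half_sq w)
  have hH := (hasDerivAt_powerSum_coeffH ((w / 2) ^ 2)).comp w (hasDerivAt_half_sq w)
  have hI1 := (hasDerivAt_powerSum_mul_coeffI ((w / 2) ^ 2)).comp w (hasDerivAt_half_sq w)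
  have hH1 := (hasDerivAt_powerSum_mul_coeffH ((w / 2) ^ 2)).comp w (hasDerivAt_half_sq w)
  refine ⟨?_, ?_⟩
  · convert! (hlog.neg.mul hI).add hH using 1
    beta_reduce
    rw [← mul_powerSum_shift_coeffI, ← mul_powerSum_shift_coeffH]
    simp only [Function.comp, Pi.neg_apply]
    field_simp
    ring
  · convert! (hI.neg.sub ((hlog.const_mul 2).mul hI1)).add (hH1.const_mul 2) using 1
    rw [macdonaldSeries]
    simp only [Function.comp]
    rw [← mul_powerSum_shift_coeffI]
    field_simp
    ring

lemma eq_zero_of_hasDerivAt_zero_of_tendsto {f : ℝ → ℂ} (hf : ∀ x, 0 < x → HasDerivAt f 0 x)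
    (h0 : Tendsto f (𝓝[>] 0) (𝓝 0)) {x : ℝ} (hx : 0 < x) : f x = 0 := by
  obtain ⟨a, ha⟩ := isOpen_Ioi.exists_is_const_of_deriv_eq_zero (𝕜 := ℝ) (s := Ioi (0 : ℝ))
    isPreconnected_Ioi (fun y hy => (hf y hy).differentiableAt.differentiableWithinAt)
    (fun y hy => (hf y hy).deriv)
  have h1 : Tendsto f (𝓝[>] 0) (𝓝 a) := by
    refine tendsto_const_nhds.congr' ?_
    filter_upwards [self_mem_nhdsWithin] with y hy
    exact (ha y hy).symm
  rw [ha x hx, tendsto_nhds_unique h1 h0]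

/-- A solution of Bessel's modified equation which, together with `w f'`, vanishes at `0+` is zero:
its Wronskian with `I₀` is constant and tends to `0`, hence the quotient by `I₀` is constant. -/
lemma SolvesBessel.eq_zero {f g : ℂ → ℂ} (h : SolvesBessel f g)
    (hf : Tendsto (fun x : ℝ => f x) (𝓝[>] 0) (𝓝 0))
    (hg : Tendsto (fun x : ℝ => g x) (𝓝[>] 0) (𝓝 0)) {x : ℝ} (hx : 0 < x) : f x = 0 := by
  set I : ℂ → ℂ := fun w => powerSum coeffI ((w / 2) ^ 2) with hIdef
  set J : ℂ → ℂ := fun w => 2 * powerSum (fun k => k * coeffI k) ((w / 2) ^ 2) with hJdef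
  have hIJ : SolvesBessel I J := solvesBessel_powerSum
  have hpos : ∀ x : ℝ, 0 < x → 0 < (x : ℂ).re := fun x hx => by simpa using hx
  have hI0 : ∀ x : ℝ, I x ≠ 0 := fun x => by
    have : ((x : ℂ) / 2) ^ 2 = (((x / 2) ^ 2 : ℝ) : ℂ) := by push_cast; rfl
    rw [hIdef]
    simp only [this]
    exact powerSum_coeffI_ne_zero _ (by positivity)
  have hIc : Tendsto (fun x : ℝ => I x) (𝓝[>] 0) (𝓝 1) := by
    have h1 : ContinuousAt (fun x : ℝ => I x) 0 := by
      have h2 := (hasDerivAt_powerSum_coeffI (((0 : ℂ) / 2) ^ 2)).continuousAt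
      have h3 : ContinuousAt I ((0 : ℝ) : ℂ) := by
        rw [Complex.ofReal_zero]
        exact ContinuousAt.comp (f := fun w : ℂ => (w / 2) ^ 2) h2 (by fun_prop)
      exact h3.comp Complex.continuous_ofReal.continuousAt
    have h4 := h1.tendsto.mono_left (nhdsWithin_le_nhds (s := Ioi 0))
    convert! h4 using 2
    simp [hIdef, powerSum_zero, coeffI]
  have hJc : Tendsto (fun x : ℝ => J x) (𝓝[>] 0) (𝓝 0) := by
    have h1 : ContinuousAt (fun x : ℝ => J x) 0 := by
      have h2 := (hasDerivAt_powerSum_mul_coeffI (((0 : ℂ) / 2) ^ 2)).continuousAt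
      have h3 : ContinuousAt J ((0 : ℝ) : ℂ) := by
        rw [Complex.ofReal_zero]
        exact (ContinuousAt.comp (f := fun w : ℂ => (w / 2) ^ 2) h2 (by fun_prop)).const_mul 2
      exact h3.comp Complex.continuous_ofReal.continuousAt
    have h4 := h1.tendsto.mono_left (nhdsWithin_le_nhds (s := Ioi 0))
    convert! h4 using 2
    simp [hJdef, powerSum_zero]
  have hW : ∀ x : ℝ, 0 < x → f x * J x - g x * I x = 0 := by
    intro x hx
    refine eq_zero_of_hasDerivAt_zero_of_tendsto (f := fun x : ℝ => f x * J x - g x * I x)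
      (fun y hy => ?_) ?_ hx
    · have hy0 : (y : ℂ) ≠ 0 := by exact_mod_cast hy.ne'
      obtain ⟨a1, a2⟩ := h y (hpos y hy)
      obtain ⟨b1, b2⟩ := hIJ y (hpos y hy)
      convert! ((a1.mul b2).sub (a2.mul b1)).comp_ofReal using 1
      field_simp
      ring
    · simpa using (hf.mul hJc).sub (hg.mul hIc)
  have hQ : f x / I x = 0 := by
    refine eq_zero_of_hasDerivAt_zero_of_tendsto (f := fun x : ℝ => f x / I x)
      (fun y hy => ?_) ?_ hx
    · have hy0 : (y : ℂ) ≠ 0 := by exact_mod_cast hy.ne'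
      have a1 := (h y (hpos y hy)).1
      have b1 := (hIJ y (hpos y hy)).1
      convert! (a1.div b1 (hI0 y)).comp_ofReal using 1
      have := hW y hy
      have h1 : g y / y * I y - f y * (J y / y) = -(f y * J y - g y * I y) / y := by ring
      rw [h1, this]
      simp
    · have h2 := hf.div hIc one_ne_zero
      rw [zero_div] at h2
      exact h2
  exact (div_eq_zero_iff.1 hQ).resolve_right (hI0 x)

lemma hasDerivAt_comp_sq_zero {P : ℂ → ℂ} {P' : ℂ} (hP : HasDerivAt P P' 0) :
    HasDerivAt (fun x : ℝ => P ((x : ℂ) ^ 2)) 0 0 := by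
  have h1 : HasDerivAt (fun z : ℂ => z ^ 2) 0 ((0 : ℝ) : ℂ) := by
    simpa using hasDerivAt_pow 2 ((0 : ℝ) : ℂ)
  have h2 : HasDerivAt P P' (((0 : ℝ) : ℂ) ^ 2) := by simpa using hP
  simpa using (h2.comp ((0 : ℝ) : ℂ) h1).comp_ofReal

/-- The difference of the two sides solves Bessel's modified equation and vanishes at `0+`. -/
lemma macdonald_zero_ofReal {x : ℝ} (hx : 0 < x) : macdonald 0 x = macdonaldSeries x := by
  have hhalf : Tendsto (fun x : ℝ => x / 2) (𝓝[>] 0) (𝓝[>] 0) := by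
    refine tendsto_nhdsWithin_of_tendsto_nhds_of_eventually_within _ ?_ ?_
    · have : Tendsto (fun x : ℝ => x / 2) (𝓝 0) (𝓝 (0 / 2)) := tendsto_id.div_const 2
      rw [zero_div] at this
      exact this.mono_left nhdsWithin_le_nhds
    · filter_upwards [self_mem_nhdsWithin] with y hy
      exact half_pos (mem_Ioi.1 hy)
  set γ := Real.eulerMascheroniConstant
  have hlog : ∀ y : ℝ, 0 < y → Complex.log ((y : ℂ)) + (γ : ℂ) = ((Real.log y + γ : ℝ) : ℂ) := by
    intro y hy
    rw [Complex.ofReal_add, Complex.ofReal_log hy.le]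
  have hcont : ∀ (P : ℂ → ℂ) (P' : ℂ), HasDerivAt P P' 0 → P 0 = 0 →
      Tendsto (fun x : ℝ => P ((x : ℂ) ^ 2)) (𝓝[>] 0) (𝓝 0) := by
    intro P P' hP hP0
    have := (hasDerivAt_comp_sq_zero hP).continuousAt.tendsto
    simp only [Complex.ofReal_zero, ne_eq, OfNat.ofNat_ne_zero, not_false_eq_true, zero_pow,
      hP0] at this
    exact this.mono_left nhdsWithin_le_nhds
  have hIlog : Tendsto (fun x : ℝ => ((Real.log x + γ : ℝ) : ℂ) *
      (powerSum coeffI ((x : ℂ) ^ 2) - 1)) (𝓝[>] 0) (𝓝 0) :=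
    tendsto_log_mul_of_hasDerivAt (g := 0)
      ((hasDerivAt_comp_sq_zero (hasDerivAt_powerSum_coeffI 0)).sub_const 1)
      (by simp [powerSum_zero, coeffI]) γ
  have hI1log : Tendsto (fun x : ℝ => ((Real.log x + γ : ℝ) : ℂ) *
      powerSum (fun k => k * coeffI k) ((x : ℂ) ^ 2)) (𝓝[>] 0) (𝓝 0) :=
    tendsto_log_mul_of_hasDerivAt (g := 0)
      (hasDerivAt_comp_sq_zero (hasDerivAt_powerSum_mul_coeffI 0))
      (by simp [powerSum_zero]) γ
  have hH := hcont _ _ (hasDerivAt_powerSum_coeffH 0) (by simp [powerSum_zero, coeffH])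
  have hH1 := hcont _ _ (hasDerivAt_powerSum_mul_coeffH 0) (by simp [powerSum_zero])
  have hI : Tendsto (fun x : ℝ => powerSum coeffI ((x : ℂ) ^ 2) - 1) (𝓝[>] 0) (𝓝 0) :=
    hcont (fun q => powerSum coeffI q - 1) _ ((hasDerivAt_powerSum_coeffI 0).sub_const 1)
      (by simp [powerSum_zero, coeffI])
  have hsolve := solvesBessel_macdonald.sub solvesBessel_macdonaldSeries
  refine sub_eq_zero.1 (hsolve.eq_zero ?_ ?_ hx)
  · have h := ((tendsto_macdonald_zero_add_log.add hIlog).sub hH).comp hhalf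
    simp only [add_zero, sub_zero] at h
    refine h.congr' ?_
    filter_upwards [self_mem_nhdsWithin] with y hy
    have hy2 : 0 < y / 2 := half_pos hy
    have e1 : ((y : ℂ) / 2) = ((y / 2 : ℝ) : ℂ) := by push_cast; rfl
    have e2 : 2 * (y / 2) = y := by ring
    rw [macdonaldSeries, e1, hlog _ hy2]
    simp only [Function.comp, e2]
    ring
  · have hK1 : Tendsto (fun x : ℝ => (x : ℂ) * macdonald 1 x - 1) (𝓝[>] 0) (𝓝 0) := by
      have hid : Tendsto (fun δ : ℝ => δ) (𝓝[>] 0) (𝓝 0) :=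
        tendsto_id.mono_left nhdsWithin_le_nhds
      refine squeeze_zero_norm' ?_ hid
      filter_upwards [self_mem_nhdsWithin] with y hy
      have hy' : 0 < y := hy
      refine (norm_mul_macdonald_one_sub_one_le (by simpa using hy')).trans_eq ?_
      rw [Complex.norm_real, Real.norm_of_nonneg hy'.le, Complex.ofReal_re]
      field_simp
    have h := ((hI.add (hI1log.const_mul 2)).sub (hH1.const_mul 2)).comp hhalf
    have h' := h.sub hK1
    simp only [mul_zero, add_zero, sub_zero] at h'
    refine h'.congr' ?_
    filter_upwards [self_mem_nhdsWithin] with y hy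
    have hy2 : 0 < y / 2 := half_pos hy
    have e1 : ((y : ℂ) / 2) = ((y / 2 : ℝ) : ℂ) := by push_cast; rfl
    rw [e1, hlog _ hy2]
    simp only [Function.comp]
    ring

lemma macdonald_zero_eq_series {w : ℂ} (hw : 0 < w.re) : macdonald 0 w = macdonaldSeries w := by
  have hopen : IsOpen {w : ℂ | 0 < w.re} := isOpen_lt continuous_const Complex.continuous_re
  have h1 : AnalyticOnNhd ℂ (macdonald 0) {w : ℂ | 0 < w.re} :=
    DifferentiableOn.analyticOnNhd
      (fun v hv => (solvesBessel_macdonald v hv).1.differentiableAt.differentiableWithinAt) hopen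
  have h2 : AnalyticOnNhd ℂ macdonaldSeries {w : ℂ | 0 < w.re} :=
    DifferentiableOn.analyticOnNhd
      (fun v hv => (solvesBessel_macdonaldSeries v hv).1.differentiableAt.differentiableWithinAt)
      hopen
  refine h1.eqOn_of_preconnected_of_frequently_eq h2 (convex_halfSpace_re_gt 0).isPreconnected
    (z₀ := 1) (by simp) ?_ hw
  have hreal : Tendsto (fun x : ℝ => (x : ℂ)) (𝓝[>] 1) (𝓝[≠] 1) := by
    refine tendsto_nhdsWithin_of_tendsto_nhds_of_eventually_within _ ?_ ?_
    · have := Complex.continuous_ofReal.tendsto 1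
      rw [Complex.ofReal_one] at this
      exact this.mono_left nhdsWithin_le_nhds
    · filter_upwards [self_mem_nhdsWithin] with y hy
      simpa using (mem_Ioi.1 hy).ne'
  refine hreal.frequently (Eventually.frequently ?_)
  filter_upwards [self_mem_nhdsWithin] with y hy
  exact macdonald_zero_ofReal (zero_lt_one.trans hy)

/-- `H₀⁽¹⁾(i w) = (2 / (π i)) K₀(w)` for `Re w > 0`. -/
lemma hankel0_I_mul {w : ℂ} (hw : 0 < w.re) :
    hankel0 (Complex.I * w) = -(2 * Complex.I / (Real.pi : ℂ)) * macdonald 0 w := by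
  rw [hankel0_I_mul_eq_series hw, macdonald_zero_eq_series hw]

/-! ### A majorant of the Macdonald function -/

/-- The function bounding `|K₀(w)|` in terms of `q = Re w`. -/
def majorant (q : ℝ) : ℝ := 8 * (q ^ (-(1 / 4) : ℝ) * Real.exp (-(q / 2)))

lemma majorant_nonneg {q : ℝ} (hq : 0 ≤ q) : 0 ≤ majorant q := by
  unfold majorant; positivity

lemma majorant_anti {p q : ℝ} (hp : 0 < p) (hpq : p ≤ q) : majorant q ≤ majorant p := by
  unfold majorant
  have h1 : q ^ (-(1 / 4) : ℝ) ≤ p ^ (-(1 / 4) : ℝ) :=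
    Real.rpow_le_rpow_of_nonpos hp hpq (by norm_num)
  gcongr

lemma majorant_le {q : ℝ} (hq : 0 ≤ q) : majorant q ≤ 8 * q ^ (-(1 / 4) : ℝ) := by
  unfold majorant
  have h : Real.exp (-(q / 2)) ≤ 1 := Real.exp_le_one_iff.2 (by linarith)
  have h2 : 0 ≤ q ^ (-(1 / 4) : ℝ) := by positivity
  nlinarith

lemma integrable_comp_abs {f : ℝ → ℝ} (hf : IntegrableOn f (Ioi 0)) :
    Integrable fun v : ℝ => f |v| := by
  have h : Integrable ((Ioi (0 : ℝ)).indicator f) :=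
    (integrable_indicator_iff measurableSet_Ioi).2 hf
  refine (h.add h.comp_neg).congr ?_
  filter_upwards [compl_mem_ae_iff.2 (measure_singleton (0 : ℝ))] with v hv
  have hv0 : v ≠ 0 := hv
  rcases lt_or_gt_of_ne hv0 with h | h
  · simp [indicator, h, abs_of_neg h, not_lt.2 h.le]
  · simp [indicator, h, abs_of_pos h, not_lt.2 h.le]

lemma integrable_majorant_abs : Integrable fun v : ℝ => majorant |v| := by
  refine integrable_comp_abs ?_
  have h := (integrableOn_rpow_mul_exp_neg_mul_rpow (p := 1) (s := -(1 / 4)) (b := 1 / 2)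
    (by norm_num) one_pos (by norm_num)).const_mul 8
  refine IntegrableOn.congr_fun h (fun q _ => ?_) measurableSet_Ioi
  simp only [majorant, Real.rpow_one]
  ring_nf

lemma integrable_majorant_mul_abs {ρ : ℝ} (hρ : 0 < ρ) :
    Integrable fun v : ℝ => majorant (ρ * |v|) := by
  have h := integrable_majorant_abs.comp_mul_left' hρ.ne'
  refine h.congr (Eventually.of_forall fun v => ?_)
  simp only [abs_mul, abs_of_pos hρ]

lemma integral_majorant_mul_abs {ρ : ℝ} (hρ : 0 < ρ) :
    ∫ v : ℝ, majorant (ρ * |v|) = (∫ v : ℝ, majorant |v|) / ρ := by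
  have h := Measure.integral_comp_mul_left (fun v => majorant |v|) ρ
  rw [abs_of_pos (inv_pos.2 hρ)] at h
  simp only [abs_mul, abs_of_pos hρ] at h
  rw [h, smul_eq_mul]
  ring

lemma norm_macdonald_zero_le_majorant {w : ℂ} {q : ℝ} (hq : 0 < q) (hw : q ≤ w.re) :
    ‖macdonald 0 w‖ ≤ majorant q :=
  (norm_macdonald_zero_le (hq.trans_le hw)).trans (majorant_anti hq hw)

lemma measurable_macdonald (n : ℕ) : Measurable (macdonald n) := by
  have h : StronglyMeasurable (Function.uncurry fun (w : ℂ) (t : ℝ) =>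
      ((Real.cosh t ^ n : ℝ) : ℂ) * Complex.exp (-(w * (Real.cosh t : ℝ)))) := by
    have := Real.continuous_cosh
    exact Continuous.stronglyMeasurable (by unfold Function.uncurry; fun_prop)
  exact h.integral_prod_right.measurable

/-! ### The kernel of the generalized Possio equation -/

section Kernel

variable {a U : ℝ}

lemma beta2_pos (hU : 0 < U) (hUa : U < a) : 0 < beta2 a U := by
  unfold beta2 mach
  have ha : 0 < a := hU.trans hUa
  have h1 : U / a < 1 := (div_lt_one ha).2 hUa
  have h0 : 0 < U / a := by positivity
  nlinarith

/-- The radius `√((x - ξ)²/β² + y²)` in the argument of the Hankel function. -/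
def radius (a U X y : ℝ) : ℝ := Real.sqrt (X ^ 2 / beta2 a U + y ^ 2)

/-- The wave number `s / (a β)` multiplying the radius. -/
def waveNumber (a U : ℝ) (s : ℂ) : ℂ := s / ((a * Real.sqrt (beta2 a U) : ℝ) : ℂ)

/-- The wave number `s / (a β²)` multiplying `|x - ξ|` on the axis `y = 0`. -/
def axialNumber (a U : ℝ) (s : ℂ) : ℂ := s / ((a * beta2 a U : ℝ) : ℂ)

lemma waveArg_eq (s : ℂ) (ξ y x : ℝ) :
    waveArg a U s ξ y x = Complex.I * (waveNumber a U s * (radius a U (x - ξ) y : ℝ)) := by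
  unfold waveArg waveNumber radius
  ring

lemma waveNumber_re (s : ℂ) :
    (waveNumber a U s).re = s.re / (a * Real.sqrt (beta2 a U)) := by
  rw [waveNumber, Complex.div_ofReal_re]

lemma axialNumber_re (s : ℂ) : (axialNumber a U s).re = s.re / (a * beta2 a U) := by
  rw [axialNumber, Complex.div_ofReal_re]

lemma waveNumber_re_pos (hU : 0 < U) (hUa : U < a) {s : ℂ} (hs : 0 < s.re) :
    0 < (waveNumber a U s).re := by
  have ha : 0 < a := hU.trans hUa
  have := Real.sqrt_pos.2 (beta2_pos hU hUa)
  rw [waveNumber_re]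
  positivity

lemma axialNumber_re_pos (hU : 0 < U) (hUa : U < a) {s : ℂ} (hs : 0 < s.re) :
    0 < (axialNumber a U s).re := by
  have ha : 0 < a := hU.trans hUa
  have := beta2_pos hU hUa
  rw [axialNumber_re]
  positivity

lemma radius_zero (hU : 0 < U) (hUa : U < a) (X : ℝ) :
    radius a U X 0 = |X| / Real.sqrt (beta2 a U) := by
  have := beta2_pos hU hUa
  rw [radius, zero_pow two_ne_zero, add_zero, Real.sqrt_div (sq_nonneg X), Real.sqrt_sq_eq_abs]

lemma waveNumber_mul_radius_zero (hU : 0 < U) (hUa : U < a) (s : ℂ) (X : ℝ) :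
    waveNumber a U s * (radius a U X 0 : ℝ) = axialNumber a U s * (|X| : ℝ) := by
  have hb := beta2_pos hU hUa
  have ha : 0 < a := hU.trans hUa
  have hsq : ((Real.sqrt (beta2 a U) : ℝ) : ℂ) * ((Real.sqrt (beta2 a U) : ℝ) : ℂ) =
      ((beta2 a U : ℝ) : ℂ) := by
    rw [← Complex.ofReal_mul, Real.mul_self_sqrt hb.le]
  have h1 : ((Real.sqrt (beta2 a U) : ℝ) : ℂ) ≠ 0 := by
    exact_mod_cast (Real.sqrt_pos.2 hb).ne'
  have ha' : (a : ℂ) ≠ 0 := by exact_mod_cast ha.ne'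
  rw [radius_zero hU hUa, waveNumber, axialNumber, Complex.ofReal_div, Complex.ofReal_mul,
    Complex.ofReal_mul, ← hsq]
  field_simp

lemma radius_le_radius (X y : ℝ) : radius a U X 0 ≤ radius a U X y := by
  apply Real.sqrt_le_sqrt
  have := sq_nonneg y
  linarith

lemma radius_pos_of_height (hU : 0 < U) (hUa : U < a) (X : ℝ) {y : ℝ} (hy : 0 < y) :
    0 < radius a U X y := by
  have hb := beta2_pos hU hUa
  apply Real.sqrt_pos.2
  have : 0 ≤ X ^ 2 / beta2 a U := by positivity
  positivity

lemma radius_pos_of_ne (hU : 0 < U) (hUa : U < a) {X : ℝ} (hX : X ≠ 0) (y : ℝ) :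
    0 < radius a U X y := by
  have hb := beta2_pos hU hUa
  apply Real.sqrt_pos.2
  have : 0 < X ^ 2 / beta2 a U := by positivity
  positivity

lemma re_waveNumber_mul_radius (s : ℂ) (X y : ℝ) :
    (waveNumber a U s * (radius a U X y : ℝ)).re = (waveNumber a U s).re * radius a U X y :=
  Complex.re_mul_ofReal _ _

lemma axial_le_re_waveNumber_mul_radius (hU : 0 < U) (hUa : U < a) {s : ℂ} (hs : 0 < s.re)
    (X y : ℝ) :
    (axialNumber a U s).re * |X| ≤ (waveNumber a U s * (radius a U X y : ℝ)).re := by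
  have h := congrArg Complex.re (waveNumber_mul_radius_zero hU hUa s X)
  rw [Complex.re_mul_ofReal, Complex.re_mul_ofReal] at h
  rw [← h, re_waveNumber_mul_radius]
  exact mul_le_mul_of_nonneg_left (radius_le_radius X y) (waveNumber_re_pos hU hUa hs).le

/-- The constant `2 / (π i)` relating `H₀⁽¹⁾(i w)` to `K₀(w)`. -/
def hankelConst : ℂ := -(2 * Complex.I / (Real.pi : ℂ))

lemma hankel0_waveArg (hU : 0 < U) (hUa : U < a) {s : ℂ} (hs : 0 < s.re) {ξ y x : ℝ}
    (hr : 0 < radius a U (x - ξ) y) :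
    hankel0 (waveArg a U s ξ y x) =
      hankelConst * macdonald 0 (waveNumber a U s * (radius a U (x - ξ) y : ℝ)) := by
  rw [waveArg_eq, hankel0_I_mul, hankelConst]
  rw [re_waveNumber_mul_radius]
  exact mul_pos (waveNumber_re_pos hU hUa hs) hr

lemma hasDerivAt_radius (hU : 0 < U) (hUa : U < a) (ξ x : ℝ) {y : ℝ} (hy : 0 < y) :
    HasDerivAt (fun x => radius a U (x - ξ) y)
      ((x - ξ) / beta2 a U / radius a U (x - ξ) y) x := by
  have hb := beta2_pos hU hUa
  have hpos := radius_pos_of_height hU hUa (x - ξ) hy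
  have h1 : HasDerivAt (fun x : ℝ => (x - ξ) ^ 2 / beta2 a U + y ^ 2)
      (2 * (x - ξ) / beta2 a U) x := by
    have := ((((hasDerivAt_id x).sub_const ξ).pow 2).div_const (beta2 a U)).add_const (y ^ 2)
    convert! this using 1
    simp
  have h2 := h1.sqrt (Real.sqrt_ne_zero'.1 (by exact hpos.ne')).ne'
  convert! h2 using 1
  unfold radius
  ring

lemma hasDerivAt_hankel0_waveArg (hU : 0 < U) (hUa : U < a) {s : ℂ} (hs : 0 < s.re)
    (ξ x : ℝ) {y : ℝ} (hy : 0 < y) :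
    HasDerivAt (fun x' : ℝ => hankel0 (waveArg a U s ξ y x'))
      (hankelConst * (-macdonald 1 (waveNumber a U s * (radius a U (x - ξ) y : ℝ)) *
        (waveNumber a U s * ((x - ξ) / beta2 a U / radius a U (x - ξ) y : ℝ)))) x := by
  have hre : 0 < (waveNumber a U s * (radius a U (x - ξ) y : ℝ)).re := by
    rw [re_waveNumber_mul_radius]
    exact mul_pos (waveNumber_re_pos hU hUa hs) (radius_pos_of_height hU hUa _ hy)
  have h1 : HasDerivAt (fun x' : ℝ => waveNumber a U s * (radius a U (x' - ξ) y : ℝ))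
      (waveNumber a U s * ((x - ξ) / beta2 a U / radius a U (x - ξ) y : ℝ)) x :=
    (hasDerivAt_radius hU hUa ξ x hy).ofReal_comp.const_mul _
  have h2 := ((hasDerivAt_macdonald 0 hre).comp_of_eq x h1 rfl).const_mul hankelConst
  refine h2.congr_of_eventuallyEq (Eventually.of_forall fun x' => ?_)
  exact hankel0_waveArg hU hUa hs (radius_pos_of_height hU hUa _ hy)

lemma lam_eq (hU : 0 < U) (hUa : U < a) (s : ℂ) :
    lam a U s = -s / ((U * beta2 a U : ℝ) : ℂ) := by
  have hb := beta2_pos hU hUa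
  have ha : 0 < a := hU.trans hUa
  have h : 1 + cConst a U * U = 1 / beta2 a U := by
    have h1 : cConst a U * U = mach a U ^ 2 / beta2 a U := by
      unfold cConst mach
      field_simp
    rw [h1]
    have h2 : mach a U ^ 2 = 1 - beta2 a U := by unfold beta2; ring
    rw [h2]
    field_simp
    ring
  have hb' : ((beta2 a U : ℝ) : ℂ) ≠ 0 := by exact_mod_cast hb.ne'
  have hU' : (U : ℂ) ≠ 0 := by exact_mod_cast hU.ne'
  rw [lam, h]
  push_cast
  field_simp

lemma lam_re_neg (hU : 0 < U) (hUa : U < a) {s : ℂ} (hs : 0 < s.re) : (lam a U s).re < 0 := by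
  have hb := beta2_pos hU hUa
  rw [lam_eq hU hUa, Complex.div_ofReal_re, Complex.neg_re]
  exact div_neg_of_neg_of_pos (neg_lt_zero.2 hs) (by positivity)

lemma lam_mul_beta2 (hU : 0 < U) (hUa : U < a) (s : ℂ) :
    lam a U s * ((beta2 a U / U : ℝ) : ℂ) = -s / ((U : ℂ) ^ 2) := by
  have hb' : ((beta2 a U : ℝ) : ℂ) ≠ 0 := by exact_mod_cast (beta2_pos hU hUa).ne'
  have hU' : (U : ℂ) ≠ 0 := by exact_mod_cast hU.ne'
  rw [lam_eq hU hUa]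
  push_cast
  field_simp

lemma lam_sq_sub (hU : 0 < U) (hUa : U < a) (s : ℂ) :
    lam a U s ^ 2 * ((beta2 a U : ℝ) : ℂ) - s ^ 2 / ((a ^ 2 * beta2 a U : ℝ) : ℂ) =
      s ^ 2 / (U : ℂ) ^ 2 := by
  have hb := beta2_pos hU hUa
  have ha : 0 < a := hU.trans hUa
  have hb' : ((beta2 a U : ℝ) : ℂ) ≠ 0 := by exact_mod_cast hb.ne'
  have hU' : (U : ℂ) ≠ 0 := by exact_mod_cast hU.ne'
  have ha' : (a : ℂ) ≠ 0 := by exact_mod_cast ha.ne'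
  have hrel : ((a : ℂ) ^ 2 - (U : ℂ) ^ 2) = (a : ℂ) ^ 2 * ((beta2 a U : ℝ) : ℂ) := by
    have : a ^ 2 - U ^ 2 = a ^ 2 * beta2 a U := by
      unfold beta2 mach
      field_simp
    exact_mod_cast congrArg (fun r : ℝ => (r : ℂ)) this
  rw [lam_eq hU hUa]
  push_cast
  field_simp
  linear_combination s ^ 2 * hrel

/-- The integrand of the wake integral `∫_{-∞}^X e^{λ (X - v)} K₀(s |v| / (a β²)) dv`, extended by
`0` to the real line. -/
def wakeIntegrand (a U : ℝ) (s : ℂ) (X v : ℝ) : ℂ :=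
  (Iic X).indicator (fun v => Complex.exp (lam a U s * ((X - v : ℝ) : ℂ)) *
    macdonald 0 (axialNumber a U s * (|v| : ℝ))) v

/-- The kernel `K(x, ξ, s)` in terms of `X = x - ξ` and the Macdonald functions. -/
def reducedKernel (a U : ℝ) (s : ℂ) (X : ℝ) : ℂ :=
  hankelConst * (((beta2 a U / U : ℝ) : ℂ) * ((X : ℂ)⁻¹ *
      (1 - axialNumber a U s * (|X| : ℝ) * macdonald 1 (axialNumber a U s * (|X| : ℝ))))
    - s / (U : ℂ) ^ 2 * macdonald 0 (axialNumber a U s * (|X| : ℝ))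
    + s ^ 2 / (U : ℂ) ^ 3 * ∫ v, wakeIntegrand a U s X v)

lemma norm_macdonald_waveNumber_le (hU : 0 < U) (hUa : U < a) {s : ℂ} (hs : 0 < s.re) {ξ u : ℝ}
    (y : ℝ) (hu : u ≠ ξ) :
    ‖macdonald 0 (waveNumber a U s * (radius a U (u - ξ) y : ℝ))‖ ≤
      majorant ((axialNumber a U s).re * |u - ξ|) :=
  norm_macdonald_zero_le_majorant
    (mul_pos (axialNumber_re_pos hU hUa hs) (abs_pos.2 (sub_ne_zero.2 hu)))
    (axial_le_re_waveNumber_mul_radius hU hUa hs _ _)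

lemma ae_ne (ξ : ℝ) : ∀ᵐ u : ℝ, u ≠ ξ :=
  compl_mem_ae_iff.2 (measure_singleton ξ)

lemma norm_exp_neg_lam_mul_le (hU : 0 < U) (hUa : U < a) {s : ℂ} (hs : 0 < s.re) {x u : ℝ}
    (hu : u ≤ x) :
    ‖Complex.exp (-(lam a U s * (u : ℂ)))‖ ≤ Real.exp (-((lam a U s).re * x)) := by
  rw [Complex.norm_exp, Complex.neg_re, Complex.re_mul_ofReal]
  apply Real.exp_le_exp.2
  have := lam_re_neg hU hUa hs
  nlinarith

lemma integrable_wake_majorant (hU : 0 < U) (hUa : U < a) {s : ℂ} (hs : 0 < s.re) (x ξ : ℝ) :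
    IntegrableOn (fun u : ℝ => Real.exp (-((lam a U s).re * x)) *
      majorant ((axialNumber a U s).re * |u - ξ|)) (Iic x) :=
  (((integrable_majorant_mul_abs (axialNumber_re_pos hU hUa hs)).comp_sub_right ξ).const_mul
    _).integrableOn

lemma aestronglyMeasurable_wake (s : ℂ) (ξ y : ℝ) (μ : Measure ℝ) :
    AEStronglyMeasurable (fun u : ℝ => Complex.exp (-(lam a U s * (u : ℂ))) *
      macdonald 0 (waveNumber a U s * (radius a U (u - ξ) y : ℝ))) μ := by
  have h1 := measurable_macdonald 0
  have h2 : Measurable fun u : ℝ =>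
      macdonald 0 (waveNumber a U s * (radius a U (u - ξ) y : ℝ)) := by
    refine h1.comp ?_
    unfold radius
    fun_prop
  have h3 : Measurable fun u : ℝ => Complex.exp (-(lam a U s * (u : ℂ))) := by fun_prop
  exact (h3.mul h2).aestronglyMeasurable

lemma integrableOn_wake (hU : 0 < U) (hUa : U < a) {s : ℂ} (hs : 0 < s.re) (x ξ y : ℝ) :
    IntegrableOn (fun u : ℝ => Complex.exp (-(lam a U s * (u : ℂ))) *
      macdonald 0 (waveNumber a U s * (radius a U (u - ξ) y : ℝ))) (Iic x) := by
  refine (integrable_wake_majorant hU hUa hs x ξ).mono' (aestronglyMeasurable_wake s ξ y _) ?_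
  filter_upwards [self_mem_ae_restrict measurableSet_Iic,
    ae_restrict_of_ae (ae_ne ξ)] with u hu hne
  rw [norm_mul]
  gcongr
  · exact norm_exp_neg_lam_mul_le hU hUa hs hu
  · exact norm_macdonald_waveNumber_le hU hUa hs y hne

lemma integrableOn_exp_mul_hankel0 (hU : 0 < U) (hUa : U < a) {s : ℂ} (hs : 0 < s.re) (x ξ : ℝ)
    {y : ℝ} (hy : 0 < y) :
    IntegrableOn (fun u : ℝ => Complex.exp (-(lam a U s * (u : ℂ))) *
      hankel0 (waveArg a U s ξ y u)) (Iic x) := by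
  refine IntegrableOn.congr_fun ((integrableOn_wake hU hUa hs x ξ y).const_mul hankelConst)
    (fun u _ => ?_) measurableSet_Iic
  rw [hankel0_waveArg hU hUa hs (radius_pos_of_height hU hUa _ hy)]
  ring

lemma continuous_radius (X : ℝ) : Continuous fun y => radius a U X y := by
  unfold radius
  fun_prop

lemma tendsto_macdonald_radius (hU : 0 < U) (hUa : U < a) {s : ℂ} (hs : 0 < s.re) (n : ℕ) {X : ℝ}
    (hX : X ≠ 0) :
    Tendsto (fun y => macdonald n (waveNumber a U s * (radius a U X y : ℝ))) (𝓝[>] 0)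
      (𝓝 (macdonald n (axialNumber a U s * (|X| : ℝ)))) := by
  have hre : 0 < (waveNumber a U s * (radius a U X 0 : ℝ)).re := by
    rw [re_waveNumber_mul_radius]
    exact mul_pos (waveNumber_re_pos hU hUa hs) (radius_pos_of_ne hU hUa hX 0)
  have h1 : ContinuousAt (fun y => waveNumber a U s * (radius a U X y : ℝ)) 0 := by
    have := continuous_radius (a := a) (U := U) X
    exact Continuous.continuousAt (by fun_prop)
  have h2 := ContinuousAt.comp (f := fun y => waveNumber a U s * (radius a U X y : ℝ)) (x := 0)
    (hasDerivAt_macdonald n hre).continuousAt h1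
  have h3 := h2.tendsto.mono_left (nhdsWithin_le_nhds (s := Ioi 0))
  simpa only [Function.comp_def, waveNumber_mul_radius_zero hU hUa] using h3

lemma exp_mul_integral_wake (hU : 0 < U) (hUa : U < a) (s : ℂ) (x ξ : ℝ) :
    Complex.exp (lam a U s * (x : ℂ)) * ∫ u in Iic x, Complex.exp (-(lam a U s * (u : ℂ))) *
      macdonald 0 (waveNumber a U s * (radius a U (u - ξ) 0 : ℝ)) =
    ∫ v, wakeIntegrand a U s (x - ξ) v := by
  rw [← integral_const_mul, ← integral_indicator measurableSet_Iic,
    ← integral_sub_right_eq_self (fun v => wakeIntegrand a U s (x - ξ) v) ξ]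
  refine integral_congr_ae (Eventually.of_forall fun u => ?_)
  by_cases hu : u ≤ x
  · have hu' : u - ξ ≤ x - ξ := by linarith
    simp only [wakeIntegrand, indicator, mem_Iic, hu, hu', if_true]
    rw [waveNumber_mul_radius_zero hU hUa, ← mul_assoc, ← Complex.exp_add]
    congr 2
    push_cast
    ring
  · have hu' : ¬ u - ξ ≤ x - ξ := by linarith
    simp only [wakeIntegrand, indicator, mem_Iic, hu, hu', if_false]

/-- The limit `y → 0⁺` in the definition of the kernel. -/
lemma tendsto_prePossio (hU : 0 < U) (hUa : U < a) {s : ℂ} (hs : 0 < s.re) {x ξ : ℝ}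
    (hne : x ≠ ξ) :
    Tendsto (fun y : ℝ => prePossio a U s x ξ y) (𝓝[>] (0 : ℝ))
      (𝓝 (reducedKernel a U s (x - ξ) +
        2 * Complex.I * ((beta2 a U : ℝ) : ℂ) / ((Real.pi * U : ℝ) : ℂ) / ((x - ξ : ℝ) : ℂ))) := by
  have hX : x - ξ ≠ 0 := sub_ne_zero.2 hne
  have hb := beta2_pos hU hUa
  have hsb : 0 < Real.sqrt (beta2 a U) := Real.sqrt_pos.2 hb
  have hr0 := radius_pos_of_ne hU hUa hX 0
  have hK0 := tendsto_macdonald_radius hU hUa hs 0 hX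
  have hK1 := tendsto_macdonald_radius hU hUa hs 1 hX
  have hdr : Tendsto (fun y => waveNumber a U s *
      ((x - ξ) / beta2 a U / radius a U (x - ξ) y : ℝ)) (𝓝[>] 0)
      (𝓝 (waveNumber a U s * ((x - ξ) / beta2 a U / radius a U (x - ξ) 0 : ℝ))) := by
    have h1 : ContinuousAt (fun y => waveNumber a U s *
        ((x - ξ) / beta2 a U / radius a U (x - ξ) y : ℝ)) 0 := by
      have h2 : ContinuousAt (fun y => (x - ξ) / beta2 a U / radius a U (x - ξ) y) 0 :=
        continuousAt_const.div (continuous_radius _).continuousAt hr0.ne'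
      exact continuousAt_const.mul (Complex.continuous_ofReal.continuousAt.comp h2)
    exact h1.tendsto.mono_left nhdsWithin_le_nhds
  have hint : Tendsto (fun y => ∫ u in Iic x, Complex.exp (-(lam a U s * (u : ℂ))) *
      macdonald 0 (waveNumber a U s * (radius a U (u - ξ) y : ℝ))) (𝓝[>] 0)
      (𝓝 (∫ u in Iic x, Complex.exp (-(lam a U s * (u : ℂ))) *
        macdonald 0 (waveNumber a U s * (radius a U (u - ξ) 0 : ℝ)))) := by
    refine tendsto_integral_filter_of_dominated_convergence _
      (Eventually.of_forall fun y => aestronglyMeasurable_wake s ξ y _)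
      (Eventually.of_forall fun y => ?_) (integrable_wake_majorant hU hUa hs x ξ) ?_
    · filter_upwards [self_mem_ae_restrict measurableSet_Iic,
        ae_restrict_of_ae (ae_ne ξ)] with u hu hne
      rw [norm_mul]
      gcongr
      · exact norm_exp_neg_lam_mul_le hU hUa hs hu
      · exact norm_macdonald_waveNumber_le hU hUa hs y hne
    · filter_upwards [ae_restrict_of_ae (ae_ne ξ)] with u hne
      rw [waveNumber_mul_radius_zero hU hUa]
      exact (tendsto_macdonald_radius hU hUa hs 0 (sub_ne_zero.2 hne)).const_mul _
  have hlim := (((hK1.neg.mul hdr).const_mul hankelConst).const_mul ((beta2 a U / U : ℝ) : ℂ)).add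
    (((hK0.const_mul hankelConst).const_mul (lam a U s * ((beta2 a U / U : ℝ) : ℂ)))) |>.add
    ((hint.const_mul hankelConst).const_mul (Complex.exp (lam a U s * (x : ℂ)) / (U : ℂ)
      * (lam a U s ^ 2 * ((beta2 a U : ℝ) : ℂ) - s ^ 2 / ((a ^ 2 * beta2 a U : ℝ) : ℂ))))
  have hlim' := hlim.congr' (f₂ := fun y : ℝ => prePossio a U s x ξ y) (by
    filter_upwards [self_mem_nhdsWithin] with y hy
    rw [prePossio, (hasDerivAt_hankel0_waveArg hU hUa hs ξ x hy).deriv,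
      hankel0_waveArg hU hUa hs (radius_pos_of_height hU hUa _ hy)]
    have : ∫ u in Iic x, Complex.exp (-(lam a U s * (u : ℂ))) * hankel0 (waveArg a U s ξ y u) =
        hankelConst * ∫ u in Iic x, Complex.exp (-(lam a U s * (u : ℂ))) *
          macdonald 0 (waveNumber a U s * (radius a U (u - ξ) y : ℝ)) := by
      rw [← integral_const_mul]
      refine setIntegral_congr_fun measurableSet_Iic fun u _ => ?_
      simp only [hankel0_waveArg hU hUa hs (radius_pos_of_height hU hUa _ hy)]
      ring
    rw [this])
  convert! hlim' using 2
  have hU' : (U : ℂ) ≠ 0 := by exact_mod_cast hU.ne'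
  have hpi : (Real.pi : ℂ) ≠ 0 := by exact_mod_cast Real.pi_ne_zero
  have hb' : ((beta2 a U : ℝ) : ℂ) ≠ 0 := by exact_mod_cast hb.ne'
  have hX' : ((x - ξ : ℝ) : ℂ) ≠ 0 := by exact_mod_cast hX
  have habs : ((|x - ξ| : ℝ) : ℂ) * ((|x - ξ| : ℝ) : ℂ) =
      ((x - ξ : ℝ) : ℂ) * ((x - ξ : ℝ) : ℂ) := by
    rw [← Complex.ofReal_mul, abs_mul_abs_self, Complex.ofReal_mul]
  have habs0 : ((|x - ξ| : ℝ) : ℂ) ≠ 0 := by exact_mod_cast (abs_pos.2 hX).ne'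
  have hr0' : ((radius a U (x - ξ) 0 : ℝ) : ℂ) ≠ 0 := by exact_mod_cast hr0.ne'
  have hdir : ((beta2 a U / U : ℝ) : ℂ) *
      (waveNumber a U s * (((x - ξ) / beta2 a U / radius a U (x - ξ) 0 : ℝ) : ℂ)) =
      ((beta2 a U / U : ℝ) : ℂ) * ((((x - ξ : ℝ) : ℂ))⁻¹ *
        (axialNumber a U s * ((|x - ξ| : ℝ) : ℂ))) := by
    rw [← waveNumber_mul_radius_zero hU hUa]
    have hrsq : ((radius a U (x - ξ) 0 : ℝ) : ℂ) ^ 2 * ((beta2 a U : ℝ) : ℂ) =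
        ((x - ξ : ℝ) : ℂ) ^ 2 := by
      have h1 : radius a U (x - ξ) 0 ^ 2 * beta2 a U = (x - ξ) ^ 2 := by
        rw [radius_zero hU hUa, div_pow, Real.sq_sqrt hb.le, sq_abs]
        field_simp
      exact_mod_cast congrArg (fun r : ℝ => (r : ℂ)) h1
    rw [Complex.ofReal_div ((x - ξ) / beta2 a U), Complex.ofReal_div (x - ξ), Complex.ofReal_div]
    field_simp
    linear_combination -(waveNumber a U s) * hrsq
  have hwake := exp_mul_integral_wake hU hUa s x ξ
  rw [lam_mul_beta2 hU hUa, lam_sq_sub hU hUa, reducedKernel, ← hwake, hankelConst]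
  rw [hankelConst] at *
  rw [Complex.ofReal_mul]
  set W := ∫ u in Iic x, Complex.exp (-(lam a U s * (u : ℂ))) *
      macdonald 0 (waveNumber a U s * (radius a U (u - ξ) 0 : ℝ))
  set K1 := macdonald 1 (axialNumber a U s * ((|x - ξ| : ℝ) : ℂ))
  have e1 : ((beta2 a U / U : ℝ) : ℂ) * (-(2 * Complex.I / (Real.pi : ℂ)) * (-K1 *
      (waveNumber a U s * (((x - ξ) / beta2 a U / radius a U (x - ξ) 0 : ℝ) : ℂ)))) =
      -(2 * Complex.I / (Real.pi : ℂ)) * -K1 * (((beta2 a U / U : ℝ) : ℂ) *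
        ((((x - ξ : ℝ) : ℂ))⁻¹ * (axialNumber a U s * ((|x - ξ| : ℝ) : ℂ)))) := by
    rw [← hdir]; ring
  rw [e1, Complex.ofReal_div]
  field_simp
  ring

lemma possioKernel_eq (hU : 0 < U) (hUa : U < a) {s : ℂ} (hs : 0 < s.re) {x ξ : ℝ}
    (hne : x ≠ ξ) :
    possioKernel a U s x ξ = reducedKernel a U s (x - ξ) +
      2 * Complex.I * ((beta2 a U : ℝ) : ℂ) / ((Real.pi * U : ℝ) : ℂ) / ((x - ξ : ℝ) : ℂ) :=
  (tendsto_prePossio hU hUa hs hne).limUnder_eq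

lemma kernelK_eq (hU : 0 < U) (hUa : U < a) {s : ℂ} (hs : 0 < s.re) {x ξ : ℝ} (hne : x ≠ ξ) :
    kernelK a U s x ξ = reducedKernel a U s (x - ξ) := by
  rw [kernelK, possioKernel_eq hU hUa hs hne, add_sub_cancel_right]

lemma measurable_reducedKernel (s : ℂ) : Measurable (reducedKernel a U s) := by
  have h1 := measurable_macdonald 0
  have h2 := measurable_macdonald 1
  have h3 : Measurable fun X : ℝ => ∫ v, wakeIntegrand a U s X v := by
    have : StronglyMeasurable (Function.uncurry fun X v => wakeIntegrand a U s X v) := by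
      have hset : MeasurableSet {p : ℝ × ℝ | p.2 ≤ p.1} := measurableSet_le (by fun_prop)
        (by fun_prop)
      have hf : Measurable fun p : ℝ × ℝ => Complex.exp (lam a U s * ((p.1 - p.2 : ℝ) : ℂ)) *
          macdonald 0 (axialNumber a U s * (|p.2| : ℝ)) := by fun_prop
      exact (hf.indicator hset).stronglyMeasurable
    exact this.integral_prod_right.measurable
  unfold reducedKernel
  fun_prop

/-- On each half plane `Re s ≥ σ₁` the kernel is `O(|s|²)`, with a singularity on the diagonal
no worse than `|X|^{-1/4}`: the Cauchy part of `K₁` has been removed. -/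
lemma exists_norm_reducedKernel_le (hU : 0 < U) (hUa : U < a) {σ₁ : ℝ} (hσ : 0 < σ₁) :
    ∃ C : ℝ, 0 < C ∧ ∀ s : ℂ, σ₁ ≤ s.re → ∀ X : ℝ, X ≠ 0 →
      ‖reducedKernel a U s X‖ ≤ C * ‖s‖ ^ 2 * (1 + |X| ^ (-(1 / 4) : ℝ)) := by
  have hb := beta2_pos hU hUa
  have ha : 0 < a := hU.trans hUa
  set A := ∫ v : ℝ, majorant |v| with hA
  have hA0 : 0 ≤ A := integral_nonneg fun v => majorant_nonneg (abs_nonneg v)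
  set C1 := 1 / (U * a * σ₁) with hC1
  set C2 := 1 / (σ₁ * U ^ 2) * (8 * (σ₁ / (a * beta2 a U)) ^ (-(1 / 4) : ℝ)) with hC2
  set C3 := 1 / U ^ 3 * (A / (σ₁ / (a * beta2 a U))) with hC3
  have hC1p : 0 < C1 := by positivity
  have hC2p : 0 < C2 := by positivity
  have hC3p : 0 ≤ C3 := by positivity
  refine ⟨C1 + C2 + C3, by positivity, fun s hs X hX => ?_⟩
  have hs0 : 0 < s.re := hσ.trans_le hs
  have hsn : σ₁ ≤ ‖s‖ := hs.trans (Complex.re_le_norm s)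
  have hXa : 0 < |X| := abs_pos.2 hX
  set κ := axialNumber a U s with hκ
  have hρ : 0 < κ.re := axialNumber_re_pos hU hUa hs0
  have hρ1 : σ₁ / (a * beta2 a U) ≤ κ.re := by rw [hκ, axialNumber_re]; gcongr
  have hre : (κ * (|X| : ℝ)).re = κ.re * |X| := Complex.re_mul_ofReal _ _
  have hrep : 0 < (κ * (|X| : ℝ)).re := by rw [hre]; positivity
  have hnκ : ‖κ‖ = ‖s‖ / (a * beta2 a U) := by
    rw [hκ, axialNumber, norm_div, Complex.norm_real, Real.norm_of_nonneg (by positivity)]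
  have hconst : ‖hankelConst‖ ≤ 1 := by
    rw [hankelConst, norm_neg, norm_div, norm_mul, Complex.norm_I, Complex.norm_real,
      Real.norm_of_nonneg Real.pi_pos.le, Complex.norm_ofNat, mul_one, div_le_one Real.pi_pos]
    exact Real.two_le_pi
  have hY : 0 ≤ |X| ^ (-(1 / 4) : ℝ) := by positivity
  -- the regularised derivative term
  have t1 : ‖((beta2 a U / U : ℝ) : ℂ) * ((X : ℂ)⁻¹ *
      (1 - κ * (|X| : ℝ) * macdonald 1 (κ * (|X| : ℝ))))‖ ≤ C1 * ‖s‖ ^ 2 := by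
    have h1 := norm_mul_macdonald_one_sub_one_le hrep
    rw [norm_sub_rev, norm_mul, Complex.norm_real, Real.norm_of_nonneg hXa.le, hre] at h1
    rw [norm_mul, norm_mul, norm_inv, Complex.norm_real, Complex.norm_real,
      Real.norm_of_nonneg (by positivity : 0 ≤ beta2 a U / U), Real.norm_eq_abs]
    calc _ ≤ beta2 a U / U * (|X|⁻¹ * ((‖κ‖ * |X|) ^ 2 / (κ.re * |X|))) := by gcongr
      _ = beta2 a U / U * (‖κ‖ ^ 2 / κ.re) := by field_simp
      _ = ‖s‖ ^ 2 / (U * a * s.re) := by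
          rw [hnκ, hκ, axialNumber_re]
          field_simp
      _ ≤ ‖s‖ ^ 2 / (U * a * σ₁) := by gcongr
      _ = _ := by rw [hC1]; ring
  have t2 : ‖s / (U : ℂ) ^ 2 * macdonald 0 (κ * (|X| : ℝ))‖ ≤
      C2 * ‖s‖ ^ 2 * |X| ^ (-(1 / 4) : ℝ) := by
    have h1 : ‖macdonald 0 (κ * (|X| : ℝ))‖ ≤
        8 * ((σ₁ / (a * beta2 a U)) ^ (-(1 / 4) : ℝ) * |X| ^ (-(1 / 4) : ℝ)) := by
      rw [← Real.mul_rpow (by positivity) hXa.le]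
      refine (norm_macdonald_zero_le_majorant (q := σ₁ / (a * beta2 a U) * |X|)
        (by positivity) ?_).trans (majorant_le (by positivity))
      rw [hre]
      gcongr
    have h2 : ‖s‖ ≤ ‖s‖ ^ 2 / σ₁ := by
      rw [le_div_iff₀ hσ]; nlinarith
    rw [norm_mul, norm_div, norm_pow, Complex.norm_real, Real.norm_of_nonneg hU.le]
    calc _ ≤ ‖s‖ ^ 2 / σ₁ / U ^ 2 *
          (8 * ((σ₁ / (a * beta2 a U)) ^ (-(1 / 4) : ℝ) * |X| ^ (-(1 / 4) : ℝ))) := by gcongr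
      _ = _ := by rw [hC2]; field_simp
  have t3 : ‖s ^ 2 / (U : ℂ) ^ 3 * ∫ v, wakeIntegrand a U s X v‖ ≤ C3 * ‖s‖ ^ 2 := by
    have h1 : ‖∫ v, wakeIntegrand a U s X v‖ ≤ ∫ v : ℝ, majorant (κ.re * |v|) := by
      refine norm_integral_le_of_norm_le (integrable_majorant_mul_abs hρ) ?_
      filter_upwards [ae_ne 0] with v hv
      have hm : 0 ≤ majorant (κ.re * |v|) := majorant_nonneg (by positivity)
      by_cases hvX : v ≤ X
      · simp only [wakeIntegrand, indicator, mem_Iic, hvX, if_true]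
        rw [norm_mul, Complex.norm_exp, Complex.re_mul_ofReal]
        have h2 : Real.exp ((lam a U s).re * (X - v)) ≤ 1 := by
          apply Real.exp_le_one_iff.2
          have := lam_re_neg hU hUa hs0
          nlinarith
        have h3 : ‖macdonald 0 (κ * (|v| : ℝ))‖ ≤ majorant (κ.re * |v|) :=
          norm_macdonald_zero_le_majorant (mul_pos hρ (abs_pos.2 hv))
            (Complex.re_mul_ofReal _ _).ge
        calc _ ≤ 1 * majorant (κ.re * |v|) := by gcongr
          _ = _ := one_mul _
      · simpa only [wakeIntegrand, indicator, mem_Iic, hvX, if_false, norm_zero] using hm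
    rw [integral_majorant_mul_abs hρ] at h1
    rw [norm_mul, norm_div, norm_pow, norm_pow, Complex.norm_real, Real.norm_of_nonneg hU.le]
    calc _ ≤ ‖s‖ ^ 2 / U ^ 3 * (A / (σ₁ / (a * beta2 a U))) := by
          gcongr
          exact h1.trans (by gcongr)
      _ = _ := by rw [hC3]; ring
  rw [reducedKernel, norm_mul]
  calc _ ≤ 1 * (C1 * ‖s‖ ^ 2 + C2 * ‖s‖ ^ 2 * |X| ^ (-(1 / 4) : ℝ) + C3 * ‖s‖ ^ 2) := by
        gcongr
        refine (norm_add_le _ _).trans (add_le_add ((norm_sub_le _ _).trans ?_) t3)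
        exact add_le_add t1 t2
    _ ≤ _ := by
        have hs2 : 0 ≤ ‖s‖ ^ 2 := by positivity
        have p1 : 0 ≤ C1 * ‖s‖ ^ 2 * |X| ^ (-(1 / 4) : ℝ) := by positivity
        have p2 : 0 ≤ C2 * ‖s‖ ^ 2 := by positivity
        have p3 : 0 ≤ C3 * ‖s‖ ^ 2 * |X| ^ (-(1 / 4) : ℝ) := by positivity
        linarith

end Kernel

/-! ### Poisson kernels at Lebesgue points -/

/-- `π` times the Poisson kernel of the upper half plane. -/
def poissonKernel (ε t : ℝ) : ℝ := ε / (t ^ 2 + ε ^ 2)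

lemma poissonKernel_nonneg {ε : ℝ} (hε : 0 < ε) (t : ℝ) : 0 ≤ poissonKernel ε t := by
  unfold poissonKernel; positivity

lemma poissonKernel_eq {ε : ℝ} (hε : 0 < ε) (t : ℝ) :
    poissonKernel ε t = ε⁻¹ * (1 + (ε⁻¹ * t) ^ 2)⁻¹ := by
  unfold poissonKernel
  field_simp
  ring

lemma integrable_poissonKernel {ε : ℝ} (hε : 0 < ε) (x : ℝ) :
    Integrable fun y => poissonKernel ε (y - x) := by
  have h := ((integrable_inv_one_add_sq.comp_mul_left' (inv_pos.2 hε).ne').const_mul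
    ε⁻¹).comp_sub_right x
  refine h.congr (Eventually.of_forall fun y => ?_)
  simp only [poissonKernel_eq hε]

lemma integral_poissonKernel {ε : ℝ} (hε : 0 < ε) (x : ℝ) :
    ∫ y, poissonKernel ε (y - x) = Real.pi := by
  rw [integral_sub_right_eq_self (poissonKernel ε) x]
  simp only [poissonKernel_eq hε]
  rw [integral_const_mul, Measure.integral_comp_mul_left (fun t : ℝ => (1 + t ^ 2)⁻¹),
    integral_univ_inv_one_add_sq, inv_inv, abs_of_pos hε, smul_eq_mul]
  field_simp

/-- The Poisson kernel is dominated by a geometric series of averages over dyadic intervals. -/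
lemma ofReal_poissonKernel_le {ε : ℝ} (hε : 0 < ε) (x y : ℝ) :
    ENNReal.ofReal (poissonKernel ε (y - x)) ≤
      ∑' k : ℕ, ENNReal.ofReal (4 / (4 ^ k * ε)) *
        (Metric.closedBall x (2 ^ k * ε)).indicator 1 y := by
  have hex : ∃ k : ℕ, |y - x| ≤ 2 ^ k * ε := by
    obtain ⟨k, hk⟩ := pow_unbounded_of_one_lt (|y - x| / ε) (one_lt_two (α := ℝ))
    exact ⟨k, ((div_lt_iff₀ hε).1 hk).le⟩
  classical
  set k := Nat.find hex with hk
  have hk1 : |y - x| ≤ 2 ^ k * ε := Nat.find_spec hex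
  have hmem : y ∈ Metric.closedBall x (2 ^ k * ε) := by
    rw [Metric.mem_closedBall, Real.dist_eq]; exact hk1
  refine le_trans ?_ (ENNReal.le_tsum k)
  rw [indicator_of_mem hmem, Pi.one_apply, mul_one]
  apply ENNReal.ofReal_le_ofReal
  unfold poissonKernel
  rcases Nat.eq_zero_or_pos k with h0 | hpos
  · rw [h0, pow_zero, one_mul, div_le_div_iff₀ (by positivity) hε]
    nlinarith [sq_nonneg (y - x)]
  · obtain ⟨j, hj⟩ := Nat.exists_eq_succ_of_ne_zero hpos.ne'
    have hj1 : 2 ^ j * ε < |y - x| := by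
      have := Nat.find_min hex (m := j) (by omega)
      exact not_le.1 this
    have hsq : (2 ^ j * ε) ^ 2 ≤ (y - x) ^ 2 := by
      rw [← sq_abs (y - x)]
      gcongr
    rw [hj, pow_succ (4 : ℝ), div_le_div_iff₀ (by positivity) (by positivity)]
    have h4 : (4 : ℝ) ^ j = (2 ^ j) ^ 2 := by
      rw [← pow_mul, mul_comm, pow_mul]; norm_num
    rw [h4]
    nlinarith

/-- The mean oscillation `⨍_{|y - x| ≤ r} |g(y) - g(x)| dy`. -/
def oscillation (g : ℝ → ℂ) (x r : ℝ) : ENNReal :=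
  (∫⁻ y in Metric.closedBall x r, ‖g y - g x‖ₑ) / volume (Metric.closedBall x r)

lemma exists_oscillation_le {g : ℝ → ℂ} (hg : Integrable g) {x : ℝ}
    (hx : Tendsto (oscillation g x) (𝓝[>] 0) (𝓝 0)) :
    ∃ M : ENNReal, M ≠ ⊤ ∧ ∀ r, 0 < r → oscillation g x r ≤ M := by
  have h1 : ∀ᶠ r in 𝓝[>] (0 : ℝ), oscillation g x r < 1 := hx.eventually (gt_mem_nhds one_pos)
  obtain ⟨r₀, hr₀, h2⟩ := mem_nhdsGT_iff_exists_Ioo_subset.1 h1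
  have hr₀' : 0 < r₀ := hr₀
  have hfin : (∫⁻ y, ‖g y‖ₑ) ≠ ⊤ := hg.2.ne
  refine ⟨1 + ((∫⁻ y, ‖g y‖ₑ) / ENNReal.ofReal (2 * r₀) + ‖g x‖ₑ), ?_, fun r hr => ?_⟩
  · have : (∫⁻ y, ‖g y‖ₑ) / ENNReal.ofReal (2 * r₀) ≠ ⊤ :=
      ENNReal.div_ne_top hfin (by simpa using hr₀')
    exact ENNReal.add_ne_top.2 ⟨ENNReal.one_ne_top, ENNReal.add_ne_top.2 ⟨this, enorm_ne_top⟩⟩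
  · rcases lt_or_ge r r₀ with hlt | hge
    · exact (h2 ⟨hr, hlt⟩).le.trans le_self_add
    · refine le_trans ?_ le_add_self
      have hvol : volume (Metric.closedBall x r) = ENNReal.ofReal (2 * r) :=
        Real.volume_closedBall _ _
      have hv0 : ENNReal.ofReal (2 * r) ≠ 0 := by simpa using hr
      have hle : (∫⁻ y in Metric.closedBall x r, ‖g y - g x‖ₑ) ≤
          (∫⁻ y, ‖g y‖ₑ) + ‖g x‖ₑ * ENNReal.ofReal (2 * r) := by
        calc _ ≤ ∫⁻ y in Metric.closedBall x r, (‖g y‖ₑ + ‖g x‖ₑ) :=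
              lintegral_mono fun y => enorm_sub_le
          _ = (∫⁻ y in Metric.closedBall x r, ‖g y‖ₑ) + ‖g x‖ₑ * ENNReal.ofReal (2 * r) := by
              rw [lintegral_add_right _ measurable_const, setLIntegral_const, hvol]
          _ ≤ _ := by gcongr; exact Measure.restrict_le_self
      unfold oscillation
      rw [hvol]
      calc _ ≤ ((∫⁻ y, ‖g y‖ₑ) + ‖g x‖ₑ * ENNReal.ofReal (2 * r)) / ENNReal.ofReal (2 * r) := by
            gcongr
        _ = (∫⁻ y, ‖g y‖ₑ) / ENNReal.ofReal (2 * r) + ‖g x‖ₑ := by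
            rw [ENNReal.add_div, ENNReal.mul_div_cancel_right hv0 ENNReal.ofReal_ne_top]
        _ ≤ _ := by gcongr

lemma lintegral_mul_poissonKernel_le {g : ℝ → ℂ} (hg : Integrable g) (x : ℝ) {ε : ℝ}
    (hε : 0 < ε) :
    ∫⁻ y, ‖g y - g x‖ₑ * ENNReal.ofReal (poissonKernel ε (y - x)) ≤
      ∑' k : ℕ, ENNReal.ofReal (8 / 2 ^ k) * oscillation g x (2 ^ k * ε) := by
  have hmeas : AEMeasurable (fun y => ‖g y - g x‖ₑ) volume :=
    (hg.aestronglyMeasurable.sub aestronglyMeasurable_const).enorm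
  calc _ ≤ ∫⁻ y, ∑' k : ℕ, ENNReal.ofReal (4 / (4 ^ k * ε)) *
        (Metric.closedBall x (2 ^ k * ε)).indicator (fun y => ‖g y - g x‖ₑ) y := by
        refine lintegral_mono fun y => ?_
        refine (mul_le_mul_right (ofReal_poissonKernel_le hε x y) _).trans_eq ?_
        rw [← ENNReal.tsum_mul_left]
        congr 1
        ext k
        by_cases hy : y ∈ Metric.closedBall x (2 ^ k * ε)
        · simp only [indicator_of_mem hy, Pi.one_apply]; ring
        · simp only [indicator_of_notMem hy, mul_zero]
    _ = ∑' k : ℕ, ENNReal.ofReal (4 / (4 ^ k * ε)) *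
        ∫⁻ y in Metric.closedBall x (2 ^ k * ε), ‖g y - g x‖ₑ := by
        rw [lintegral_tsum fun k =>
          (hmeas.indicator Metric.isClosed_closedBall.measurableSet).const_mul _]
        congr 1
        ext k
        rw [lintegral_const_mul'' _ (hmeas.indicator Metric.isClosed_closedBall.measurableSet),
          lintegral_indicator Metric.isClosed_closedBall.measurableSet]
    _ = _ := by
        congr 1
        ext k
        have hr : 0 < 2 ^ k * ε := by positivity
        have hvol : volume (Metric.closedBall x (2 ^ k * ε)) = ENNReal.ofReal (2 * (2 ^ k * ε)) :=
          Real.volume_closedBall _ _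
        have hv0 : ENNReal.ofReal (2 * (2 ^ k * ε)) ≠ 0 := by
          rw [Ne, ENNReal.ofReal_eq_zero, not_le]; positivity
        have h8 : ENNReal.ofReal (8 / 2 ^ k) =
            ENNReal.ofReal (4 / (4 ^ k * ε)) * ENNReal.ofReal (2 * (2 ^ k * ε)) := by
          rw [← ENNReal.ofReal_mul (by positivity)]
          congr 1
          have h4 : (4 : ℝ) ^ k = (2 ^ k) * 2 ^ k := by rw [← mul_pow]; norm_num
          rw [h4]
          field_simp
          norm_num
        rw [h8, oscillation, hvol, mul_assoc, ENNReal.mul_div_cancel hv0 ENNReal.ofReal_ne_top]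

lemma tendsto_lintegral_poissonKernel {g : ℝ → ℂ} (hg : Integrable g) {x : ℝ}
    (hx : Tendsto (oscillation g x) (𝓝[>] 0) (𝓝 0)) :
    Tendsto (fun ε => ∫⁻ y, ‖g y - g x‖ₑ * ENNReal.ofReal (poissonKernel ε (y - x))) (𝓝[>] 0)
      (𝓝 0) := by
  obtain ⟨M, hM, hle⟩ := exists_oscillation_le hg hx
  have hsum : Tendsto (fun ε : ℝ => ∑' k : ℕ, ENNReal.ofReal (8 / 2 ^ k) *
      oscillation g x (2 ^ k * ε)) (𝓝[>] 0) (𝓝 0) := by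
    have h0 : ∑' k : ℕ, ENNReal.ofReal (8 / 2 ^ k) * (0 : ENNReal) = 0 := by simp
    rw [← h0]
    simp only [← lintegral_count]
    refine tendsto_lintegral_filter_of_dominated_convergence
      (fun k : ℕ => ENNReal.ofReal (8 / 2 ^ k) * M)
      (Eventually.of_forall fun ε => measurable_of_countable _) ?_ ?_
      (Eventually.of_forall fun k => ?_)
    · filter_upwards [self_mem_nhdsWithin] with ε hε
      refine Eventually.of_forall fun k => ?_
      have hr : 0 < 2 ^ k * ε := mul_pos (by positivity) hε
      gcongr
      exact hle _ hr
    · rw [lintegral_count, ENNReal.tsum_mul_right]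
      refine ENNReal.mul_ne_top ?_ hM
      have hs : Summable fun k : ℕ => (8 : ℝ) / 2 ^ k := by
        refine (summable_geometric_two.mul_left 8).congr fun k => ?_
        rw [one_div, inv_pow, div_eq_mul_inv]
      rw [← ENNReal.ofReal_tsum_of_nonneg (fun k => by positivity) hs]
      exact ENNReal.ofReal_ne_top
    · refine ENNReal.Tendsto.const_mul ?_ (Or.inr ENNReal.ofReal_ne_top)
      refine hx.comp ?_
      refine tendsto_nhdsWithin_of_tendsto_nhds_of_eventually_within _ ?_ ?_
      · have : Tendsto (fun ε : ℝ => 2 ^ k * ε) (𝓝 0) (𝓝 (2 ^ k * 0)) := tendsto_id.const_mul _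
        rw [mul_zero] at this
        exact this.mono_left nhdsWithin_le_nhds
      · filter_upwards [self_mem_nhdsWithin] with ε hε
        exact mul_pos (by positivity) (mem_Ioi.1 hε)
  refine tendsto_of_tendsto_of_tendsto_of_le_of_le' tendsto_const_nhds hsum
    (Eventually.of_forall fun _ => zero_le) ?_
  filter_upwards [self_mem_nhdsWithin] with ε hε
  exact lintegral_mul_poissonKernel_le hg x hε

lemma ae_tendsto_oscillation {g : ℝ → ℂ} (hg : Integrable g) :
    ∀ᵐ x, Tendsto (oscillation g x) (𝓝[>] 0) (𝓝 0) := by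
  filter_upwards [(Besicovitch.vitaliFamily (volume : Measure ℝ)).ae_tendsto_lintegral_enorm_sub_div
    hg.locallyIntegrable] with x hx
  exact hx.comp (Besicovitch.tendsto_filterAt volume x)

/-- Kernels dominated by the Poisson kernel localise at Lebesgue points. -/
lemma tendsto_integral_sub_mul_of_le_poissonKernel {g : ℝ → ℂ} (hg : Integrable g) {x : ℝ}
    (hx : Tendsto (oscillation g x) (𝓝[>] 0) (𝓝 0)) {D : ℝ → ℝ → ℝ}
    (hD : ∀ ε, 0 < ε → ∀ t, |D ε t| ≤ poissonKernel ε t) :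
    Tendsto (fun ε => ∫ y, (g y - g x) * ((D ε (y - x) : ℝ) : ℂ)) (𝓝[>] 0) (𝓝 0) := by
  rw [tendsto_zero_iff_enorm_tendsto_zero]
  refine tendsto_of_tendsto_of_tendsto_of_le_of_le' tendsto_const_nhds
    (tendsto_lintegral_poissonKernel hg hx) (Eventually.of_forall fun _ => zero_le) ?_
  filter_upwards [self_mem_nhdsWithin] with ε hε
  refine (enorm_integral_le_lintegral_enorm _).trans (lintegral_mono fun y => ?_)
  rw [enorm_mul]
  gcongr
  rw [← ofReal_norm, Complex.norm_real, Real.norm_eq_abs]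
  exact ENNReal.ofReal_le_ofReal (hD ε hε _)

lemma integrable_mul_of_le_poissonKernel {g : ℝ → ℂ} (hg : Integrable g) (x : ℝ) {ε : ℝ}
    (hε : 0 < ε) {D : ℝ → ℝ} (hm : Measurable D) (hD : ∀ t, |D t| ≤ poissonKernel ε t) :
    Integrable fun y => g y * ((D (y - x) : ℝ) : ℂ) := by
  refine hg.mul_bdd (c := 1 / ε) ?_ (Eventually.of_forall fun y => ?_)
  · exact (Complex.measurable_ofReal.comp
      (hm.comp (measurable_id.sub_const x))).aestronglyMeasurable
  · rw [Complex.norm_real, Real.norm_eq_abs]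
    refine (hD _).trans ?_
    unfold poissonKernel
    rw [div_le_div_iff₀ (by positivity) hε]
    nlinarith [sq_nonneg (y - x)]

lemma integrable_of_le_poissonKernel (x : ℝ) {ε : ℝ}
    (hε : 0 < ε) {D : ℝ → ℝ} (hm : Measurable D) (hD : ∀ t, |D t| ≤ poissonKernel ε t) :
    Integrable fun y => D (y - x) :=
  (integrable_poissonKernel hε x).mono' (hm.comp (measurable_id.sub_const x)).aestronglyMeasurable
    (Eventually.of_forall fun _ => hD _)

lemma tendsto_integral_mul_poissonKernel {g : ℝ → ℂ} (hg : Integrable g) {x : ℝ}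
    (hx : Tendsto (oscillation g x) (𝓝[>] 0) (𝓝 0)) :
    Tendsto (fun ε => ∫ y, g y * ((poissonKernel ε (y - x) : ℝ) : ℂ)) (𝓝[>] 0)
      (𝓝 (Real.pi * g x)) := by
  have hle : ∀ ε, 0 < ε → ∀ t, |poissonKernel ε t| ≤ poissonKernel ε t := fun ε hε t =>
    (abs_of_nonneg (poissonKernel_nonneg hε t)).le
  have h := (tendsto_integral_sub_mul_of_le_poissonKernel hg hx hle).add_const (Real.pi * g x)
  rw [zero_add] at h
  refine h.congr' ?_
  filter_upwards [self_mem_nhdsWithin] with ε hε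
  have hm : Measurable (poissonKernel ε) := by unfold poissonKernel; fun_prop
  have h1 := integrable_mul_of_le_poissonKernel hg x hε hm (hle ε hε)
  have h2 : Integrable fun y => g x * ((poissonKernel ε (y - x) : ℝ) : ℂ) :=
    (integrable_poissonKernel hε x).ofReal.const_mul _
  simp only [sub_mul]
  rw [integral_sub h1 h2, integral_const_mul, integral_complex_ofReal, integral_poissonKernel hε]
  ring

/-! ### Truncated and smoothed Cauchy kernels -/

/-- The conjugate Poisson kernel minus the truncated Cauchy kernel. -/
def truncationError (ε t : ℝ) : ℝ :=
  t / (t ^ 2 + ε ^ 2) - {t : ℝ | ε < |t|}.indicator (fun t => t⁻¹) t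

lemma abs_truncationError_le {ε : ℝ} (hε : 0 < ε) (t : ℝ) :
    |truncationError ε t| ≤ poissonKernel ε t := by
  unfold truncationError poissonKernel
  by_cases ht : ε < |t|
  · have ht0 : 0 < |t| := hε.trans ht
    have ht0' : t ≠ 0 := abs_pos.1 ht0
    rw [indicator_of_mem (by exact ht)]
    have h : t / (t ^ 2 + ε ^ 2) - t⁻¹ = -(ε ^ 2 / (t * (t ^ 2 + ε ^ 2))) := by
      have : t ^ 2 + ε ^ 2 ≠ 0 := by positivity
      field_simp
      ring
    rw [h, abs_neg, abs_div, abs_mul, abs_of_pos (by positivity : 0 < ε ^ 2),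
      abs_of_pos (by positivity : 0 < t ^ 2 + ε ^ 2), div_le_div_iff₀ (by positivity)
        (by positivity)]
    have : 0 < t ^ 2 + ε ^ 2 := by positivity
    nlinarith [mul_pos hε this]
  · rw [indicator_of_notMem (by exact ht), sub_zero, abs_div,
      abs_of_pos (by positivity : 0 < t ^ 2 + ε ^ 2)]
    gcongr
    exact not_lt.1 ht

lemma truncationError_neg (ε t : ℝ) : truncationError ε (-t) = -truncationError ε t := by
  unfold truncationError
  by_cases ht : ε < |t|
  · rw [indicator_of_mem (by simpa using ht), indicator_of_mem (by exact ht), neg_sq, inv_neg]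
    ring
  · rw [indicator_of_notMem (by simpa using ht), indicator_of_notMem (by exact ht), neg_sq]
    ring

lemma measurable_truncationError (ε : ℝ) : Measurable (truncationError ε) := by
  unfold truncationError
  refine Measurable.sub (by fun_prop) (Measurable.indicator (by fun_prop) ?_)
  exact measurableSet_lt measurable_const (by fun_prop)

lemma integral_truncationError (ε x : ℝ) : ∫ y, truncationError ε (y - x) = 0 := by
  rw [integral_sub_right_eq_self (truncationError ε) x]
  have h := integral_neg_eq_self (truncationError ε) volume
  simp only [truncationError_neg, integral_neg] at h
  linarith

/-- At a Lebesgue point the principal value of the Cauchy integral exists as soon as the limit of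
the conjugate Poisson integrals does. -/
lemma tendsto_truncated_of_tendsto_conjugate {h : ℝ → ℂ} (hh : Integrable h) {x : ℝ}
    (hx : Tendsto (oscillation h x) (𝓝[>] 0) (𝓝 0)) {L : ℂ}
    (hL : Tendsto (fun ε : ℝ => ∫ y, h y * (((y - x) / ((y - x) ^ 2 + ε ^ 2) : ℝ) : ℂ)) (𝓝[>] 0)
      (𝓝 L)) :
    Tendsto (fun ε : ℝ => ∫ y in {y : ℝ | ε < |y - x|}, h y * (((y - x)⁻¹ : ℝ) : ℂ)) (𝓝[>] 0)
      (𝓝 L) := by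
  have hT := tendsto_integral_sub_mul_of_le_poissonKernel hh hx
    (fun ε hε t => abs_truncationError_le hε t)
  have h1 := hL.sub hT
  rw [sub_zero] at h1
  refine h1.congr' ?_
  filter_upwards [self_mem_nhdsWithin] with ε hε
  have hε' : 0 < ε := hε
  have hset : MeasurableSet {y : ℝ | ε < |y - x|} :=
    measurableSet_lt measurable_const (by fun_prop)
  have i1 := integrable_mul_of_le_poissonKernel hh x hε' (measurable_truncationError ε)
    (abs_truncationError_le hε')
  have i2 : Integrable fun y => h x * ((truncationError ε (y - x) : ℝ) : ℂ) :=
    (integrable_of_le_poissonKernel x hε' (measurable_truncationError ε)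
      (abs_truncationError_le hε')).ofReal.const_mul _
  have i3 : Integrable fun y => h y * (((y - x) / ((y - x) ^ 2 + ε ^ 2) : ℝ) : ℂ) := by
    refine hh.mul_bdd (c := 1 / ε) ?_ (Eventually.of_forall fun y => ?_)
    · exact (by fun_prop : Measurable fun y : ℝ =>
        (((y - x) / ((y - x) ^ 2 + ε ^ 2) : ℝ) : ℂ)).aestronglyMeasurable
    · rw [Complex.norm_real, Real.norm_eq_abs, abs_div,
        abs_of_pos (by positivity : 0 < (y - x) ^ 2 + ε ^ 2),
        div_le_div_iff₀ (by positivity) hε', ← sq_abs (y - x)]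
      nlinarith [sq_nonneg (|y - x| - ε), sq_nonneg (|y - x|), abs_nonneg (y - x)]
  simp only [sub_mul]
  rw [integral_sub i1 i2, integral_const_mul, integral_complex_ofReal, integral_truncationError,
    Complex.ofReal_zero, mul_zero, sub_zero, ← integral_sub i3 i1, ← integral_indicator hset]
  refine integral_congr_ae (Eventually.of_forall fun y => ?_)
  simp only [truncationError]
  by_cases hy : ε < |y - x|
  · rw [indicator_of_mem (s := {t : ℝ | ε < |t|}) (by exact hy),
      indicator_of_mem (s := {y : ℝ | ε < |y - x|}) (by exact hy)]
    push_cast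
    ring
  · rw [indicator_of_notMem (s := {t : ℝ | ε < |t|}) (by exact hy),
      indicator_of_notMem (s := {y : ℝ | ε < |y - x|}) (by exact hy)]
    push_cast
    ring

/-! ### Two orthonormal systems of Chebyshev functions -/

/-- Two orthonormal sequences in a Hilbert space are exchanged by a bounded operator. -/
lemma exists_transfer {H : Type*} [NormedAddCommGroup H] [InnerProductSpace ℂ H] [CompleteSpace H]
    {e c : ℕ → H} (he : Orthonormal ℂ e) (hc : Orthonormal ℂ c) :
    ∃ V : H →L[ℂ] H, ∀ F, HasSum (fun n => inner ℂ (e n) F • c n) (V F) := by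
  set J := he.orthogonalFamily.linearIsometry.toContinuousLinearMap with hJ
  set J' := hc.orthogonalFamily.linearIsometry.toContinuousLinearMap with hJ'
  refine ⟨J' ∘L ContinuousLinearMap.adjoint J, fun F => ?_⟩
  have h := hc.orthogonalFamily.hasSum_linearIsometry (ContinuousLinearMap.adjoint J F)
  have hcoef : ∀ n, (ContinuousLinearMap.adjoint J F) n = inner ℂ (e n) F := by
    intro n
    have h1 := lp.inner_single_left (𝕜 := ℂ) n (1 : ℂ) (ContinuousLinearMap.adjoint J F)
    rw [ContinuousLinearMap.adjoint_inner_right] at h1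
    have h2 : J (lp.single 2 n (1 : ℂ)) = e n := by
      rw [hJ, LinearIsometry.coe_toContinuousLinearMap,
        OrthogonalFamily.linearIsometry_apply_single]
      simp
    rw [h2] at h1
    rw [h1]
    simp
  convert! h using 2 with n
  rw [hcoef]
  simp

/-- The weight `√(1 - x²)`. -/
def weight (x : ℝ) : ℝ := Real.sqrt (1 - x ^ 2)

/-- The weight `(1 - x²)^{1/4}`. -/
def rootWeight (x : ℝ) : ℝ := Real.sqrt (weight x)

lemma continuous_weight : Continuous weight := by
  unfold weight
  fun_prop

lemma continuous_rootWeight : Continuous rootWeight := continuous_weight.sqrt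

lemma weight_nonneg (x : ℝ) : 0 ≤ weight x := Real.sqrt_nonneg _

lemma rootWeight_nonneg (x : ℝ) : 0 ≤ rootWeight x := Real.sqrt_nonneg _

lemma rootWeight_mul_self (x : ℝ) : rootWeight x * rootWeight x = weight x :=
  Real.mul_self_sqrt (weight_nonneg x)

lemma weight_le_one (x : ℝ) : weight x ≤ 1 := by
  unfold weight
  rw [Real.sqrt_le_left (by norm_num)]
  nlinarith [sq_nonneg x]

lemma rootWeight_le_one (x : ℝ) : rootWeight x ≤ 1 :=
  (Real.sqrt_le_sqrt (weight_le_one x)).trans_eq Real.sqrt_one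

lemma weight_pos {x : ℝ} (hx : x ∈ Ioo (-1 : ℝ) 1) : 0 < weight x := by
  apply Real.sqrt_pos.2
  nlinarith [hx.1, hx.2]

lemma ae_mem_Ioo : ∀ᵐ x ∂μI, x ∈ Ioo (-1 : ℝ) 1 := by
  filter_upwards [self_mem_ae_restrict measurableSet_Icc, ae_restrict_of_ae (ae_ne (-1)),
    ae_restrict_of_ae (ae_ne 1)] with x hx h1 h2
  exact ⟨lt_of_le_of_ne hx.1 h1.symm, lt_of_le_of_ne hx.2 h2⟩

/-- The normalised function `√(2/π) (1 - x²)^{1/4} Uₙ(x)`, a sine in the variable `arccos x`. -/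
def sineFun (n : ℕ) (x : ℝ) : ℝ :=
  Real.sqrt (2 / Real.pi) * (rootWeight x * (Polynomial.Chebyshev.U ℝ n).eval x)

/-- The normalised function `√(2/π) (1 - x²)^{-1/4} Tₙ₊₁(x)`, a cosine in the variable
`arccos x`. -/
def cosineFun (n : ℕ) (x : ℝ) : ℝ :=
  Real.sqrt (2 / Real.pi) * ((rootWeight x)⁻¹ * (Polynomial.Chebyshev.T ℝ (n + 1)).eval x)

lemma integral_μI_eq_measureT (f : ℝ → ℝ) :
    ∫ x, f x * (weight x)⁻¹ ∂μI = ∫ x, f x ∂Polynomial.Chebyshev.measureT := by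
  rw [Polynomial.Chebyshev.integral_measureT, intervalIntegral.integral_of_le (by norm_num),
    ← integral_Icc_eq_integral_Ioc]
  simp only [weight, Real.sqrt_inv]

lemma integrable_mul_inv_weight {f : ℝ → ℝ} (hf : Continuous f) :
    Integrable (fun x => f x * (weight x)⁻¹) μI := by
  have h := Polynomial.Chebyshev.intervalIntegrable_sqrt_one_sub_sq_inv.continuousOn_mul
    hf.continuousOn
  rw [intervalIntegrable_iff_integrableOn_Icc_of_le (by norm_num)] at h
  simpa only [weight, Real.sqrt_inv] using! h

lemma weight_sq {x : ℝ} (hx : x ∈ Icc (-1 : ℝ) 1) : weight x ^ 2 = 1 - x ^ 2 :=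
  Real.sq_sqrt (by nlinarith [hx.1, hx.2])

lemma integral_sineFun_mul (n m : ℕ) :
    ∫ x, sineFun n x * sineFun m x ∂μI = if n = m then 1 else 0 := by
  have hpi := Real.pi_pos
  have h2 : Real.sqrt (2 / Real.pi) * Real.sqrt (2 / Real.pi) = 2 / Real.pi :=
    Real.mul_self_sqrt (by positivity)
  have h1 : ∫ x, sineFun n x * sineFun m x ∂μI = ∫ x, (2 / Real.pi) *
      (((1 - x ^ 2) * ((Polynomial.Chebyshev.U ℝ n).eval x *
        (Polynomial.Chebyshev.U ℝ m).eval x)) * (weight x)⁻¹) ∂μI := by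
    refine integral_congr_ae ?_
    filter_upwards [ae_mem_Ioo] with x hx
    have hw := weight_pos hx
    rw [← weight_sq (Ioo_subset_Icc_self hx)]
    unfold sineFun
    have hww : weight x ^ 2 * (weight x)⁻¹ = rootWeight x * rootWeight x := by
      rw [rootWeight_mul_self, sq, mul_assoc, mul_inv_cancel₀ hw.ne', mul_one]
    linear_combination (rootWeight x * rootWeight x * (Polynomial.Chebyshev.U ℝ n).eval x *
      (Polynomial.Chebyshev.U ℝ m).eval x) * h2 - (2 / Real.pi *
      (Polynomial.Chebyshev.U ℝ n).eval x * (Polynomial.Chebyshev.U ℝ m).eval x) * hww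
  rw [h1, integral_const_mul, integral_μI_eq_measureT]
  have h3 : ∫ x, (1 - x ^ 2) * ((Polynomial.Chebyshev.U ℝ n).eval x *
      (Polynomial.Chebyshev.U ℝ m).eval x) ∂Polynomial.Chebyshev.measureT =
      ∫ x, ((Polynomial.Chebyshev.T ℝ ((n : ℤ) - m)).eval x -
        (Polynomial.Chebyshev.T ℝ ((n : ℤ) + m + 2)).eval x) / 2
        ∂Polynomial.Chebyshev.measureT := by
    rw [Polynomial.Chebyshev.integral_measureT_eq_integral_cos,
      Polynomial.Chebyshev.integral_measureT_eq_integral_cos]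
    refine intervalIntegral.integral_congr fun θ _ => ?_
    have hn := Polynomial.Chebyshev.U_real_cos θ n
    have hm := Polynomial.Chebyshev.U_real_cos θ m
    simp only [Polynomial.Chebyshev.T_real_cos]
    have e1 : 1 - Real.cos θ ^ 2 = Real.sin θ * Real.sin θ := by
      have := Real.sin_sq_add_cos_sq θ; linarith
    have e2 : (((n : ℤ) - (m : ℤ) : ℤ) : ℝ) * θ = ((n : ℤ) + 1) * θ - ((m : ℤ) + 1) * θ := by
      push_cast; ring
    have e3 : (((n : ℤ) + (m : ℤ) + 2 : ℤ) : ℝ) * θ = ((n : ℤ) + 1) * θ + ((m : ℤ) + 1) * θ := by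
      push_cast; ring
    rw [e1, e2, e3, Real.cos_sub, Real.cos_add]
    calc _ = ((Polynomial.Chebyshev.U ℝ n).eval (Real.cos θ) * Real.sin θ) *
          ((Polynomial.Chebyshev.U ℝ m).eval (Real.cos θ) * Real.sin θ) := by ring
      _ = _ := by rw [hn, hm]; ring
  rw [h3, integral_div, integral_sub
    (Polynomial.Chebyshev.integrable_measureT (by fun_prop))
    (Polynomial.Chebyshev.integrable_measureT (by fun_prop)),
    Polynomial.Chebyshev.integral_eval_T_real_measureT_of_ne_zero (n := (n : ℤ) + m + 2) (by omega)]
  split_ifs with hnm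
  · rw [hnm, sub_self, Polynomial.Chebyshev.integral_eval_T_real_measureT_zero]
    field_simp
    ring
  · rw [Polynomial.Chebyshev.integral_eval_T_real_measureT_of_ne_zero (by omega)]
    simp

lemma integral_cosineFun_mul (n m : ℕ) :
    ∫ x, cosineFun n x * cosineFun m x ∂μI = if n = m then 1 else 0 := by
  have hpi := Real.pi_pos
  have h2 : Real.sqrt (2 / Real.pi) * Real.sqrt (2 / Real.pi) = 2 / Real.pi :=
    Real.mul_self_sqrt (by positivity)
  have h1 : ∫ x, cosineFun n x * cosineFun m x ∂μI = ∫ x, (2 / Real.pi) *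
      (((Polynomial.Chebyshev.T ℝ ((n + 1 : ℕ) : ℤ)).eval x *
        (Polynomial.Chebyshev.T ℝ ((m + 1 : ℕ) : ℤ)).eval x) * (weight x)⁻¹) ∂μI := by
    congr 1
    ext x
    rw [← rootWeight_mul_self, mul_inv, ← h2]
    unfold cosineFun
    push_cast
    ring
  rw [h1, integral_const_mul, integral_μI_eq_measureT]
  split_ifs with hnm
  · rw [hnm, Polynomial.Chebyshev.integral_T_real_mul_self_measureT_of_ne_zero (by omega)]
    field_simp
  · rw [Polynomial.Chebyshev.integral_eval_T_real_mul_eval_T_real_measureT_of_ne (by omega)]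
    simp

lemma integral_inv_rootWeight_mul_cosineFun (n : ℕ) :
    ∫ x, (rootWeight x)⁻¹ * cosineFun n x ∂μI = 0 := by
  have h1 : ∫ x, (rootWeight x)⁻¹ * cosineFun n x ∂μI = ∫ x, Real.sqrt (2 / Real.pi) *
      ((Polynomial.Chebyshev.T ℝ ((n : ℤ) + 1)).eval x * (weight x)⁻¹) ∂μI := by
    congr 1
    ext x
    rw [← rootWeight_mul_self, mul_inv]
    unfold cosineFun
    ring
  rw [h1, integral_const_mul, integral_μI_eq_measureT,
    Polynomial.Chebyshev.integral_eval_T_real_measureT_of_ne_zero (by omega), mul_zero]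

lemma measurable_rootWeight_inv : Measurable fun x => (rootWeight x)⁻¹ :=
  continuous_rootWeight.measurable.inv

lemma continuous_sineFun (n : ℕ) : Continuous (sineFun n) :=
  (continuous_rootWeight.mul (Polynomial.continuous _)).const_mul _

lemma memLp_ofReal_of_integrable_sq {f : ℝ → ℝ} (hf : Measurable f)
    (h : Integrable (fun x => f x ^ 2) μI) : MemLp (fun x => (f x : ℂ)) 2 μI := by
  have hm : AEStronglyMeasurable (fun x => (f x : ℂ)) μI :=
    (Complex.measurable_ofReal.comp hf).aestronglyMeasurable
  rw [memLp_two_iff_integrable_sq_norm hm]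
  refine h.congr (Eventually.of_forall fun x => ?_)
  simp only [Complex.norm_real, Real.norm_eq_abs, sq_abs]

lemma memLp_sineFun (n : ℕ) : MemLp (fun x => (sineFun n x : ℂ)) 2 μI :=
  memLp_ofReal_of_integrable_sq (continuous_sineFun n).measurable
    (((continuous_sineFun n).pow 2).continuousOn.integrableOn_compact isCompact_Icc)

lemma memLp_inv_rootWeight_mul {f : ℝ → ℝ} (hf : Continuous f) :
    MemLp (fun x => (((rootWeight x)⁻¹ * f x : ℝ) : ℂ)) 2 μI := by
  refine memLp_ofReal_of_integrable_sq (measurable_rootWeight_inv.mul hf.measurable) ?_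
  refine (integrable_mul_inv_weight (hf.pow 2)).congr (Eventually.of_forall fun x => ?_)
  simp only [← rootWeight_mul_self, mul_inv, Pi.pow_apply]
  ring

lemma memLp_cosineFun (n : ℕ) : MemLp (fun x => (cosineFun n x : ℂ)) 2 μI := by
  have h := memLp_inv_rootWeight_mul (f := fun x => Real.sqrt (2 / Real.pi) *
    (Polynomial.Chebyshev.T ℝ (n + 1)).eval x) (by fun_prop)
  refine h.ae_eq (Eventually.of_forall fun x => ?_)
  simp only [cosineFun]
  congr 1
  ring

lemma inner_toLp_ofReal {f : ℝ → ℝ} (hf : MemLp (fun x => (f x : ℂ)) 2 μI) (F : L2I) :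
    inner ℂ (hf.toLp _) F = ∫ x, F x * (f x : ℂ) ∂μI := by
  rw [L2.inner_def]
  refine integral_congr_ae ?_
  filter_upwards [hf.coeFn_toLp] with x hx
  rw [hx, RCLike.inner_apply]
  simp

lemma inner_toLp_ofReal_toLp_ofReal {f g : ℝ → ℝ} (hf : MemLp (fun x => (f x : ℂ)) 2 μI)
    (hg : MemLp (fun x => (g x : ℂ)) 2 μI) :
    inner ℂ (hf.toLp _) (hg.toLp _) = ((∫ x, f x * g x ∂μI : ℝ) : ℂ) := by
  rw [inner_toLp_ofReal, ← integral_complex_ofReal]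
  refine integral_congr_ae ?_
  filter_upwards [hg.coeFn_toLp] with x hx
  rw [hx]
  push_cast
  ring

/-- The function `sineFun n` as an element of `L²`. -/
def sineL (n : ℕ) : L2I := (memLp_sineFun n).toLp _

/-- The function `cosineFun n` as an element of `L²`. -/
def cosineL (n : ℕ) : L2I := (memLp_cosineFun n).toLp _

lemma orthonormal_sineL : Orthonormal ℂ sineL := by
  rw [orthonormal_iff_ite]
  intro n m
  rw [sineL, sineL, inner_toLp_ofReal_toLp_ofReal, integral_sineFun_mul]
  split_ifs <;> simp

lemma orthonormal_cosineL : Orthonormal ℂ cosineL := by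
  rw [orthonormal_iff_ite]
  intro n m
  rw [cosineL, cosineL, inner_toLp_ofReal_toLp_ofReal, integral_cosineFun_mul]
  split_ifs <;> simp

/-- The inverse finite Hilbert transform, conjugated by powers of the weight: it maps the sine
system to the cosine system. -/
def transfer : L2I →L[ℂ] L2I := (exists_transfer orthonormal_sineL orthonormal_cosineL).choose

lemma hasSum_transfer (F : L2I) :
    HasSum (fun n => inner ℂ (sineL n) F • cosineL n) (transfer F) :=
  (exists_transfer orthonormal_sineL orthonormal_cosineL).choose_spec F

lemma inner_cosineL_transfer (n : ℕ) (F : L2I) :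
    inner ℂ (cosineL n) (transfer F) = inner ℂ (sineL n) F := by
  have h := (hasSum_transfer F).mapL (innerSL ℂ (cosineL n))
  refine h.unique ?_
  have hterm : ∀ m, innerSL ℂ (cosineL n) (inner ℂ (sineL m) F • cosineL m) =
      if m = n then inner ℂ (sineL n) F else 0 := by
    intro m
    rw [innerSL_apply_apply, inner_smul_right, orthonormal_iff_ite.1 orthonormal_cosineL n m]
    by_cases hm : m = n
    · simp [hm]
    · simp [hm, Ne.symm hm]
  simp only [hterm]
  exact hasSum_ite_eq n _

lemma memLp_inv_rootWeight : MemLp (fun x => (((rootWeight x)⁻¹ : ℝ) : ℂ)) 2 μI := by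
  simpa only [mul_one] using! memLp_inv_rootWeight_mul (f := fun _ => 1) continuous_const

lemma integral_transfer_mul_inv_rootWeight (F : L2I) :
    ∫ x, transfer F x * (((rootWeight x)⁻¹ : ℝ) : ℂ) ∂μI = 0 := by
  rw [← inner_toLp_ofReal memLp_inv_rootWeight]
  have h := (hasSum_transfer F).mapL (innerSL ℂ (memLp_inv_rootWeight.toLp _))
  refine h.unique ?_
  convert! hasSum_zero using 2 with n
  rw [innerSL_apply_apply, inner_smul_right, cosineL, inner_toLp_ofReal_toLp_ofReal,
    integral_inv_rootWeight_mul_cosineFun]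
  simp

/-! ### Cauchy integrals and Chebyshev expansions -/

/-- Telescoping form of `(z - y)⁻¹ = 2 ∑ ζⁿ⁺¹ Uₙ(y)`, where `z = (ζ + ζ⁻¹) / 2`. -/
lemma sub_mul_sum_pow_mul_U {z ζ : ℂ} (hζ : ζ ^ 2 + 1 = 2 * z * ζ) (y : ℝ) (N : ℕ) :
    (z - y) * ∑ n ∈ Finset.range N,
        2 * ζ ^ (n + 1) * (((Polynomial.Chebyshev.U ℝ n).eval y : ℝ) : ℂ) =
      1 - ζ ^ N * (((Polynomial.Chebyshev.U ℝ N).eval y : ℝ) : ℂ) +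
        ζ ^ (N + 1) * (((Polynomial.Chebyshev.U ℝ ((N : ℤ) - 1)).eval y : ℝ) : ℂ) := by
  induction N with
  | zero => simp
  | succ N ih =>
    rw [Finset.sum_range_succ, mul_add, ih]
    have h : (Polynomial.Chebyshev.U ℝ ((N : ℤ) + 1)).eval y =
        2 * y * (Polynomial.Chebyshev.U ℝ N).eval y -
          (Polynomial.Chebyshev.U ℝ ((N : ℤ) - 1)).eval y := by
      rw [Polynomial.Chebyshev.U_add_one]
      simp
    simp only [Nat.cast_add, Nat.cast_one, add_sub_cancel_right, h, Complex.ofReal_sub,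
      Complex.ofReal_mul, Complex.ofReal_ofNat]
    linear_combination (-(ζ ^ N) * (((Polynomial.Chebyshev.U ℝ N).eval y : ℝ) : ℂ)) * hζ

/-- Telescoping form of `S / (z - y) = 1 + 2 ∑ ζⁿ⁺¹ Tₙ₊₁(y)`, where `z = (ζ + ζ⁻¹) / 2` and
`S = (ζ⁻¹ - ζ) / 2`. -/
lemma sub_mul_sum_pow_mul_T {z ζ : ℂ} (hζ : ζ ^ 2 + 1 = 2 * z * ζ) (y : ℝ) (N : ℕ) :
    (z - y) * (1 + ∑ n ∈ Finset.range N,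
        2 * ζ ^ (n + 1) * (((Polynomial.Chebyshev.T ℝ (n + 1)).eval y : ℝ) : ℂ)) =
      (z - ζ) - ζ ^ N * (((Polynomial.Chebyshev.T ℝ (N + 1)).eval y : ℝ) : ℂ) +
        ζ ^ (N + 1) * (((Polynomial.Chebyshev.T ℝ N).eval y : ℝ) : ℂ) := by
  induction N with
  | zero =>
    simp
    ring
  | succ N ih =>
    rw [Finset.sum_range_succ, ← add_assoc, mul_add, ih]
    have h : (Polynomial.Chebyshev.T ℝ ((N : ℤ) + 1 + 1)).eval y =
        2 * y * (Polynomial.Chebyshev.T ℝ ((N : ℤ) + 1)).eval y -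
          (Polynomial.Chebyshev.T ℝ N).eval y := by
      rw [Polynomial.Chebyshev.T_add_one, add_sub_cancel_right]
      simp
    simp only [Nat.cast_add, Nat.cast_one, h, Complex.ofReal_sub, Complex.ofReal_mul,
      Complex.ofReal_ofNat]
    linear_combination (-(ζ ^ N) * (((Polynomial.Chebyshev.T ℝ (N + 1)).eval y : ℝ) : ℂ)) * hζ

lemma abs_eval_U_le {y : ℝ} (hy : y ∈ Icc (-1 : ℝ) 1) (n : ℕ) :
    |(Polynomial.Chebyshev.U ℝ n).eval y| ≤ n + 1 := by
  have hy1 : |y| ≤ 1 := abs_le.2 hy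
  induction n with
  | zero => simp
  | succ n ih =>
    have h := Polynomial.Chebyshev.U_eq_X_mul_U_add_T ℝ (n : ℤ)
    push_cast
    rw [h, Polynomial.eval_add, Polynomial.eval_mul, Polynomial.eval_X]
    have hT := Polynomial.Chebyshev.abs_eval_T_real_le_one ((n : ℤ) + 1) hy1
    calc _ ≤ |y * (Polynomial.Chebyshev.U ℝ n).eval y| +
          |(Polynomial.Chebyshev.T ℝ ((n : ℤ) + 1)).eval y| := abs_add_le _ _
      _ ≤ 1 * (n + 1) + 1 := by
          rw [abs_mul]
          gcongr
      _ = _ := by ring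

lemma integrable_mul_continuous {g : ℝ → ℂ} (hg : Integrable g μI) {q : ℝ → ℂ}
    (hq : Continuous q) : Integrable (fun y => g y * q y) μI :=
  IntegrableOn.mul_continuousOn hg hq.continuousOn isCompact_Icc

lemma tendsto_integral_mul_of_norm_sub_le {g : ℝ → ℂ} (hg : Integrable g μI) {q : ℕ → ℝ → ℂ}
    {q₀ : ℝ → ℂ} (hq : ∀ N, Continuous (q N)) (hq₀ : Continuous q₀) {b : ℕ → ℝ}
    (hb : Tendsto b atTop (𝓝 0)) (hle : ∀ N, ∀ y ∈ Icc (-1 : ℝ) 1, ‖q N y - q₀ y‖ ≤ b N) :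
    Tendsto (fun N => ∫ y, g y * q N y ∂μI) atTop (𝓝 (∫ y, g y * q₀ y ∂μI)) := by
  rw [tendsto_iff_norm_sub_tendsto_zero]
  have h0 : Tendsto (fun N => (∫ y, ‖g y‖ ∂μI) * b N) atTop (𝓝 0) := by
    simpa using hb.const_mul (∫ y, ‖g y‖ ∂μI)
  refine squeeze_zero (fun _ => norm_nonneg _) (fun N => ?_) h0
  rw [← integral_sub (integrable_mul_continuous hg (hq N)) (integrable_mul_continuous hg hq₀),
    ← integral_mul_const]
  refine norm_integral_le_of_norm_le (hg.norm.mul_const _) ?_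
  filter_upwards [self_mem_ae_restrict measurableSet_Icc] with y hy
  rw [← mul_sub, norm_mul]
  exact mul_le_mul_of_nonneg_left (hle N y hy) (norm_nonneg _)

lemma sub_ofReal_ne_zero {z : ℂ} (hz : z.im ≠ 0) (y : ℝ) : z - y ≠ 0 := by
  intro h
  apply hz
  have := congrArg Complex.im h
  simpa using this

lemma continuous_inv_sub_ofReal {z : ℂ} (hz : z.im ≠ 0) : Continuous fun y : ℝ => (z - y)⁻¹ :=
  (by fun_prop : Continuous fun y : ℝ => z - y).inv₀ (sub_ofReal_ne_zero hz)

lemma norm_sub_div_le {z w c : ℂ} (hz : z.im ≠ 0) (y : ℝ) :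
    ‖w - c * (z - y)⁻¹‖ ≤ |z.im|⁻¹ * ‖(z - y) * w - c‖ := by
  have h := sub_ofReal_ne_zero hz y
  have h1 : w - c * (z - y)⁻¹ = (z - y)⁻¹ * ((z - y) * w - c) := by
    field_simp
  rw [h1, norm_mul, norm_inv]
  gcongr
  have := Complex.abs_im_le_norm (z - y)
  simpa using this

/-- Cauchy integrals are sums of the moments against the polynomials `Uₙ`. -/
lemma tendsto_sum_U {g : ℝ → ℂ} (hg : Integrable g μI) {z ζ : ℂ} (hz : z.im ≠ 0)
    (hζ : ζ ^ 2 + 1 = 2 * z * ζ) (hζ1 : ‖ζ‖ < 1) :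
    Tendsto (fun N => ∑ n ∈ Finset.range N, 2 * ζ ^ (n + 1) *
      ∫ y, g y * (((Polynomial.Chebyshev.U ℝ n).eval y : ℝ) : ℂ) ∂μI) atTop
      (𝓝 (∫ y, g y * (z - y)⁻¹ ∂μI)) := by
  have hc : ∀ n : ℕ, Continuous fun y : ℝ =>
      (((Polynomial.Chebyshev.U ℝ n).eval y : ℝ) : ℂ) := fun n => by fun_prop
  have h := tendsto_integral_mul_of_norm_sub_le hg
    (q := fun N y => ∑ n ∈ Finset.range N,
        2 * ζ ^ (n + 1) * (((Polynomial.Chebyshev.U ℝ n).eval y : ℝ) : ℂ))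
    (q₀ := fun y => (z - y)⁻¹)
    (b := fun N => |z.im|⁻¹ * (2 * (N * ‖ζ‖ ^ N) + ‖ζ‖ ^ N))
    (fun N => by fun_prop) (continuous_inv_sub_ofReal hz) ?_ ?_
  · refine h.congr fun N => ?_
    simp only [Finset.mul_sum]
    rw [integral_finsetSum _ fun n _ => integrable_mul_continuous hg ((hc n).const_mul _)]
    refine Finset.sum_congr rfl fun n _ => ?_
    rw [← integral_const_mul]
    congr 1
    ext y
    ring
  · have h1 := tendsto_self_mul_const_pow_of_lt_one (norm_nonneg ζ) hζ1
    have h2 := tendsto_pow_atTop_nhds_zero_of_lt_one (norm_nonneg ζ) hζ1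
    simpa using ((h1.const_mul 2).add h2).const_mul |z.im|⁻¹
  · intro N y hy
    have h1 := norm_sub_div_le (w := ∑ n ∈ Finset.range N,
        2 * ζ ^ (n + 1) * (((Polynomial.Chebyshev.U ℝ n).eval y : ℝ) : ℂ)) (c := 1) hz y
    rw [one_mul] at h1
    refine h1.trans ?_
    gcongr
    rw [sub_mul_sum_pow_mul_U hζ]
    have hU1 := abs_eval_U_le hy N
    have hU2 : |(Polynomial.Chebyshev.U ℝ ((N : ℤ) - 1)).eval y| ≤ N := by
      cases N with
      | zero => simp
      | succ N => simpa using abs_eval_U_le hy N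
    calc _ = ‖ζ ^ (N + 1) * (((Polynomial.Chebyshev.U ℝ ((N : ℤ) - 1)).eval y : ℝ) : ℂ) -
          ζ ^ N * (((Polynomial.Chebyshev.U ℝ N).eval y : ℝ) : ℂ)‖ := by congr 1; ring
      _ ≤ _ := norm_sub_le _ _
      _ ≤ ‖ζ‖ ^ N * N + ‖ζ‖ ^ N * (N + 1) := by
          rw [norm_mul, norm_mul, norm_pow, norm_pow, Complex.norm_real, Complex.norm_real,
            Real.norm_eq_abs, Real.norm_eq_abs]
          gcongr ?_ * ?_ + ?_ * ?_
          exact pow_le_pow_of_le_one (norm_nonneg _) hζ1.le (Nat.le_succ N)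
      _ = _ := by ring

/-- Cauchy integrals are sums of the moments against the polynomials `Tₙ`. -/
lemma tendsto_sum_T {g : ℝ → ℂ} (hg : Integrable g μI) (hg0 : ∫ y, g y ∂μI = 0) {z ζ : ℂ}
    (hz : z.im ≠ 0) (hζ : ζ ^ 2 + 1 = 2 * z * ζ) (hζ1 : ‖ζ‖ < 1) :
    Tendsto (fun N => ∑ n ∈ Finset.range N, 2 * ζ ^ (n + 1) *
      ∫ y, g y * (((Polynomial.Chebyshev.T ℝ (n + 1)).eval y : ℝ) : ℂ) ∂μI) atTop
      (𝓝 ((z - ζ) * ∫ y, g y * (z - y)⁻¹ ∂μI)) := by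
  have hc : ∀ n : ℕ, Continuous fun y : ℝ =>
      (((Polynomial.Chebyshev.T ℝ (n + 1)).eval y : ℝ) : ℂ) := fun n => by fun_prop
  have h := tendsto_integral_mul_of_norm_sub_le hg
    (q := fun N y => 1 + ∑ n ∈ Finset.range N,
        2 * ζ ^ (n + 1) * (((Polynomial.Chebyshev.T ℝ (n + 1)).eval y : ℝ) : ℂ))
    (q₀ := fun y => (z - ζ) * (z - y)⁻¹)
    (b := fun N => |z.im|⁻¹ * (2 * ‖ζ‖ ^ N))
    (fun N => by fun_prop) ((continuous_inv_sub_ofReal hz).const_mul _) ?_ ?_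
  · have hlim : ∫ y : ℝ, g y * ((z - ζ) * (z - y)⁻¹) ∂μI =
        (z - ζ) * ∫ y : ℝ, g y * (z - y)⁻¹ ∂μI := by
      rw [← integral_const_mul]
      congr 1
      ext y
      ring
    rw [hlim] at h
    refine h.congr fun N => ?_
    simp only [mul_add, mul_one, Finset.mul_sum]
    rw [integral_add hg (integrable_finsetSum _ fun n _ =>
      integrable_mul_continuous hg ((hc n).const_mul _)), hg0, zero_add,
      integral_finsetSum _ fun n _ => integrable_mul_continuous hg ((hc n).const_mul _)]
    refine Finset.sum_congr rfl fun n _ => ?_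
    rw [← integral_const_mul]
    congr 1
    ext y
    ring
  · have h2 := tendsto_pow_atTop_nhds_zero_of_lt_one (norm_nonneg ζ) hζ1
    simpa using (h2.const_mul 2).const_mul |z.im|⁻¹
  · intro N y hy
    refine (norm_sub_div_le hz y).trans ?_
    gcongr
    rw [sub_mul_sum_pow_mul_T hζ]
    have hT1 := Polynomial.Chebyshev.abs_eval_T_real_le_one ((N : ℤ) + 1) (abs_le.2 hy)
    have hT2 := Polynomial.Chebyshev.abs_eval_T_real_le_one (N : ℤ) (abs_le.2 hy)
    calc _ = ‖ζ ^ (N + 1) * (((Polynomial.Chebyshev.T ℝ N).eval y : ℝ) : ℂ) -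
          ζ ^ N * (((Polynomial.Chebyshev.T ℝ (N + 1)).eval y : ℝ) : ℂ)‖ := by congr 1; ring
      _ ≤ _ := norm_sub_le _ _
      _ ≤ ‖ζ‖ ^ N * 1 + ‖ζ‖ ^ N * 1 := by
          rw [norm_mul, norm_mul, norm_pow, norm_pow, Complex.norm_real, Complex.norm_real,
            Real.norm_eq_abs, Real.norm_eq_abs]
          gcongr ?_ * ?_ + ?_ * ?_
          exact pow_le_pow_of_le_one (norm_nonneg _) hζ1.le (Nat.le_succ N)
      _ = _ := by ring

lemma memLp_rootWeight : MemLp (fun x => ((rootWeight x : ℝ) : ℂ)) 2 μI :=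
  memLp_ofReal_of_integrable_sq continuous_rootWeight.measurable
    ((continuous_rootWeight.pow 2).continuousOn.integrableOn_compact isCompact_Icc)

lemma integrable_mul_rootWeight (F : L2I) :
    Integrable (fun y => F y * ((rootWeight y : ℝ) : ℂ)) μI :=
  (Lp.memLp F).integrable_mul memLp_rootWeight

lemma integrable_mul_inv_rootWeight (F : L2I) :
    Integrable (fun y => F y * (((rootWeight y)⁻¹ : ℝ) : ℂ)) μI :=
  (Lp.memLp F).integrable_mul memLp_inv_rootWeight

lemma integral_mul_U_eq_integral_transfer_mul_T (F : L2I) (n : ℕ) :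
    ∫ y, F y * ((rootWeight y : ℝ) : ℂ) * (((Polynomial.Chebyshev.U ℝ n).eval y : ℝ) : ℂ) ∂μI =
      ∫ y, transfer F y * (((rootWeight y)⁻¹ : ℝ) : ℂ) *
        (((Polynomial.Chebyshev.T ℝ (n + 1)).eval y : ℝ) : ℂ) ∂μI := by
  have h := inner_cosineL_transfer n F
  rw [sineL, cosineL, inner_toLp_ofReal, inner_toLp_ofReal] at h
  have hne : ((Real.sqrt (2 / Real.pi) : ℝ) : ℂ) ≠ 0 := by
    have : 0 < Real.sqrt (2 / Real.pi) := Real.sqrt_pos.2 (by positivity)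
    exact_mod_cast this.ne'
  apply mul_left_cancel₀ hne
  rw [← integral_const_mul, ← integral_const_mul]
  convert! h.symm using 2
  · ext y
    simp only [sineFun]
    push_cast
    ring
  · ext y
    simp only [cosineFun]
    push_cast
    ring

/-- The Cauchy integrals of `F √w` and of `(transfer F) / √w` differ by the factor
`S = √(z² - 1)`. -/
lemma integral_cauchy_eq_mul_integral_cauchy (F : L2I) {z S : ℂ} (hz : z.im ≠ 0)
    (hS : S ^ 2 = z ^ 2 - 1) (hzS : ‖z - S‖ < 1) :
    ∫ y, F y * ((rootWeight y : ℝ) : ℂ) * (z - y)⁻¹ ∂μI =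
      S * ∫ y, transfer F y * (((rootWeight y)⁻¹ : ℝ) : ℂ) * (z - y)⁻¹ ∂μI := by
  have hζ : (z - S) ^ 2 + 1 = 2 * z * (z - S) := by linear_combination hS
  have h1 := tendsto_sum_U (integrable_mul_rootWeight F) hz hζ hzS
  have h2 := tendsto_sum_T (integrable_mul_inv_rootWeight (transfer F))
    (integral_transfer_mul_inv_rootWeight F) hz hζ hzS
  simp only [integral_mul_U_eq_integral_transfer_mul_T] at h1
  rw [sub_sub_cancel] at h2
  exact tendsto_nhds_unique h1 h2

/-! ### The finite Hilbert transform as a principal value -/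

/-- The imaginary part of the branch of `√(z² - 1)`, `z = x + iε`, with positive imaginary part. -/
def branchIm (x ε : ℝ) : ℝ :=
  Real.sqrt ((1 - x ^ 2 + ε ^ 2 + Real.sqrt ((1 - x ^ 2 + ε ^ 2) ^ 2 + 4 * (x * ε) ^ 2)) / 2)

/-- The real part of the branch of `√(z² - 1)`, `z = x + iε`, with positive imaginary part. -/
def branchRe (x ε : ℝ) : ℝ := x * ε / branchIm x ε

lemma branchIm_pos {x : ℝ} (hx : x ∈ Ioo (-1 : ℝ) 1) (ε : ℝ) : 0 < branchIm x ε := by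
  unfold branchIm
  have h : 0 < 1 - x ^ 2 := by nlinarith [hx.1, hx.2]
  positivity

lemma continuous_branchIm (x : ℝ) : Continuous (branchIm x) := by
  unfold branchIm
  fun_prop

lemma tendsto_branchIm {x : ℝ} (hx : x ∈ Ioo (-1 : ℝ) 1) :
    Tendsto (branchIm x) (𝓝[>] 0) (𝓝 (weight x)) := by
  have h : 0 < 1 - x ^ 2 := by nlinarith [hx.1, hx.2]
  have h0 : branchIm x 0 = weight x := by
    unfold branchIm weight
    congr 1
    simp [Real.sqrt_sq h.le]
  rw [← h0]
  exact ((continuous_branchIm x).tendsto 0).mono_left nhdsWithin_le_nhds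

lemma tendsto_branchRe {x : ℝ} (hx : x ∈ Ioo (-1 : ℝ) 1) :
    Tendsto (branchRe x) (𝓝[>] 0) (𝓝 0) := by
  have h1 : Tendsto (fun ε : ℝ => x * ε) (𝓝[>] 0) (𝓝 0) := by
    have : Tendsto (fun ε : ℝ => x * ε) (𝓝 0) (𝓝 (x * 0)) := (continuous_const_mul x).tendsto 0
    rw [mul_zero] at this
    exact this.mono_left nhdsWithin_le_nhds
  have h2 := h1.div (tendsto_branchIm hx) (weight_pos hx).ne'
  rwa [zero_div] at h2

lemma branchRe_mul_branchIm {x : ℝ} (hx : x ∈ Ioo (-1 : ℝ) 1) (ε : ℝ) :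
    branchRe x ε * branchIm x ε = x * ε :=
  div_mul_cancel₀ _ (branchIm_pos hx ε).ne'

lemma branchRe_sq_sub_branchIm_sq {x : ℝ} (hx : x ∈ Ioo (-1 : ℝ) 1) (ε : ℝ) :
    branchRe x ε ^ 2 - branchIm x ε ^ 2 = x ^ 2 - ε ^ 2 - 1 := by
  have hpos := branchIm_pos hx ε
  have h : 0 < 1 - x ^ 2 := by nlinarith [hx.1, hx.2]
  have hsq : branchIm x ε ^ 2 =
      (1 - x ^ 2 + ε ^ 2 + Real.sqrt ((1 - x ^ 2 + ε ^ 2) ^ 2 + 4 * (x * ε) ^ 2)) / 2 :=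
    Real.sq_sqrt (by positivity)
  have hR : Real.sqrt ((1 - x ^ 2 + ε ^ 2) ^ 2 + 4 * (x * ε) ^ 2) ^ 2 =
      (1 - x ^ 2 + ε ^ 2) ^ 2 + 4 * (x * ε) ^ 2 := Real.sq_sqrt (by positivity)
  have hR' : Real.sqrt ((1 - x ^ 2 + ε ^ 2) ^ 2 + 4 * (x * ε) ^ 2) =
      2 * branchIm x ε ^ 2 - (1 - x ^ 2 + ε ^ 2) := by linarith
  rw [hR'] at hR
  apply mul_right_cancel₀ (pow_pos hpos 2).ne'
  have hprod := congrArg (· ^ 2) (branchRe_mul_branchIm hx ε)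
  simp only [mul_pow] at hprod
  linear_combination hprod - hR / 4

/-- The branch of `√(z² - 1)`, `z = x + iε`, with positive imaginary part. -/
def branch (x ε : ℝ) : ℂ := ⟨branchRe x ε, branchIm x ε⟩

lemma branch_sq {x : ℝ} (hx : x ∈ Ioo (-1 : ℝ) 1) (ε : ℝ) :
    branch x ε ^ 2 = (⟨x, ε⟩ : ℂ) ^ 2 - 1 := by
  have h1 := branchRe_mul_branchIm hx ε
  have h2 := branchRe_sq_sub_branchIm_sq hx ε
  apply Complex.ext
  · simp only [branch, sq, Complex.mul_re, Complex.sub_re, Complex.one_re]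
    linarith
  · simp only [branch, sq, Complex.mul_im, Complex.sub_im, Complex.one_im]
    linarith

lemma norm_sub_branch_lt_one {x ε : ℝ} (hx : x ∈ Ioo (-1 : ℝ) 1) (hε : 0 < ε) :
    ‖(⟨x, ε⟩ : ℂ) - branch x ε‖ < 1 := by
  have hpos := branchIm_pos hx ε
  have h1 := branchRe_mul_branchIm hx ε
  have hprod : Complex.normSq (⟨x, ε⟩ - branch x ε) * Complex.normSq (⟨x, ε⟩ + branch x ε) = 1 := by
    rw [← map_mul]
    have : ((⟨x, ε⟩ : ℂ) - branch x ε) * (⟨x, ε⟩ + branch x ε) = 1 := by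
      linear_combination -branch_sq hx ε
    rw [this, map_one]
  have hre : 0 < x * branchRe x ε + ε * branchIm x ε := by
    apply pos_of_mul_pos_left (b := branchIm x ε) ?_ hpos.le
    have : 0 < x ^ 2 * ε + ε * branchIm x ε ^ 2 := by positivity
    linear_combination this - x * h1
  have hlt : Complex.normSq (⟨x, ε⟩ - branch x ε) < Complex.normSq (⟨x, ε⟩ + branch x ε) := by
    simp only [Complex.normSq_apply, branch, Complex.sub_re, Complex.sub_im, Complex.add_re,
      Complex.add_im]
    nlinarith
  have h0 := Complex.normSq_nonneg (⟨x, ε⟩ - branch x ε)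
  have : ‖(⟨x, ε⟩ : ℂ) - branch x ε‖ ^ 2 < 1 := by
    rw [← Complex.normSq_eq_norm_sq]
    nlinarith
  exact (sq_lt_one_iff₀ (norm_nonneg _)).1 this

/-- The Cauchy kernel at `x ± iε` in terms of the Poisson kernel and its conjugate. -/
lemma integral_mul_inv_sub {g : ℝ → ℂ} (hg : Integrable g) (x : ℝ) {ε : ℝ} (hε : 0 < ε) {δ : ℝ}
    (hδ : δ = ε ∨ δ = -ε) :
    ∫ y, g y * ((⟨x, δ⟩ : ℂ) - y)⁻¹ =
      -(∫ y, g y * (((y - x) / ((y - x) ^ 2 + ε ^ 2) : ℝ) : ℂ)) -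
        Complex.I * (δ / ε : ℝ) * ∫ y, g y * ((poissonKernel ε (y - x) : ℝ) : ℂ) := by
  have hQ : Integrable fun y => g y * (((y - x) / ((y - x) ^ 2 + ε ^ 2) : ℝ) : ℂ) := by
    refine hg.mul_bdd (c := 1 / ε) (Complex.measurable_ofReal.comp
      (by fun_prop)).aestronglyMeasurable (Eventually.of_forall fun y => ?_)
    rw [Complex.norm_real, Real.norm_eq_abs, abs_div,
      abs_of_pos (by positivity : 0 < (y - x) ^ 2 + ε ^ 2), div_le_div_iff₀ (by positivity) hε,
      one_mul, ← sq_abs (y - x)]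
    nlinarith [sq_nonneg (|y - x| - ε), abs_nonneg (y - x), sq_nonneg (|y - x|), sq_nonneg ε]
  have hP : Integrable fun y => g y * ((poissonKernel ε (y - x) : ℝ) : ℂ) :=
    integrable_mul_of_le_poissonKernel hg x hε (by unfold poissonKernel; fun_prop)
      fun t => (abs_of_nonneg (poissonKernel_nonneg hε t)).le
  rw [← integral_neg, ← integral_const_mul, ← integral_sub (Integrable.fun_neg hQ) (hP.const_mul _)]
  congr 1
  ext y
  have hδ2 : δ ^ 2 = ε ^ 2 := by rcases hδ with h | h <;> rw [h]; ring
  have hε' : (ε : ℂ) ≠ 0 := by exact_mod_cast hε.ne'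
  have hden : ((y : ℂ) - x) ^ 2 + (ε : ℂ) ^ 2 ≠ 0 := by
    have : (y - x) ^ 2 + ε ^ 2 ≠ 0 := by positivity
    exact_mod_cast this
  have hδ2' : (δ : ℂ) ^ 2 = (ε : ℂ) ^ 2 := by exact_mod_cast hδ2
  have hinv : ((⟨x, δ⟩ : ℂ) - y)⁻¹ =
      (-(y - x) - Complex.I * δ) / (((y : ℂ) - x) ^ 2 + (ε : ℂ) ^ 2) := by
    rw [Complex.mk_eq_add_mul_I, eq_div_iff hden, ← hδ2']
    have hfac : ((y : ℂ) - x) ^ 2 + (δ : ℂ) ^ 2 =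
        (x + δ * Complex.I - y) * (-(y - x) - Complex.I * δ) := by
      linear_combination δ ^ 2 * Complex.I_sq
    rw [← hδ2', hfac] at hden
    rw [hfac, inv_mul_cancel_left₀ (left_ne_zero_of_mul hden)]
  rw [hinv, poissonKernel]
  push_cast
  field_simp

/-- The identities between the Cauchy integrals of `F √w` and `(transfer F) / √w` at `x ± iε`,
solved for the conjugate Poisson integral of `F √w`. Only Poisson integrals, which converge at
Lebesgue points, remain on the right. -/
lemma integral_conjugate_eq (F : L2I) {x ε : ℝ} (hx : x ∈ Ioo (-1 : ℝ) 1) (hε : 0 < ε) :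
    ∫ y, (Icc (-1 : ℝ) 1).indicator (fun y => F y * ((rootWeight y : ℝ) : ℂ)) y *
        (((y - x) / ((y - x) ^ 2 + ε ^ 2) : ℝ) : ℂ) =
      branchRe x ε * ((∫ y, (Icc (-1 : ℝ) 1).indicator
            (fun y => F y * ((rootWeight y : ℝ) : ℂ)) y * ((poissonKernel ε (y - x) : ℝ) : ℂ)) -
          branchRe x ε * ∫ y, (Icc (-1 : ℝ) 1).indicator
            (fun y => transfer F y * (((rootWeight y)⁻¹ : ℝ) : ℂ)) y *
              ((poissonKernel ε (y - x) : ℝ) : ℂ)) / branchIm x ε -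
        branchIm x ε * ∫ y, (Icc (-1 : ℝ) 1).indicator
            (fun y => transfer F y * (((rootWeight y)⁻¹ : ℝ) : ℂ)) y *
              ((poissonKernel ε (y - x) : ℝ) : ℂ) := by
  have hi1 : Integrable ((Icc (-1 : ℝ) 1).indicator (fun y => F y * ((rootWeight y : ℝ) : ℂ))) :=
    (integrable_indicator_iff measurableSet_Icc).2 (integrable_mul_rootWeight F)
  have hi2 : Integrable ((Icc (-1 : ℝ) 1).indicator
      (fun y => transfer F y * (((rootWeight y)⁻¹ : ℝ) : ℂ))) :=
    (integrable_indicator_iff measurableSet_Icc).2 (integrable_mul_inv_rootWeight (transfer F))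
  have hconv : ∀ (g : ℝ → ℂ) (z : ℂ), ∫ y, g y * (z - y)⁻¹ ∂μI =
      ∫ y, (Icc (-1 : ℝ) 1).indicator g y * (z - y)⁻¹ := by
    intro g z
    rw [← integral_indicator measurableSet_Icc]
    congr 1
    ext y
    by_cases hy : y ∈ Icc (-1 : ℝ) 1
    · simp [hy]
    · simp [hy]
  have hup := integral_cauchy_eq_mul_integral_cauchy F (z := ⟨x, ε⟩) hε.ne' (branch_sq hx ε)
    (norm_sub_branch_lt_one hx hε)
  have hconj : (⟨x, -ε⟩ : ℂ) = (starRingEnd ℂ) ⟨x, ε⟩ := rfl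
  have hdown := integral_cauchy_eq_mul_integral_cauchy F (z := ⟨x, -ε⟩)
    (S := (starRingEnd ℂ) (branch x ε)) (neg_ne_zero.2 hε.ne')
    (by rw [hconj, ← map_pow, branch_sq hx ε, map_sub, map_pow, map_one])
    (by rw [hconj, ← map_sub, RCLike.norm_conj]; exact norm_sub_branch_lt_one hx hε)
  rw [hconv, hconv, integral_mul_inv_sub hi1 x hε (Or.inl rfl),
    integral_mul_inv_sub hi2 x hε (Or.inl rfl), div_self hε.ne'] at hup
  rw [hconv, hconv, integral_mul_inv_sub hi1 x hε (Or.inr rfl),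
    integral_mul_inv_sub hi2 x hε (Or.inr rfl), neg_div, div_self hε.ne'] at hdown
  have hS : branch x ε = branchRe x ε + branchIm x ε * Complex.I := Complex.mk_eq_add_mul_I _ _
  have hS' : (starRingEnd ℂ) (branch x ε) = branchRe x ε - branchIm x ε * Complex.I := by
    rw [hS]
    simp only [map_add, map_mul, Complex.conj_ofReal, Complex.conj_I]
    ring
  rw [hS] at hup
  rw [hS'] at hdown
  set Qh := ∫ y, (Icc (-1 : ℝ) 1).indicator (fun y => F y * ((rootWeight y : ℝ) : ℂ)) y *
        (((y - x) / ((y - x) ^ 2 + ε ^ 2) : ℝ) : ℂ)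
  set Ph := ∫ y, (Icc (-1 : ℝ) 1).indicator
            (fun y => F y * ((rootWeight y : ℝ) : ℂ)) y * ((poissonKernel ε (y - x) : ℝ) : ℂ)
  set Pp := ∫ y, (Icc (-1 : ℝ) 1).indicator
            (fun y => transfer F y * (((rootWeight y)⁻¹ : ℝ) : ℂ)) y *
              ((poissonKernel ε (y - x) : ℝ) : ℂ)
  set Qp := ∫ y, (Icc (-1 : ℝ) 1).indicator
            (fun y => transfer F y * (((rootWeight y)⁻¹ : ℝ) : ℂ)) y *
              (((y - x) / ((y - x) ^ 2 + ε ^ 2) : ℝ) : ℂ)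
  have hτ : (branchIm x ε : ℂ) ≠ 0 := by exact_mod_cast (branchIm_pos hx ε).ne'
  push_cast at hup hdown
  have e1 : Qh = branchRe x ε * Qp - branchIm x ε * Pp := by
    linear_combination (-1 / 2 : ℂ) * (hup + hdown) + branchIm x ε * Pp * Complex.I_sq
  have e2 : Ph = branchIm x ε * Qp + branchRe x ε * Pp := by
    linear_combination (Complex.I / 2) * (hup - hdown) +
      (Ph - branchIm x ε * Qp - branchRe x ε * Pp) * Complex.I_sq
  have e3 : Qp = (Ph - branchRe x ε * Pp) / branchIm x ε := by
    rw [eq_div_iff hτ]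
    linear_combination -e2
  rw [e1, e3]
  ring

/-- The principal value integral of `F √w` is `-π √w transfer F` almost everywhere. -/
lemma tendsto_truncated_mul_rootWeight (F : L2I) :
    ∀ᵐ x ∂μI, Tendsto (fun ε : ℝ => ∫ y in {y : ℝ | ε < |y - x|},
      (Icc (-1 : ℝ) 1).indicator (fun y => F y * ((rootWeight y : ℝ) : ℂ)) y *
        (((y - x)⁻¹ : ℝ) : ℂ)) (𝓝[>] 0)
      (𝓝 (-(Real.pi * weight x * (transfer F x * (((rootWeight x)⁻¹ : ℝ) : ℂ))))) := by
  have hi1 : Integrable ((Icc (-1 : ℝ) 1).indicator (fun y => F y * ((rootWeight y : ℝ) : ℂ))) :=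
    (integrable_indicator_iff measurableSet_Icc).2 (integrable_mul_rootWeight F)
  have hi2 : Integrable ((Icc (-1 : ℝ) 1).indicator
      (fun y => transfer F y * (((rootWeight y)⁻¹ : ℝ) : ℂ))) :=
    (integrable_indicator_iff measurableSet_Icc).2 (integrable_mul_inv_rootWeight (transfer F))
  filter_upwards [ae_mem_Ioo, ae_restrict_of_ae (ae_tendsto_oscillation hi1),
    ae_restrict_of_ae (ae_tendsto_oscillation hi2)] with x hx ho1 ho2
  refine tendsto_truncated_of_tendsto_conjugate hi1 ho1 ?_
  have hP1 := tendsto_integral_mul_poissonKernel hi1 ho1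
  have hP2 := tendsto_integral_mul_poissonKernel hi2 ho2
  have hρ := (Complex.continuous_ofReal.tendsto 0).comp (tendsto_branchRe hx)
  have hτ := (Complex.continuous_ofReal.tendsto (weight x)).comp (tendsto_branchIm hx)
  have hw : (weight x : ℂ) ≠ 0 := by exact_mod_cast (weight_pos hx).ne'
  have hlim := ((hρ.mul (hP1.sub (hρ.mul hP2))).div hτ hw).sub (hτ.mul hP2)
  have hval : ((0 : ℝ) : ℂ) * (Real.pi * (Icc (-1 : ℝ) 1).indicator
      (fun y => F y * ((rootWeight y : ℝ) : ℂ)) x - ((0 : ℝ) : ℂ) *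
        (Real.pi * (Icc (-1 : ℝ) 1).indicator
          (fun y => transfer F y * (((rootWeight y)⁻¹ : ℝ) : ℂ)) x)) / (weight x : ℂ) -
      (weight x : ℂ) * (Real.pi * (Icc (-1 : ℝ) 1).indicator
          (fun y => transfer F y * (((rootWeight y)⁻¹ : ℝ) : ℂ)) x) =
      -(Real.pi * weight x * (transfer F x * (((rootWeight x)⁻¹ : ℝ) : ℂ))) := by
    rw [indicator_of_mem (Ioo_subset_Icc_self hx) (fun y => transfer F y *
      (((rootWeight y)⁻¹ : ℝ) : ℂ))]
    push_cast
    ring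
  rw [hval] at hlim
  refine hlim.congr' ?_
  filter_upwards [self_mem_nhdsWithin] with ε hε
  exact (integral_conjugate_eq F hx hε).symm

lemma memLp_rootWeight_mul (f : L2I) : MemLp (fun x => ((rootWeight x : ℝ) : ℂ) * f x) 2 μI := by
  refine (Lp.memLp f).of_le ((Complex.measurable_ofReal.comp
    continuous_rootWeight.measurable).aestronglyMeasurable.mul (Lp.aestronglyMeasurable f))
    (Eventually.of_forall fun x => ?_)
  rw [norm_mul, Complex.norm_real, Real.norm_of_nonneg (rootWeight_nonneg x)]
  exact mul_le_of_le_one_left (norm_nonneg _) (rootWeight_le_one x)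

/-- Multiplication by `rootWeight` on `L²[-1, 1]`. -/
def mulRootWeight : L2I →L[ℂ] L2I :=
  LinearMap.mkContinuous
    { toFun := fun f => (memLp_rootWeight_mul f).toLp _
      map_add' := fun f g => by
        ext1
        filter_upwards [(memLp_rootWeight_mul (f + g)).coeFn_toLp,
          (memLp_rootWeight_mul f).coeFn_toLp, (memLp_rootWeight_mul g).coeFn_toLp,
          Lp.coeFn_add f g, Lp.coeFn_add ((memLp_rootWeight_mul f).toLp _)
            ((memLp_rootWeight_mul g).toLp _)] with x h1 h2 h3 h4 h5
        rw [h1, h5, Pi.add_apply, h2, h3, h4, Pi.add_apply, mul_add]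
      map_smul' := fun c f => by
        ext1
        filter_upwards [(memLp_rootWeight_mul (c • f)).coeFn_toLp,
          (memLp_rootWeight_mul f).coeFn_toLp, Lp.coeFn_smul c f,
          Lp.coeFn_smul c ((memLp_rootWeight_mul f).toLp _)] with x h1 h2 h3 h4
        rw [h1, RingHom.id_apply, h4, Pi.smul_apply, h2, h3, Pi.smul_apply, smul_eq_mul,
          smul_eq_mul]
        ring } 1 fun f => by
    rw [one_mul]
    refine Lp.norm_le_norm_of_ae_le ?_
    filter_upwards [(memLp_rootWeight_mul f).coeFn_toLp] with x hx
    rw [LinearMap.coe_mk, AddHom.coe_mk, hx, norm_mul, Complex.norm_real,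
      Real.norm_of_nonneg (rootWeight_nonneg x)]
    exact mul_le_of_le_one_left (norm_nonneg _) (rootWeight_le_one x)

lemma coeFn_mulRootWeight (f : L2I) :
    (mulRootWeight f : ℝ → ℂ) =ᵐ[μI] fun x => ((rootWeight x : ℝ) : ℂ) * f x :=
  (memLp_rootWeight_mul f).coeFn_toLp

/-- The principal value defining the inverse finite Hilbert transform exists almost everywhere. -/
lemma ae_tendsto_truncTinv (f : L2I) : ∀ᵐ x ∂μI, Tendsto (truncTinv f x) (𝓝[>] 0)
    (𝓝 (transfer (mulRootWeight f) x * (((rootWeight x)⁻¹ : ℝ) : ℂ))) := by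
  have hcoe : ∀ᵐ y : ℝ, y ∈ Icc (-1 : ℝ) 1 → mulRootWeight f y = ((rootWeight y : ℝ) : ℂ) * f y :=
    (ae_restrict_iff' measurableSet_Icc).1 (coeFn_mulRootWeight f)
  filter_upwards [ae_mem_Ioo, tendsto_truncated_mul_rootWeight (mulRootWeight f)] with x hx hlim
  have hw : (weight x : ℂ) ≠ 0 := by exact_mod_cast (weight_pos hx).ne'
  have hpi : (Real.pi : ℂ) ≠ 0 := by exact_mod_cast Real.pi_ne_zero
  have hlim2 := hlim.const_mul (-(1 / (Real.pi : ℂ)) * (weight x : ℂ)⁻¹)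
  have hval : -(1 / (Real.pi : ℂ)) * (weight x : ℂ)⁻¹ *
      -(Real.pi * weight x * (transfer (mulRootWeight f) x * (((rootWeight x)⁻¹ : ℝ) : ℂ))) =
      transfer (mulRootWeight f) x * (((rootWeight x)⁻¹ : ℝ) : ℂ) := by
    field_simp
  rw [hval] at hlim2
  refine hlim2.congr fun ε => ?_
  have hset : {y : ℝ | y ∈ Icc (-1 : ℝ) 1 ∧ ε < |y - x|} = {y | ε < |y - x|} ∩ Icc (-1 : ℝ) 1 := by
    ext y
    exact and_comm
  rw [truncTinv, mul_assoc, hset, ← setIntegral_indicator measurableSet_Icc,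
    ← integral_const_mul]
  congr 1
  refine integral_congr_ae (ae_restrict_of_ae ?_)
  filter_upwards [hcoe] with y hy
  by_cases hmem : y ∈ Icc (-1 : ℝ) 1
  · rw [indicator_of_mem hmem, indicator_of_mem hmem, hy hmem,
      Real.sqrt_div' _ (by nlinarith [hx.1, hx.2])]
    have hyw := rootWeight_mul_self y
    have hyw' : ((weight y : ℝ) : ℂ) = (rootWeight y : ℂ) * (rootWeight y : ℂ) := by
      rw [← hyw]
      push_cast
      ring
    change _ = (((weight y / weight x : ℝ)) : ℂ) * _ / _
    push_cast
    rw [hyw']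
    ring
  · rw [indicator_of_notMem hmem, indicator_of_notMem hmem, zero_mul, mul_zero]

lemma Tinv_ae_eq (f : L2I) : Tinv f =ᵐ[μI]
    fun x => transfer (mulRootWeight f) x * (((rootWeight x)⁻¹ : ℝ) : ℂ) := by
  filter_upwards [ae_tendsto_truncTinv f] with x hx
  exact hx.limUnder_eq

/-! ### Limits of operators of finite rank -/

lemma isCompactOperator_of_hasNoetherianRange {H : Type*} [NormedAddCommGroup H] [NormedSpace ℂ H]
    {A : H →L[ℂ] H} (hA : (A : H →ₗ[ℂ] H).HasNoetherianRange) : IsCompactOperator A := by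
  have hN : IsNoetherian ℂ (LinearMap.range (A : H →ₗ[ℂ] H)) := hA
  have hfd : FiniteDimensional ℂ (LinearMap.range (A : H →ₗ[ℂ] H)) := inferInstance
  have hproper : ProperSpace (LinearMap.range (A : H →ₗ[ℂ] H)) := FiniteDimensional.proper ℂ _
  have h := isCompactOperator_of_locallyCompactSpace_dom (A.rangeRestrict)
  exact h.clm_comp (LinearMap.range (A : H →ₗ[ℂ] H)).subtypeL

/-- A perturbation of the identity by a limit of operators of finite rank is Fredholm: it differs
by an operator of finite rank from an invertible operator. -/
lemma isFredholm_id_add {H : Type*} [NormedAddCommGroup H] [NormedSpace ℂ H] [CompleteSpace H]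
    {T A : H →L[ℂ] H} (hA : (A : H →ₗ[ℂ] H).HasNoetherianRange) (hTA : ‖T - A‖ < 1) :
    (ContinuousLinearMap.id ℂ H + T).IsFredholm := by
  rw [← norm_neg] at hTA
  let u := Units.oneSub (-(T - A)) hTA
  have hu : (u : H →L[ℂ] H) = 1 - -(T - A) := rfl
  have h1 : (((u⁻¹ : (H →L[ℂ] H)ˣ) : H →L[ℂ] H) : H →ₗ[ℂ] H).IsQuasiInverse
      ((u : H →L[ℂ] H) : H →ₗ[ℂ] H) := by
    constructor
    · have h : (((u⁻¹ : (H →L[ℂ] H)ˣ) : H →L[ℂ] H) : H →ₗ[ℂ] H) ∘ₗ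
          ((u : H →L[ℂ] H) : H →ₗ[ℂ] H) = .id := by
        ext v
        exact congrArg (fun B : H →L[ℂ] H => B v) u.inv_mul
      rw [LinearMap.IsLeftQuasiInverse, h]
    · have h : ((u : H →L[ℂ] H) : H →ₗ[ℂ] H) ∘ₗ
          (((u⁻¹ : (H →L[ℂ] H)ˣ) : H →L[ℂ] H) : H →ₗ[ℂ] H) = .id := by
        ext v
        exact congrArg (fun B : H →L[ℂ] H => B v) u.mul_inv
      rw [LinearMap.IsRightQuasiInverse, h]
  refine ContinuousLinearMap.IsFredholm.of_isQuasiInverse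
    (h1.congr (LinearMap.FiniteRangeSetoid.setoid.refl _) ?_)
  refine LinearMap.FiniteRangeSetoid.equiv_iff_hasNoetherianRange.2 ?_
  convert! hA using 1
  ext v
  simp [hu]

/-! ### Hilbert–Schmidt operators -/

lemma norm_toLp_sq {α : Type*} [MeasurableSpace α] {μ : Measure α} {u : α → ℂ}
    (hu : MemLp u 2 μ) : ‖hu.toLp u‖ ^ 2 = ∫ x, ‖u x‖ ^ 2 ∂μ := by
  have h : ((‖hu.toLp u‖ ^ 2 : ℝ) : ℂ) = ((∫ x, ‖u x‖ ^ 2 ∂μ : ℝ) : ℂ) := by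
    have h1 := inner_self_eq_norm_sq_to_K (𝕜 := ℂ) (hu.toLp u)
    rw [L2.inner_def] at h1
    rw [← integral_complex_ofReal]
    push_cast
    refine Eq.trans h1.symm (integral_congr_ae ?_)
    filter_upwards [hu.coeFn_toLp] with x hx
    rw [hx, inner_self_eq_norm_sq_to_K]
    rfl
  exact_mod_cast h

lemma norm_sq_eq_integral {α : Type*} [MeasurableSpace α] {μ : Measure α} (F : Lp ℂ 2 μ) :
    ‖F‖ ^ 2 = ∫ x, ‖F x‖ ^ 2 ∂μ := by
  rw [← norm_toLp_sq (Lp.memLp F), Lp.toLp_coeFn]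

lemma ae_memLp_section {F : ℝ × ℝ → ℂ} (hF : MemLp F 2 (μI.prod μI)) :
    ∀ᵐ x ∂μI, MemLp (fun y => F (x, y)) 2 μI := by
  have h := (memLp_two_iff_integrable_sq_norm hF.1).1 hF
  filter_upwards [hF.1.prodMk_left, h.prod_right_ae] with x h1 h2
  exact (memLp_two_iff_integrable_sq_norm h1).2 h2

lemma norm_integral_mul_sq_le {u : ℝ → ℂ} (hu : MemLp u 2 μI) (f : L2I) :
    ‖∫ y, u y * f y ∂μI‖ ^ 2 ≤ (∫ y, ‖u y‖ ^ 2 ∂μI) * ‖f‖ ^ 2 := by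
  have hs : MemLp (fun y => (starRingEnd ℂ) (u y)) 2 μI := hu.star
  have h1 : ∫ y, u y * f y ∂μI = inner ℂ (hs.toLp _) f := by
    rw [L2.inner_def]
    refine integral_congr_ae ?_
    filter_upwards [hs.coeFn_toLp] with y hy
    rw [hy, RCLike.inner_apply, Complex.conj_conj, mul_comm]
  have h2 : ∫ y, ‖u y‖ ^ 2 ∂μI = ‖hs.toLp _‖ ^ 2 := by
    rw [norm_toLp_sq]
    simp
  rw [h1, h2, ← mul_pow]
  gcongr
  exact norm_inner_le_norm _ _

lemma memLp_integral_mul (F : Lp ℂ 2 (μI.prod μI)) (f : L2I) :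
    MemLp (fun x => ∫ y, F (x, y) * f y ∂μI) 2 μI := by
  have hm : AEStronglyMeasurable (fun x => ∫ y, F (x, y) * f y ∂μI) μI :=
    ((Lp.aestronglyMeasurable F).mul
      (Lp.aestronglyMeasurable f).comp_snd).integral_prod_right'
  rw [memLp_two_iff_integrable_sq_norm hm]
  have hF := (memLp_two_iff_integrable_sq_norm (Lp.memLp F).1).1 (Lp.memLp F)
  refine (hF.integral_prod_left.mul_const (‖f‖ ^ 2)).mono' (hm.norm.pow 2) ?_
  filter_upwards [ae_memLp_section (Lp.memLp F)] with x hx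
  rw [Real.norm_of_nonneg (by positivity)]
  exact norm_integral_mul_sq_le hx f

lemma norm_toLp_integral_mul_le (F : Lp ℂ 2 (μI.prod μI)) (f : L2I) :
    ‖(memLp_integral_mul F f).toLp _‖ ≤ ‖F‖ * ‖f‖ := by
  have hF := (memLp_two_iff_integrable_sq_norm (Lp.memLp F).1).1 (Lp.memLp F)
  have h : ‖(memLp_integral_mul F f).toLp _‖ ^ 2 ≤ (‖F‖ * ‖f‖) ^ 2 := by
    rw [norm_toLp_sq, mul_pow, norm_sq_eq_integral F, integral_prod _ hF, ← integral_mul_const]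
    refine integral_mono_ae
      ((memLp_two_iff_integrable_sq_norm (memLp_integral_mul F f).1).1 (memLp_integral_mul F f))
      (hF.integral_prod_left.mul_const (‖f‖ ^ 2)) ?_
    filter_upwards [ae_memLp_section (Lp.memLp F)] with x hx
    exact norm_integral_mul_sq_le hx f
  exact (sq_le_sq₀ (norm_nonneg _) (by positivity)).1 h

/-- The Hilbert–Schmidt operator with a given square integrable kernel, as a continuous function
of the kernel. -/
def hsOp : Lp ℂ 2 (μI.prod μI) →L[ℂ] L2I →L[ℂ] L2I :=
  LinearMap.mkContinuous₂
    (LinearMap.mk₂ ℂ (fun F f => (memLp_integral_mul F f).toLp _)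
      (fun F G f => by
        ext1
        filter_upwards [(memLp_integral_mul (F + G) f).coeFn_toLp,
          (memLp_integral_mul F f).coeFn_toLp, (memLp_integral_mul G f).coeFn_toLp,
          Lp.coeFn_add ((memLp_integral_mul F f).toLp _) ((memLp_integral_mul G f).toLp _),
          Measure.ae_ae_of_ae_prod (Lp.coeFn_add F G), ae_memLp_section (Lp.memLp F),
          ae_memLp_section (Lp.memLp G)] with x h1 h2 h3 h4 h5 h6 h7
        rw [h1, h4, Pi.add_apply, h2, h3]
        refine Eq.trans ?_ (integral_add (h6.integrable_mul (Lp.memLp f))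
          (h7.integrable_mul (Lp.memLp f)))
        refine integral_congr_ae ?_
        filter_upwards [h5] with y hy
        rw [hy]
        exact add_mul _ _ _)
      (fun c F f => by
        ext1
        filter_upwards [(memLp_integral_mul (c • F) f).coeFn_toLp,
          (memLp_integral_mul F f).coeFn_toLp,
          Lp.coeFn_smul c ((memLp_integral_mul F f).toLp _),
          Measure.ae_ae_of_ae_prod (Lp.coeFn_smul c F)] with x h1 h2 h3 h4
        rw [h1, h3, Pi.smul_apply, h2, ← integral_smul]
        refine integral_congr_ae ?_
        filter_upwards [h4] with y hy
        rw [hy, Pi.smul_apply, smul_mul_assoc])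
      (fun F f g => by
        ext1
        filter_upwards [(memLp_integral_mul F (f + g)).coeFn_toLp,
          (memLp_integral_mul F f).coeFn_toLp, (memLp_integral_mul F g).coeFn_toLp,
          Lp.coeFn_add ((memLp_integral_mul F f).toLp _) ((memLp_integral_mul F g).toLp _),
          ae_memLp_section (Lp.memLp F)] with x h1 h2 h3 h4 h5
        rw [h1, h4, Pi.add_apply, h2, h3]
        refine Eq.trans ?_ (integral_add (h5.integrable_mul (Lp.memLp f))
          (h5.integrable_mul (Lp.memLp g)))
        refine integral_congr_ae ?_
        filter_upwards [Lp.coeFn_add f g] with y hy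
        rw [hy]
        exact mul_add _ _ _)
      (fun c F f => by
        ext1
        filter_upwards [(memLp_integral_mul F (c • f)).coeFn_toLp,
          (memLp_integral_mul F f).coeFn_toLp,
          Lp.coeFn_smul c ((memLp_integral_mul F f).toLp _)] with x h1 h2 h3
        rw [h1, h3, Pi.smul_apply, h2, ← integral_smul]
        refine integral_congr_ae ?_
        filter_upwards [Lp.coeFn_smul c f] with y hy
        rw [hy, Pi.smul_apply, mul_smul_comm])) 1
    fun F f => by
      rw [one_mul]
      exact norm_toLp_integral_mul_le F f

lemma coeFn_hsOp (F : Lp ℂ 2 (μI.prod μI)) (f : L2I) :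
    (hsOp F f : ℝ → ℂ) =ᵐ[μI] fun x => ∫ y, F (x, y) * f y ∂μI :=
  (memLp_integral_mul F f).coeFn_toLp

lemma memLp_tensor (κ e : L2I) : MemLp (fun p : ℝ × ℝ => κ p.1 * e p.2) 2 (μI.prod μI) := by
  have hm : AEStronglyMeasurable (fun p : ℝ × ℝ => κ p.1 * e p.2) (μI.prod μI) :=
    (Lp.aestronglyMeasurable κ).comp_fst.mul (Lp.aestronglyMeasurable e).comp_snd
  rw [memLp_two_iff_integrable_sq_norm hm]
  simp only [norm_mul, mul_pow]
  exact ((memLp_two_iff_integrable_sq_norm (Lp.memLp κ).1).1 (Lp.memLp κ)).mul_prod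
    ((memLp_two_iff_integrable_sq_norm (Lp.memLp e).1).1 (Lp.memLp e))

/-- The kernel `κ(x) e(y)`. -/
def tensor (κ e : L2I) : Lp ℂ 2 (μI.prod μI) := (memLp_tensor κ e).toLp _

lemma inner_tensor (κ e κ' e' : L2I) :
    inner ℂ (tensor κ e) (tensor κ' e') = inner ℂ κ κ' * inner ℂ e e' := by
  rw [L2.inner_def, L2.inner_def, L2.inner_def, ← integral_prod_mul]
  refine integral_congr_ae ?_
  filter_upwards [(memLp_tensor κ e).coeFn_toLp, (memLp_tensor κ' e').coeFn_toLp] with p h1 h2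
  rw [tensor, tensor, h1, h2]
  simp only [RCLike.inner_apply, map_mul]
  ring

lemma norm_tensor (κ e : L2I) : ‖tensor κ e‖ = ‖κ‖ * ‖e‖ := by
  have h : ((‖tensor κ e‖ ^ 2 : ℝ) : ℂ) = (((‖κ‖ * ‖e‖) ^ 2 : ℝ) : ℂ) := by
    have h1 := inner_tensor κ e κ e
    rw [inner_self_eq_norm_sq_to_K, inner_self_eq_norm_sq_to_K, inner_self_eq_norm_sq_to_K] at h1
    rw [mul_pow]
    exact_mod_cast h1
  exact (sq_eq_sq₀ (norm_nonneg _) (by positivity)).1 (by exact_mod_cast h)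

lemma hsOp_tensor_apply (κ e f : L2I) :
    hsOp (tensor κ e) f = (∫ y, e y * f y ∂μI) • κ := by
  ext1
  filter_upwards [coeFn_hsOp (tensor κ e) f, Lp.coeFn_smul (∫ y, e y * f y ∂μI) κ,
    Measure.ae_ae_of_ae_prod (memLp_tensor κ e).coeFn_toLp] with x h1 h2 h3
  rw [h1, h2, Pi.smul_apply, smul_eq_mul, mul_comm, ← integral_const_mul]
  refine integral_congr_ae ?_
  filter_upwards [h3] with y hy
  rw [tensor, hy]
  ring

lemma hasNoetherianRange_hsOp_tensor (κ e : L2I) :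
    (hsOp (tensor κ e) : L2I →ₗ[ℂ] L2I).HasNoetherianRange := by
  have hle : LinearMap.range (hsOp (tensor κ e) : L2I →ₗ[ℂ] L2I) ≤ Submodule.span ℂ {κ} := by
    rintro _ ⟨f, rfl⟩
    rw [ContinuousLinearMap.coe_coe, hsOp_tensor_apply]
    exact Submodule.smul_mem _ _ (Submodule.mem_span_singleton_self κ)
  exact isNoetherian_of_le hle

/-- Bessel's inequality, integrated over the first variable of the kernel. -/
lemma sum_norm_hsOp_cosineL_sq_le (k : Lp ℂ 2 (μI.prod μI)) (s : Finset ℕ) :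
    ∑ n ∈ s, ‖hsOp k (cosineL n)‖ ^ 2 ≤ ‖k‖ ^ 2 := by
  have hk := (memLp_two_iff_integrable_sq_norm (Lp.memLp k).1).1 (Lp.memLp k)
  have hint : ∀ n, Integrable (fun x => ‖hsOp k (cosineL n) x‖ ^ 2) μI := fun n =>
    (memLp_two_iff_integrable_sq_norm (Lp.memLp _).1).1 (Lp.memLp _)
  simp only [norm_sq_eq_integral]
  rw [← integral_finsetSum _ fun n _ => hint n, integral_prod _ hk]
  refine integral_mono_ae (integrable_finsetSum _ fun n _ => hint n) hk.integral_prod_left ?_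
  have hall : ∀ᵐ x ∂μI, ∀ n, hsOp k (cosineL n) x = ∫ y, k (x, y) * cosineL n y ∂μI :=
    ae_all_iff.2 fun n => coeFn_hsOp k (cosineL n)
  filter_upwards [hall, ae_memLp_section (Lp.memLp k)] with x h1 h2
  have hterm : ∀ n, hsOp k (cosineL n) x = inner ℂ (cosineL n) (h2.toLp _) := by
    intro n
    rw [h1 n, cosineL, inner_toLp_ofReal]
    refine integral_congr_ae ?_
    filter_upwards [h2.coeFn_toLp, (memLp_cosineFun n).coeFn_toLp] with y hy1 hy2
    rw [hy1, hy2]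
  simp only [hterm]
  rw [← norm_toLp_sq h2]
  exact orthonormal_cosineL.sum_inner_products_le _

lemma integral_sineL_mul (n : ℕ) (f : L2I) :
    ∫ y, sineL n y * f y ∂μI = inner ℂ (sineL n) f := by
  rw [sineL, inner_toLp_ofReal]
  refine integral_congr_ae ?_
  filter_upwards [(memLp_sineFun n).coeFn_toLp] with y hy
  rw [hy, mul_comm]

/-- Composing a Hilbert–Schmidt operator with `transfer` gives a Hilbert–Schmidt operator, whose
kernel is `∑ κₙ(x) eₙ(y)` with `κₙ` the image of the `n`-th cosine function and `eₙ` the `n`-th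
sine function. -/
lemma exists_hasSum_tensor (k : Lp ℂ 2 (μI.prod μI)) :
    ∃ N : Lp ℂ 2 (μI.prod μI),
      HasSum (fun n => tensor (hsOp k (cosineL n)) (sineL n)) N ∧ ‖N‖ ≤ ‖k‖ := by
  set T : ℕ → Lp ℂ 2 (μI.prod μI) := fun n => tensor (hsOp k (cosineL n)) (sineL n) with hT
  have hnorm : ∀ n, ‖T n‖ = ‖hsOp k (cosineL n)‖ := fun n => by
    rw [hT, norm_tensor, orthonormal_sineL.1 n, mul_one]
  have horth : OrthogonalFamily ℂ (fun n => Submodule.span ℂ {T n})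
      (fun n => (Submodule.span ℂ {T n}).subtypeₗᵢ) := by
    refine OrthogonalFamily.of_pairwise fun i j hij => ?_
    refine Submodule.isOrtho_span.2 fun u hu v hv => ?_
    rw [mem_singleton_iff.1 hu, mem_singleton_iff.1 hv, inner_tensor, orthonormal_sineL.2 hij,
      mul_zero]
  let l : ∀ n, Submodule.span ℂ {T n} := fun n => ⟨T n, Submodule.mem_span_singleton_self _⟩
  have hsum : Summable T := by
    refine (horth.summable_iff_norm_sq_summable l).2
      (summable_of_sum_le (c := ‖k‖ ^ 2) (fun n => sq_nonneg _) fun s => ?_)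
    refine le_trans (le_of_eq ?_) (sum_norm_hsOp_cosineL_sq_le k s)
    exact Finset.sum_congr rfl fun n _ => by rw [← hnorm n]; rfl
  obtain ⟨N, hN⟩ := hsum
  refine ⟨N, hN, le_of_tendsto hN.norm (Eventually.of_forall fun s => ?_)⟩
  have h1 := horth.norm_sum l s
  have h2 : ‖∑ n ∈ s, T n‖ ^ 2 ≤ ‖k‖ ^ 2 := by
    refine le_trans (le_of_eq (h1.trans ?_)) (sum_norm_hsOp_cosineL_sq_le k s)
    exact Finset.sum_congr rfl fun n _ => by rw [← hnorm n]; rfl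
  exact (sq_le_sq₀ (norm_nonneg _) (norm_nonneg _)).1 h2

lemma hsOp_eq_comp_transfer {k N : Lp ℂ 2 (μI.prod μI)}
    (hN : HasSum (fun n => tensor (hsOp k (cosineL n)) (sineL n)) N) (f : L2I) :
    hsOp N f = hsOp k (transfer f) := by
  have h1 := (hN.mapL hsOp).mapL (ContinuousLinearMap.apply ℂ L2I f)
  have h2 := (hasSum_transfer f).mapL (hsOp k)
  refine h1.unique ?_
  convert! h2 using 2 with n
  rw [ContinuousLinearMap.apply_apply, hsOp_tensor_apply, integral_sineL_mul, map_smul]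

lemma exists_hasNoetherianRange_norm_sub_lt {k N : Lp ℂ 2 (μI.prod μI)}
    (hN : HasSum (fun n => tensor (hsOp k (cosineL n)) (sineL n)) N) {δ : ℝ} (hδ : 0 < δ) :
    ∃ A : L2I →L[ℂ] L2I, (A : L2I →ₗ[ℂ] L2I).HasNoetherianRange ∧ ‖hsOp N - A‖ < δ := by
  have h1 : Tendsto (fun s : Finset ℕ => ∑ n ∈ s, hsOp (tensor (hsOp k (cosineL n)) (sineL n)))
      atTop (𝓝 (hsOp N)) := hN.mapL hsOp
  obtain ⟨s, hs⟩ := (h1.eventually (Metric.ball_mem_nhds _ hδ)).exists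
  refine ⟨_, ?_, by rwa [dist_comm, dist_eq_norm] at hs⟩
  rw [ContinuousLinearMap.toLinearMap_sum]
  exact Submodule.sum_mem (LinearMap.finiteRange ℂ L2I L2I)
    fun n _ => hasNoetherianRange_hsOp_tensor _ _

/-! ### The weighted reduced kernel is square integrable -/

lemma integrable_indicator_one_add_rpow_sq :
    Integrable ((Icc (-2 : ℝ) 2).indicator fun v : ℝ => (1 + |v| ^ (-(1 / 4) : ℝ)) ^ 2) := by
  have h1 : IntegrableOn (fun r : ℝ => (Iic (2 : ℝ)).indicator
      (fun r : ℝ => 1 + 2 * r ^ (-(1 / 4) : ℝ) + r ^ (-(1 / 2) : ℝ)) r) (Ioi 0) := by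
    rw [IntegrableOn, integrable_indicator_iff measurableSet_Iic, IntegrableOn,
      Measure.restrict_restrict measurableSet_Iic, inter_comm, Ioi_inter_Iic]
    change IntegrableOn (fun r : ℝ => 1 + 2 * r ^ (-(1 / 4) : ℝ) + r ^ (-(1 / 2) : ℝ)) (Ioc 0 2)
    rw [← intervalIntegrable_iff_integrableOn_Ioc_of_le (by norm_num)]
    exact (intervalIntegrable_const.add
      ((intervalIntegral.intervalIntegrable_rpow' (by norm_num)).const_mul 2)).add
      (intervalIntegral.intervalIntegrable_rpow' (by norm_num))
  have h2 := integrable_comp_abs h1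
  refine h2.congr ?_
  filter_upwards [ae_ne 0] with v hv
  have hv' : 0 < |v| := abs_pos.2 hv
  have hiff : |v| ∈ Iic (2 : ℝ) ↔ v ∈ Icc (-2 : ℝ) 2 := by
    rw [mem_Iic, abs_le, mem_Icc]
  by_cases h : v ∈ Icc (-2 : ℝ) 2
  · rw [indicator_of_mem h, indicator_of_mem (hiff.2 h)]
    have : |v| ^ (-(1 / 2) : ℝ) = |v| ^ (-(1 / 4) : ℝ) * |v| ^ (-(1 / 4) : ℝ) := by
      rw [← Real.rpow_add hv']
      norm_num
    rw [this]
    ring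
  · rw [indicator_of_notMem h, indicator_of_notMem (fun h' => h (hiff.1 h'))]

/-- The majorant of the squared kernel. -/
lemma integrable_one_add_rpow_sq_mul_inv_weight :
    Integrable (fun p : ℝ × ℝ => (1 + |p.1 - p.2| ^ (-(1 / 4) : ℝ)) ^ 2 * (weight p.2)⁻¹)
      (μI.prod μI) := by
  have hw : Integrable ((Icc (-1 : ℝ) 1).indicator fun x => (weight x)⁻¹) :=
    (integrable_indicator_iff measurableSet_Icc).2
      (by simpa only [one_mul] using! integrable_mul_inv_weight (f := fun _ => 1) continuous_const)
  have h := hw.convolution_integrand (ContinuousLinearMap.mul ℝ ℝ)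
    integrable_indicator_one_add_rpow_sq
  have hset : MeasurableSet (Icc (-1 : ℝ) 1 ×ˢ Icc (-1 : ℝ) 1) :=
    measurableSet_Icc.prod measurableSet_Icc
  rw [Measure.prod_restrict]
  refine (h.restrict (s := Icc (-1 : ℝ) 1 ×ˢ Icc (-1 : ℝ) 1)).congr ?_
  filter_upwards [self_mem_ae_restrict hset] with p hp
  have h2 : p.1 - p.2 ∈ Icc (-2 : ℝ) 2 :=
    ⟨by linarith [hp.1.1, hp.2.2], by linarith [hp.1.2, hp.2.1]⟩
  rw [ContinuousLinearMap.mul_apply', indicator_of_mem hp.2, indicator_of_mem h2, mul_comm]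

lemma ae_prod_ne : ∀ᵐ p ∂(μI.prod μI), p.1 ≠ p.2 := by
  have hm : MeasurableSet {p : ℝ × ℝ | p.1 = p.2} :=
    measurableSet_eq_fun (by fun_prop) (by fun_prop)
  have h : (μI.prod μI) {p : ℝ × ℝ | p.1 = p.2} = 0 := by
    rw [Measure.measure_prod_null hm]
    refine Eventually.of_forall fun x => ?_
    have hx : Prod.mk x ⁻¹' {p : ℝ × ℝ | p.1 = p.2} = {x} := by
      ext y
      exact eq_comm
    simp only [hx, Pi.zero_apply]
    exact measure_singleton x
  exact compl_mem_ae_iff.2 h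

/-- The kernel of the operator which turns `transfer (rootWeight · f)` into `𝒦_s[𝒯⁻¹ f]`. -/
def weightedKernel (a U : ℝ) (s : ℂ) (p : ℝ × ℝ) : ℂ :=
  reducedKernel a U s (p.1 - p.2) * (((rootWeight p.2)⁻¹ : ℝ) : ℂ)

variable {a U : ℝ}

lemma measurable_weightedKernel (s : ℂ) : Measurable (weightedKernel a U s) :=
  ((measurable_reducedKernel s).comp (measurable_fst.sub measurable_snd)).mul
    (Complex.measurable_ofReal.comp (measurable_rootWeight_inv.comp measurable_snd))

lemma exists_norm_weightedKernel_sq_le (hU : 0 < U) (hUa : U < a) {σ₁ : ℝ} (hσ : 0 < σ₁) :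
    ∃ C : ℝ, 0 < C ∧ ∀ s : ℂ, σ₁ ≤ s.re → ∀ᵐ p ∂(μI.prod μI), ‖weightedKernel a U s p‖ ^ 2 ≤
      C * ‖s‖ ^ 4 * ((1 + |p.1 - p.2| ^ (-(1 / 4) : ℝ)) ^ 2 * (weight p.2)⁻¹) := by
  obtain ⟨C, hC, hle⟩ := exists_norm_reducedKernel_le hU hUa hσ
  refine ⟨C ^ 2, by positivity, fun s hs => ?_⟩
  filter_upwards [ae_prod_ne] with p hp
  have h := hle s hs (p.1 - p.2) (sub_ne_zero.2 hp)
  rw [weightedKernel, norm_mul, mul_pow, Complex.norm_real, Real.norm_eq_abs, sq_abs, inv_pow,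
    sq (rootWeight p.2), rootWeight_mul_self, ← mul_assoc]
  refine mul_le_mul_of_nonneg_right ?_ (inv_nonneg.2 (weight_nonneg _))
  calc _ ≤ (C * ‖s‖ ^ 2 * (1 + |p.1 - p.2| ^ (-(1 / 4) : ℝ))) ^ 2 := by gcongr
    _ = _ := by ring

lemma memLp_weightedKernel (hU : 0 < U) (hUa : U < a) {s : ℂ} (hs : 0 < s.re) :
    MemLp (weightedKernel a U s) 2 (μI.prod μI) := by
  obtain ⟨C, -, hle⟩ := exists_norm_weightedKernel_sq_le hU hUa hs
  have hm : AEStronglyMeasurable (weightedKernel a U s) (μI.prod μI) :=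
    (measurable_weightedKernel s).aestronglyMeasurable
  rw [memLp_two_iff_integrable_sq_norm hm]
  refine (integrable_one_add_rpow_sq_mul_inv_weight.const_mul (C * ‖s‖ ^ 4)).mono'
    (hm.norm.pow 2) ?_
  filter_upwards [hle s le_rfl] with p hp
  rw [Real.norm_of_nonneg (by positivity)]
  exact hp

lemma exists_integral_norm_weightedKernel_sq_le (hU : 0 < U) (hUa : U < a) {σ₁ : ℝ}
    (hσ : 0 < σ₁) :
    ∃ C : ℝ, 0 ≤ C ∧ ∀ s : ℂ, σ₁ ≤ s.re →
      ∫ p, ‖weightedKernel a U s p‖ ^ 2 ∂(μI.prod μI) ≤ C * ‖s‖ ^ 4 := by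
  obtain ⟨C, hC, hle⟩ := exists_norm_weightedKernel_sq_le hU hUa hσ
  refine ⟨C * ∫ p : ℝ × ℝ, (1 + |p.1 - p.2| ^ (-(1 / 4) : ℝ)) ^ 2 * (weight p.2)⁻¹
    ∂(μI.prod μI), ?_, fun s hs => ?_⟩
  · refine mul_nonneg hC.le (integral_nonneg fun p => ?_)
    have := inv_nonneg.2 (weight_nonneg p.2)
    positivity
  · have hk := memLp_weightedKernel hU hUa (hσ.trans_le hs)
    refine (integral_mono_ae ((memLp_two_iff_integrable_sq_norm hk.1).1 hk)
      (integrable_one_add_rpow_sq_mul_inv_weight.const_mul (C * ‖s‖ ^ 4)) (hle s hs)).trans ?_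
    rw [integral_const_mul]
    exact le_of_eq (by ring)

/-! ### The operator `𝒩_s` -/

/-- The factor `i U / (2 (1 - M²))` in the definition of `𝒩_s`. -/
def opNConst (a U : ℝ) : ℂ := Complex.I * (U : ℂ) / ((2 * beta2 a U : ℝ) : ℂ)

lemma kernelK_mul_Tinv_ae_eq (hU : 0 < U) (hUa : U < a) {s : ℂ} (hs : 0 < s.re) (f : L2I)
    (x : ℝ) : (fun ξ => weightedKernel a U s (x, ξ) * transfer (mulRootWeight f) ξ) =ᵐ[μI]
      fun ξ => kernelK a U s x ξ * Tinv f ξ := by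
  filter_upwards [Tinv_ae_eq f, ae_restrict_of_ae (ae_ne x)] with ξ h1 h2
  rw [h1, kernelK_eq hU hUa hs h2.symm, weightedKernel]
  ring

lemma ae_integrable_kernelK_mul_Tinv (hU : 0 < U) (hUa : U < a) {s : ℂ} (hs : 0 < s.re)
    (f : L2I) : ∀ᵐ x ∂μI, Integrable (fun ξ => kernelK a U s x ξ * Tinv f ξ) μI := by
  filter_upwards [ae_memLp_section (memLp_weightedKernel hU hUa hs)] with x hx
  have h : Integrable (fun ξ => weightedKernel a U s (x, ξ) * transfer (mulRootWeight f) ξ) μI :=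
    hx.integrable_mul (Lp.memLp _)
  exact h.congr (kernelK_mul_Tinv_ae_eq hU hUa hs f x)

lemma exists_operator_and_kernel (hU : 0 < U) (hUa : U < a) {s : ℂ} (hs : 0 < s.re) :
    ∃ (T : L2I →L[ℂ] L2I) (N : ℝ → ℝ → ℂ),
      (∀ f : L2I, (T f : ℝ → ℂ) =ᵐ[μI] opN a U s f) ∧
      MemLp (fun p : ℝ × ℝ => N p.1 p.2) 2 (μI.prod μI) ∧
      (∀ f : L2I, (T f : ℝ → ℂ) =ᵐ[μI] fun x => ∫ y, N x y * f y ∂μI) ∧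
      IsCompactOperator T ∧ (ContinuousLinearMap.id ℂ L2I + T).IsFredholm ∧
      ∫ p : ℝ × ℝ, ‖N p.1 p.2‖ ^ 2 ∂(μI.prod μI) ≤
        ‖opNConst a U‖ ^ 2 * ∫ p, ‖weightedKernel a U s p‖ ^ 2 ∂(μI.prod μI) := by
  have hk := memLp_weightedKernel hU hUa hs
  obtain ⟨N, hN, hNle⟩ := exists_hasSum_tensor (hk.toLp _)
  have happly : ∀ f, ((opNConst a U • (hsOp N ∘L mulRootWeight)) f : ℝ → ℂ) =ᵐ[μI]
      fun x => opNConst a U * hsOp N (mulRootWeight f) x := fun f => by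
    filter_upwards [Lp.coeFn_smul (opNConst a U) (hsOp N (mulRootWeight f))] with x hx
    exact hx
  have hbound : ∀ p : ℝ × ℝ, ‖opNConst a U * N p * ((rootWeight p.2 : ℝ) : ℂ)‖ ≤
      ‖opNConst a U * N p‖ := fun p => by
    rw [norm_mul _ ((rootWeight p.2 : ℝ) : ℂ), Complex.norm_real,
      Real.norm_of_nonneg (rootWeight_nonneg _)]
    exact mul_le_of_le_one_right (norm_nonneg _) (rootWeight_le_one _)
  have hmem : MemLp (fun p : ℝ × ℝ => opNConst a U * N p * ((rootWeight p.2 : ℝ) : ℂ)) 2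
      (μI.prod μI) := by
    refine ((Lp.memLp N).const_mul (opNConst a U)).of_le
      (((Lp.aestronglyMeasurable N).const_mul _).mul (Complex.measurable_ofReal.comp
        (continuous_rootWeight.measurable.comp measurable_snd)).aestronglyMeasurable)
      (Eventually.of_forall hbound)
  refine ⟨opNConst a U • (hsOp N ∘L mulRootWeight),
    fun x y => opNConst a U * N (x, y) * ((rootWeight y : ℝ) : ℂ), fun f => ?_, hmem, fun f => ?_,
    ?_, ?_, ?_⟩
  · filter_upwards [happly f, coeFn_hsOp (hk.toLp _) (transfer (mulRootWeight f)),
      Measure.ae_ae_of_ae_prod hk.coeFn_toLp] with x h1 h2 h3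
    rw [h1, hsOp_eq_comp_transfer hN, h2, opN, opK, opNConst]
    congr 1
    refine integral_congr_ae (EventuallyEq.trans ?_ (kernelK_mul_Tinv_ae_eq hU hUa hs f x))
    filter_upwards [h3] with y hy
    rw [hy]
  · filter_upwards [happly f, coeFn_hsOp N (mulRootWeight f)] with x h1 h2
    rw [h1, h2, ← integral_const_mul]
    refine integral_congr_ae ?_
    filter_upwards [coeFn_mulRootWeight f] with y hy
    rw [hy]
    ring
  · have hc : IsCompactOperator (hsOp N) :=
      isCompactOperator_of_tendsto (l := atTop) (hN.mapL hsOp) (Eventually.of_forall fun t =>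
        isCompactOperator_of_hasNoetherianRange (by
          rw [ContinuousLinearMap.toLinearMap_sum]
          exact Submodule.sum_mem (LinearMap.finiteRange ℂ L2I L2I)
            fun n _ => hasNoetherianRange_hsOp_tensor _ _))
    exact (hc.comp_clm mulRootWeight).smul (opNConst a U)
  · set c := ‖opNConst a U‖ * ‖mulRootWeight‖ with hcdef
    obtain ⟨A, hA, hlt⟩ := exists_hasNoetherianRange_norm_sub_lt hN
      (δ := (c + 1)⁻¹) (by positivity)
    refine isFredholm_id_add (A := opNConst a U • (A ∘L mulRootWeight)) ?_ ?_
    · have h1 : ((A ∘L mulRootWeight : L2I →L[ℂ] L2I) : L2I →ₗ[ℂ] L2I).HasNoetherianRange :=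
        hA.comp_right _
      rw [ContinuousLinearMap.toLinearMap_smul]
      exact h1.smul (opNConst a U)
    · have h1 : opNConst a U • (hsOp N ∘L mulRootWeight) - opNConst a U • (A ∘L mulRootWeight) =
          opNConst a U • ((hsOp N - A) ∘L mulRootWeight) := by
        rw [← smul_sub, ContinuousLinearMap.sub_comp]
      rw [h1, norm_smul]
      calc _ ≤ ‖opNConst a U‖ * (‖hsOp N - A‖ * ‖mulRootWeight‖) := by
            gcongr
            exact ContinuousLinearMap.opNorm_comp_le _ _
        _ = c * ‖hsOp N - A‖ := by rw [hcdef]; ring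
        _ ≤ c * (c + 1)⁻¹ := by gcongr
        _ < 1 := by
            rw [← div_eq_mul_inv, div_lt_one (by positivity)]
            linarith
  · have h1 : ∫ p, ‖weightedKernel a U s p‖ ^ 2 ∂(μI.prod μI) = ‖hk.toLp _‖ ^ 2 :=
      (norm_toLp_sq hk).symm
    have h2 := (Lp.memLp N).const_mul (opNConst a U)
    calc _ ≤ ∫ p, ‖opNConst a U * N p‖ ^ 2 ∂(μI.prod μI) :=
          integral_mono ((memLp_two_iff_integrable_sq_norm hmem.1).1 hmem)
            ((memLp_two_iff_integrable_sq_norm h2.1).1 h2)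
            fun p => pow_le_pow_left₀ (norm_nonneg _) (hbound p) 2
      _ = ‖opNConst a U‖ ^ 2 * ‖N‖ ^ 2 := by
          simp only [norm_mul, mul_pow]
          rw [integral_const_mul, norm_sq_eq_integral]
      _ ≤ _ := by
          rw [h1]
          gcongr

end

end Possio

theorem proposition5p2 (a U : ℝ) (hU : 0 < U) (hUa : U < a) :
    -- all limits and integrals in the definition of `𝒩_s` exist
    (∀ s : ℂ, 0 < s.re →
      (∀ x ξ : ℝ, x ≠ ξ →
        (∀ y : ℝ, 0 < y →
          DifferentiableAt ℝ (fun x' : ℝ => Possio.hankel0 (Possio.waveArg a U s ξ y x')) x ∧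
          IntegrableOn (fun u : ℝ => Complex.exp (-(Possio.lam a U s * (u : ℂ))) *
            Possio.hankel0 (Possio.waveArg a U s ξ y u)) (Iic x)) ∧
        Tendsto (fun y : ℝ => Possio.prePossio a U s x ξ y) (𝓝[>] (0 : ℝ))
          (𝓝 (Possio.possioKernel a U s x ξ))) ∧
      (∀ f : Possio.L2I,
        (∀ᵐ x ∂Possio.μI,
          Tendsto (Possio.truncTinv f x) (𝓝[>] (0 : ℝ)) (𝓝 (Possio.Tinv f x))) ∧
        (∀ᵐ x ∂Possio.μI,
          Integrable (fun ξ : ℝ => Possio.kernelK a U s x ξ * Possio.Tinv f ξ) Possio.μI))) ∧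
    ∃ (𝒩 : ℂ → (Possio.L2I →L[ℂ] Possio.L2I)) (N : ℂ → ℝ → ℝ → ℂ),
      (∀ s : ℂ, 0 < s.re →
        -- `𝒩 s` is the operator `const · 𝒦_s ∘ 𝒯⁻¹`
        (∀ f : Possio.L2I, (𝒩 s f : ℝ → ℂ) =ᵐ[Possio.μI] Possio.opN a U s f) ∧
        -- it is a Hilbert-Schmidt integral operator with kernel `N s`
        MemLp (fun p : ℝ × ℝ => N s p.1 p.2) 2 (Possio.μI.prod Possio.μI) ∧
        (∀ f : Possio.L2I, (𝒩 s f : ℝ → ℂ) =ᵐ[Possio.μI]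
          fun x => ∫ y, N s x y * f y ∂Possio.μI) ∧
        IsCompactOperator (𝒩 s) ∧
        (ContinuousLinearMap.id ℂ Possio.L2I + 𝒩 s).IsFredholm) ∧
      (∀ σ₁ : ℝ, 0 < σ₁ → ∃ C : ℝ, 0 < C ∧ ∀ s : ℂ, σ₁ ≤ s.re →
        ∫ p : ℝ × ℝ, ‖N s p.1 p.2‖ ^ 2 ∂(Possio.μI.prod Possio.μI) < C * ‖s‖ ^ 4) := by

  refine ⟨fun s hs => ⟨fun x ξ hne => ⟨fun y hy =>
    ⟨(Possio.hasDerivAt_hankel0_waveArg hU hUa hs ξ x hy).differentiableAt,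
      Possio.integrableOn_exp_mul_hankel0 hU hUa hs x ξ hy⟩, ?_⟩, fun f => ⟨?_,
        Possio.ae_integrable_kernelK_mul_Tinv hU hUa hs f⟩⟩, ?_⟩
  · rw [Possio.possioKernel_eq hU hUa hs hne]
    exact Possio.tendsto_prePossio hU hUa hs hne
  · filter_upwards [Possio.ae_tendsto_truncTinv f] with x hx
    exact tendsto_nhds_limUnder ⟨_, hx⟩
  · choose T N hT using fun s : {s : ℂ // 0 < s.re} =>
      Possio.exists_operator_and_kernel hU hUa s.2
    classical
    refine ⟨fun s => if hs : 0 < s.re then T ⟨s, hs⟩ else 0,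
      fun s => if hs : 0 < s.re then N ⟨s, hs⟩ else 0, fun s hs => ?_, fun σ₁ hσ => ?_⟩
    · simp only [dif_pos hs]
      obtain ⟨h1, h2, h3, h4, h5, -⟩ := hT ⟨s, hs⟩
      exact ⟨h1, h2, h3, h4, h5⟩
    · obtain ⟨C, hC, hle⟩ := Possio.exists_integral_norm_weightedKernel_sq_le hU hUa hσ
      refine ⟨‖Possio.opNConst a U‖ ^ 2 * C + 1, by positivity, fun s hs => ?_⟩
      have hre : 0 < s.re := hσ.trans_le hs
      have hs4 : 0 < ‖s‖ ^ 4 := pow_pos (hre.trans_le (Complex.re_le_norm s)) 4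
      simp only [dif_pos hre]
      calc _ ≤ _ := (hT ⟨s, hre⟩).2.2.2.2.2
        _ ≤ ‖Possio.opNConst a U‖ ^ 2 * (C * ‖s‖ ^ 4) := by
            gcongr
            exact hle s hs
        _ < _ := by linarith
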